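/- Theorem 1.2 (subgraph counts in the Erdős–Rényi random graph, general result). Let $G_0$ be a finite simple graph with at least one edge, and let $v_{G_0}$, $e_{G_0}$ and $\mathrm{aut}_{G_0}$ be its numbers of vertices, edges and automorphisms. Let $n \ge 4 v_{G_0}^2$ be an integer, $p \in (0,1)$, $q := 1-p$, and let $G(n,p)$ be the random graph on $n$ vertices in which each possible edge is present with probability $p$, independently of all others. A copy of $G_0$ in a graph is a (not necessarily induced) subgraph of it that is isomorphic to $G_0$. Let $X$ be the number of copies of $G_0$ in $G(n,p)$, let $\sigma := \sqrt{\operatorname{Var}(X)}$, and let $W := (X - \mathbb{E}[X])/\sigma$. Let $D$ be the number of copies of $G_0$ in the complete graph on the $n$ vertices that have at least one edge in common with a given such copy $\Gamma$ ($\Gamma$ itself included); by symmetry this number does not depend on $\Gamma$. Further let $$\Psi_{\min} := \min_{H \subset G_0,\ e_H \ge 1} n^{v_H} p^{e_H},$$ the minimum being over all subgraphs $H$ of $G_0$ with at least one edge, where $v_H$ and $e_H$ are the numbers of vertices and edges of $H$. Let $\Phi$ be the distribution function of the standard normal distribution. Then for all $t \ge 0$ $$\left| \frac{\mathbb{P}(W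 > t)}{1 - \Phi(t)} - 1 \right| \le 50\, c_{G_0} \cdot \exp\big( c_{G_0}\, t^2\, s(t) \big) \cdot (1+t^2) \cdot s(t),$$ where $$s(t) = \left( 1 + \frac{t}{\min\{\sqrt{\Psi_{\min}},\, 1\}} \right) \frac{1}{\sqrt{q \Psi_{\min}}} \cdot \exp\left( \frac{5 D t}{\sigma} \right) \quad\text{and}\quad c_{G_0} = \frac{2^{\frac92 + \frac{15}{2} e_{G_0}} \cdot (v_{G_0}!)^4 \cdot e_{G_0}}{\mathrm{aut}_{G_0}^{3/2}}.$$ -/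

import Mathlib

open MeasureTheory ProbabilityTheory

namespace SubgraphCount

/-- The set of possible copies of `G₀` on the vertex set `{0, …, n - 1}`: the subgraphs of the
complete graph on these vertices (a set of vertices together with a set of edges) that are
isomorphic to `G₀`. -/
def copies {V : Type*} (G₀ : SimpleGraph V) (n : ℕ) :
    Set (⊤ : SimpleGraph (Fin n)).Subgraph :=
  {Γ | Nonempty (G₀ ≃g Γ.coe)}

/-- The neighborhood of a subgraph `Γ` of the complete graph: all possible copies of `G₀` that
have at least one edge in common with `Γ`. -/
def neighborhood {V : Type*} (G₀ : SimpleGraph V) (n : ℕ)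
    (Γ : (⊤ : SimpleGraph (Fin n)).Subgraph) : Set (⊤ : SimpleGraph (Fin n)).Subgraph :=
  {Γ' ∈ copies G₀ n | (Γ'.edgeSet ∩ Γ.edgeSet).Nonempty}

/-- `D`: the common cardinality of the neighborhoods of the copies `Γ` of `G₀`, written as a
supremum of finitely many equal numbers (see `neighborhood_ncard_eq` and `D_eq`). -/
noncomputable def D {V : Type*} (G₀ : SimpleGraph V) (n : ℕ) : ℕ :=
  ⨆ Γ : copies G₀ n, (neighborhood G₀ n Γ.1).ncard

open Classical in
/-- An isomorphism between two subgraphs of a finite complete graph extends to a permutation of the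
vertices. -/
theorem exists_perm_map_eq {n : ℕ} {Γ Γ' : (⊤ : SimpleGraph (Fin n)).Subgraph}
    (e : Γ.coe ≃g Γ'.coe) :
    ∃ π : (⊤ : SimpleGraph (Fin n)) ≃g (⊤ : SimpleGraph (Fin n)), Γ.map π.toHom = Γ' := by
  let π : Equiv.Perm (Fin n) :=
    Equiv.extendSubtype (p := fun x ↦ x ∈ Γ.verts) (q := fun x ↦ x ∈ Γ'.verts) e.toEquiv
  have hπ : ∀ x (hx : x ∈ Γ.verts), π x = e ⟨x, hx⟩ := fun x hx ↦
    Equiv.extendSubtype_apply_of_mem _ x hx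
  have hadj : ∀ x y, Γ.Adj x y → Γ'.Adj (π x) (π y) := by
    intro x y h
    rw [hπ x h.fst_mem, hπ y h.snd_mem]
    exact e.map_adj_iff.2 (show Γ.coe.Adj ⟨x, h.fst_mem⟩ ⟨y, h.snd_mem⟩ from h)
  refine ⟨SimpleGraph.Iso.completeGraph π, ?_⟩
  ext x y
  · simp only [SimpleGraph.Subgraph.map_verts, Set.mem_image]
    constructor
    · rintro ⟨v, hv, rfl⟩
      change π v ∈ _
      rw [hπ v hv]
      exact (e ⟨v, hv⟩).2
    · intro hx
      refine ⟨e.symm ⟨x, hx⟩, (e.symm ⟨x, hx⟩).2, ?_⟩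
      change π _ = _
      rw [hπ _ (e.symm ⟨x, hx⟩).2]
      simp
  · simp only [SimpleGraph.Subgraph.map_adj, Relation.Map]
    constructor
    · rintro ⟨a, b, h, rfl, rfl⟩
      exact hadj a b h
    · intro h
      refine ⟨e.symm ⟨x, h.fst_mem⟩, e.symm ⟨y, h.snd_mem⟩, ?_, ?_, ?_⟩
      · exact e.symm.map_adj_iff.2
          (show Γ'.coe.Adj ⟨x, h.fst_mem⟩ ⟨y, h.snd_mem⟩ from h)
      · change π _ = _
        rw [hπ _ (e.symm ⟨x, h.fst_mem⟩).2]
        simp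
      · change π _ = _
        rw [hπ _ (e.symm ⟨y, h.snd_mem⟩).2]
        simp

theorem map_injective {n : ℕ} (π : (⊤ : SimpleGraph (Fin n)) ≃g (⊤ : SimpleGraph (Fin n))) :
    Function.Injective fun Γ : (⊤ : SimpleGraph (Fin n)).Subgraph ↦ Γ.map π.toHom := by
  refine Function.LeftInverse.injective (g := fun Γ ↦ Γ.map π.symm.toHom) fun Γ ↦ ?_
  change (Γ.map π.toHom).map π.symm.toHom = Γ
  rw [← SimpleGraph.Subgraph.map_comp]
  convert Γ.map_id
  ext x
  simp [SimpleGraph.Hom.id]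

theorem map_mem_copies {V : Type*} {G₀ : SimpleGraph V} {n : ℕ}
    (π : (⊤ : SimpleGraph (Fin n)) ≃g (⊤ : SimpleGraph (Fin n)))
    {Γ : (⊤ : SimpleGraph (Fin n)).Subgraph} (h : Γ ∈ copies G₀ n) :
    Γ.map π.toHom ∈ copies G₀ n := by
  obtain ⟨f⟩ := h
  refine ⟨f.trans ⟨Equiv.Set.image π Γ.verts π.injective, ?_⟩⟩
  intro a b
  simp only [SimpleGraph.Subgraph.coe_adj, SimpleGraph.Subgraph.map_adj, Relation.Map]
  constructor
  · rintro ⟨x, y, h, hx, hy⟩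
    have hx' : x = a := π.injective hx
    have hy' : y = b := π.injective hy
    exact hx' ▸ hy' ▸ h
  · intro h
    exact ⟨a, b, h, rfl, rfl⟩

theorem neighborhood_ncard_le {V : Type*} {G₀ : SimpleGraph V} {n : ℕ}
    {Γ Γ' : (⊤ : SimpleGraph (Fin n)).Subgraph} (h : Γ ∈ copies G₀ n) (h' : Γ' ∈ copies G₀ n) :
    (neighborhood G₀ n Γ).ncard ≤ (neighborhood G₀ n Γ').ncard := by
  obtain ⟨f⟩ := h
  obtain ⟨f'⟩ := h'
  obtain ⟨π, hπ⟩ := exists_perm_map_eq (f.symm.trans f')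
  refine Set.ncard_le_ncard_of_injOn (fun Δ ↦ Δ.map π.toHom) ?_ (map_injective π).injOn
    (Set.toFinite _)
  rintro Δ ⟨hΔ, e, he₁, he₂⟩
  refine ⟨map_mem_copies π hΔ, Sym2.map π.toHom e, ?_, ?_⟩
  · rw [SimpleGraph.Subgraph.edgeSet_map]
    exact Set.mem_image_of_mem _ he₁
  · rw [← hπ, SimpleGraph.Subgraph.edgeSet_map]
    exact Set.mem_image_of_mem _ he₂

/-- The cardinality of the neighborhood of a copy does not depend on the copy. -/
theorem neighborhood_ncard_eq {V : Type*} {G₀ : SimpleGraph V} {n : ℕ}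
    {Γ Γ' : (⊤ : SimpleGraph (Fin n)).Subgraph} (h : Γ ∈ copies G₀ n) (h' : Γ' ∈ copies G₀ n) :
    (neighborhood G₀ n Γ).ncard = (neighborhood G₀ n Γ').ncard :=
  (neighborhood_ncard_le h h').antisymm (neighborhood_ncard_le h' h)

/-- `D` is the cardinality of the neighborhood of any copy of `G₀`. -/
theorem D_eq {V : Type*} {G₀ : SimpleGraph V} {n : ℕ}
    {Γ : (⊤ : SimpleGraph (Fin n)).Subgraph} (h : Γ ∈ copies G₀ n) :
    D G₀ n = (neighborhood G₀ n Γ).ncard := by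
  have : Nonempty (copies G₀ n) := ⟨⟨Γ, h⟩⟩
  rw [D, ← ciSup_const (ι := copies G₀ n) (a := (neighborhood G₀ n Γ).ncard)]
  exact iSup_congr fun Γ' ↦ neighborhood_ncard_eq Γ'.2 h

/-- The number of copies of `G₀` in a graph `G` on `n` vertices: the number of subgraphs of `G`,
induced or not, that are isomorphic to `G₀`. -/
noncomputable def count {V : Type*} (G₀ : SimpleGraph V) {n : ℕ} (G : SimpleGraph (Fin n)) : ℝ :=
  (G.copyCount G₀ : ℝ)

/-- The standard deviation `σ` of the number of copies of `G₀` in `G(n,p)`. -/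
noncomputable def sigma {V : Type*} (G₀ : SimpleGraph V) (n : ℕ) (p : unitInterval) : ℝ :=
  √(Var[fun G ↦ count G₀ G; SimpleGraph.binomialRandom (Fin n) p])

/-- The standardized number `W` of copies of `G₀` in `G(n,p)`, a random variable on the
probability space of all graphs on `n` vertices with the law of `G(n,p)`. -/
noncomputable def W {V : Type*} (G₀ : SimpleGraph V) (n : ℕ) (p : unitInterval)
    (G : SimpleGraph (Fin n)) : ℝ :=
  (count G₀ G - ∫ G', count G₀ G' ∂(SimpleGraph.binomialRandom (Fin n) p)) / sigma G₀ n p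

/-- `Ψ_min`: the minimum of `n ^ v_H * p ^ e_H` over all subgraphs `H` of `G₀` with at least one
edge. -/
noncomputable def psiMin {V : Type*} (G₀ : SimpleGraph V) (n : ℕ) (p : unitInterval) : ℝ :=
  ⨅ H : {H : G₀.Subgraph // H.edgeSet.Nonempty},
    (n : ℝ) ^ H.1.verts.ncard * (p : ℝ) ^ H.1.edgeSet.ncard

/-- The constant `c_{G₀}`. -/
noncomputable def c {V : Type*} (G₀ : SimpleGraph V) : ℝ :=
  (2 : ℝ) ^ ((9 / 2 : ℝ) + 15 / 2 * (G₀.edgeSet.ncard : ℝ)) * ((Nat.card V).factorial : ℝ) ^ 4 *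
    (G₀.edgeSet.ncard : ℝ) / (Nat.card (G₀ ≃g G₀) : ℝ) ^ (3 / 2 : ℝ)

/-- The function `s(t)`, in which `q = 1 - p`. -/
noncomputable def s {V : Type*} (G₀ : SimpleGraph V) (n : ℕ) (p : unitInterval) (t : ℝ) : ℝ :=
  (1 + t / min (√(psiMin G₀ n p)) 1) * (1 / √((1 - (p : ℝ)) * psiMin G₀ n p)) *
    Real.exp (5 * (D G₀ n : ℝ) * t / sigma G₀ n p)

end SubgraphCount

/-!
Size biasing and Stein's method. A copy of `G₀` is a set of `e` possible edges, and the count `X`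
is the number of members of a finite family `A` of such sets that are contained in a random set
`ω`, so most of the proof is about a family of finite sets (namespace `RandomSubset`).

Conditioning on `A i ⊆ ω` amounts to replacing `ω` with `ω ∪ A i` (`ev_ind_mul`), which only
increases `X`. Hence `E[(X - E X) F(X)]` is `p ^ e` times the sum over `i` of the mean of
`F(X(ω ∪ A i)) - F(X(ω))`: Stein's identity with a nonnegative kernel (`ev_total_sub_mul`). If the
derivative `g` of `F` is increasing, then the error in Stein's identity for `W` is at most
`E[|g(W)| Q]`, in which `Q = |massDev| + |nearDev|` does not depend on `F`
(`abs_ev_std_mul_sub_le`). There are two applications: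

* For `F = exp (u ·)` it becomes a differential inequality for `E[exp (u W)]`. If
  `E[Q exp (u W)] ≤ δ E[exp (u W)]` for all `u ≤ t`, then `E[exp (u W)] ≤ exp ((1 + δ) u² / 2)`
  (`ev_exp_std_le`).
* The solution `f` of Stein's equation for the half-line up to `t` is not convex, but the sum
  `steinPrimitive` of `f`, `(w - t)⁺` and a linear function is, and its derivative is `w f(w)`.
  The function `(w - t)⁺` is convex as well, so that the error in the tail probability is at most
  `E[(|W f(W)| + 1_{W > t}) Q]`. The factor of `Q` is dominated by a combination of exponentials
  `exp (u W)` with `0 ≤ u ≤ t`, the total size of which is `1 - Φ(t)` up to a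
  factor of order `1 + t²`.

Together they bound the relative error of the tail probability by a multiple of `δ`
(`abs_tail_div_sub_one_le`).

To find `δ`, both parts of `Q` are written as sums of centred local terms, indexed by the pairs of
members of `A` that meet (`IsLocalField`). Under the weight `exp (u W)`, distant terms are
correlated only through the few members of `A` that link them, so the weighted second moment of
such a sum is bounded by an explicit term and a multiple of the weighted first moment. With the
Cauchy–Schwarz inequality this is a quadratic inequality for the first moment
(`ev_abs_sum_mul_exp_le`). What enters is, besides the number `D` of members meeting a given one,
the expected number `attach A p U` of members meeting a union `U` of up to four members, given that
`U` is present.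

The graph-theoretic input consists of a bound on `attach`, by counting the embeddings of the
vertices according to which of them land on endpoints of `U` (`attach_copyEdges_le`), and a lower bound
for the variance, from the pairs of copies that share a subgraph attaining the minimum in `Ψ_min`
(`le_sigma_sq`). Everything else is a comparison of constants; if the claimed bound has
`c * s t ≥ 1`, then the reciprocal of `1 - Φ(t)` already is a sufficient bound.
-/

/-! ### Expectation over a random subset of a finite set -/

namespace RandomSubset

open Finset

variable {α : Type*} [DecidableEq α]

/-- The indicator of the event that the random subset contains `U`. -/
noncomputable def ind (U ω : Finset α) : ℝ :=
  if U ⊆ ω then 1 else 0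

theorem ind_nonneg (U ω : Finset α) : 0 ≤ ind U ω := by
  unfold ind; split_ifs <;> norm_num

theorem ind_le_one (U ω : Finset α) : ind U ω ≤ 1 := by
  unfold ind; split_ifs <;> norm_num

theorem ind_mul_ind (U V ω : Finset α) : ind U ω * ind V ω = ind (U ∪ V) ω := by
  unfold ind
  by_cases h : U ⊆ ω <;> by_cases h' : V ⊆ ω <;> simp [h, h', union_subset_iff]

theorem ind_mono (U : Finset α) {ω ω' : Finset α} (h : ω ⊆ ω') : ind U ω ≤ ind U ω' := by
  unfold ind
  split_ifs with h1 h2 h2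
  · rfl
  · exact absurd (h1.trans h) h2
  · norm_num
  · rfl

theorem ind_union_right (U V ω : Finset α) : ind U (ω ∪ V) = ind (U \ V) ω := by
  unfold ind
  congr 1
  rw [union_comm]
  exact propext (sdiff_le_iff (a := U) (b := V) (c := ω)).symm

theorem ind_inter {U V : Finset α} (h : U ⊆ V) (ω : Finset α) : ind U (ω ∩ V) = ind U ω := by
  unfold ind
  simp [subset_inter_iff, h]

theorem ind_sdiff_of_disjoint {U V : Finset α} (h : Disjoint U V) (ω : Finset α) :
    ind U (ω \ V) = ind U ω := by
  unfold ind
  simp [subset_sdiff, h]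

theorem ind_sdiff_of_not_disjoint {U V : Finset α} (h : ¬ Disjoint U V) (ω : Finset α) :
    ind U (ω \ V) = 0 := by
  unfold ind
  simp [subset_sdiff, h]

variable [Fintype α]

/-- The probability of the outcome `ω` for the random subset of `α` that contains each element with
probability `p`, independently of the others. -/
noncomputable def weight (p : ℝ) (ω : Finset α) : ℝ :=
  ∏ e, if e ∈ ω then p else 1 - p

/-- The expectation of `F` under the law of the random subset of `α` with parameter `p`. -/
noncomputable def ev (p : ℝ) (F : Finset α → ℝ) : ℝ :=
  ∑ ω, weight p ω * F ω

theorem weight_eq (p : ℝ) (ω : Finset α) : weight p ω = p ^ #ω * (1 - p) ^ #ωᶜ := by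
  unfold weight
  rw [prod_ite, prod_const, prod_const]
  congr 3
  · ext; simp
  · ext; simp

theorem sum_prod_ite (f g : α → ℝ) :
    ∑ ω : Finset α, ∏ e, (if e ∈ ω then f e else g e) = ∏ e, (f e + g e) := by
  rw [prod_add, powerset_univ]
  refine sum_congr rfl fun ω _ ↦ ?_
  rw [prod_ite]
  congr 1
  · exact prod_congr (by ext; simp) fun _ _ ↦ rfl
  · exact prod_congr (by ext; simp) fun _ _ ↦ rfl

theorem sum_weight (p : ℝ) : ∑ ω : Finset α, weight p ω = 1 := by
  unfold weight
  rw [sum_prod_ite (fun _ ↦ p) (fun _ ↦ 1 - p)]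
  simp

theorem ev_ind (p : ℝ) (U : Finset α) : ev p (ind U) = p ^ #U := by
  have h : ∀ ω : Finset α, weight p ω * ind U ω =
      ∏ e, (if e ∈ ω then p else if e ∈ U then 0 else 1 - p) := by
    intro ω
    unfold ind weight
    split_ifs with hU
    · rw [mul_one]
      refine prod_congr rfl fun e _ ↦ ?_
      by_cases he : e ∈ ω
      · simp [he]
      · have : e ∉ U := fun h ↦ he (hU h)
        simp [he, this]
    · obtain ⟨e, he, he'⟩ := not_subset.1 hU
      rw [mul_zero]
      symm
      exact prod_eq_zero (mem_univ e) (by simp [he, he'])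
  unfold ev
  rw [sum_congr rfl fun ω _ ↦ h ω, sum_prod_ite]
  have : ∀ e, (p + if e ∈ U then 0 else 1 - p) = if e ∈ U then p else 1 := by
    intro e; split_ifs <;> ring
  simp_rw [this]
  rw [prod_ite]
  simp

section Basic

variable {p : ℝ}

theorem ev_const (p c : ℝ) : ev p (fun _ : Finset α ↦ c) = c := by
  unfold ev; rw [← sum_mul, sum_weight, one_mul]

theorem ev_add (F G : Finset α → ℝ) : ev p (fun ω ↦ F ω + G ω) = ev p F + ev p G := by
  unfold ev; rw [← sum_add_distrib]; exact sum_congr rfl fun _ _ ↦ by ring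

theorem ev_sub (F G : Finset α → ℝ) : ev p (fun ω ↦ F ω - G ω) = ev p F - ev p G := by
  unfold ev; rw [← sum_sub_distrib]; exact sum_congr rfl fun _ _ ↦ by ring

theorem ev_const_mul (c : ℝ) (F : Finset α → ℝ) : ev p (fun ω ↦ c * F ω) = c * ev p F := by
  unfold ev; rw [mul_sum]; exact sum_congr rfl fun _ _ ↦ by ring

theorem ev_mul_const (c : ℝ) (F : Finset α → ℝ) : ev p (fun ω ↦ F ω * c) = ev p F * c := by
  unfold ev; rw [sum_mul]; exact sum_congr rfl fun _ _ ↦ by ring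

theorem ev_sum {ι : Type*} (s : Finset ι) (F : ι → Finset α → ℝ) :
    ev p (fun ω ↦ ∑ i ∈ s, F i ω) = ∑ i ∈ s, ev p (F i) := by
  unfold ev
  simp_rw [mul_sum]
  rw [sum_comm]

theorem weight_nonneg (hp : 0 ≤ p) (hp1 : p ≤ 1) (ω : Finset α) : 0 ≤ weight p ω :=
  prod_nonneg fun _ _ ↦ by split_ifs <;> linarith

theorem ev_mono (hp : 0 ≤ p) (hp1 : p ≤ 1) {F G : Finset α → ℝ} (h : ∀ ω, F ω ≤ G ω) :
    ev p F ≤ ev p G :=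
  sum_le_sum fun ω _ ↦ mul_le_mul_of_nonneg_left (h ω) (weight_nonneg hp hp1 ω)

theorem ev_nonneg (hp : 0 ≤ p) (hp1 : p ≤ 1) {F : Finset α → ℝ} (h : ∀ ω, 0 ≤ F ω) :
    0 ≤ ev p F :=
  sum_nonneg fun ω _ ↦ mul_nonneg (weight_nonneg hp hp1 ω) (h ω)

theorem abs_ev_le (hp : 0 ≤ p) (hp1 : p ≤ 1) (F : Finset α → ℝ) :
    |ev p F| ≤ ev p (fun ω ↦ |F ω|) := by
  refine (abs_sum_le_sum_abs _ _).trans (le_of_eq (sum_congr rfl fun ω _ ↦ ?_))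
  rw [abs_mul, abs_of_nonneg (weight_nonneg hp hp1 ω)]

/-- Two functions of a random subset are independent if one only looks inside `U` and the other one
only looks outside `U`. -/
theorem ev_mul_of_indep (U : Finset α) {F G : Finset α → ℝ} (hF : ∀ ω, F (ω ∩ U) = F ω)
    (hG : ∀ ω, G (ω \ U) = G ω) : ev p (fun ω ↦ F ω * G ω) = ev p F * ev p G := by
  -- Exchanging the parts outside `U` of two independent outcomes preserves their joint law.
  let φ : Finset α × Finset α → Finset α × Finset α := fun x ↦
    ((x.1 ∩ U) ∪ (x.2 \ U), (x.2 ∩ U) ∪ (x.1 \ U))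
  have hφ : Function.Involutive φ := by
    rintro ⟨a, b⟩
    simp only [φ, Prod.mk.injEq]
    constructor <;> ext x <;> by_cases hx : x ∈ U <;> simp [hx]
  have hw : ∀ x, weight p (φ x).1 * weight p (φ x).2 = weight p x.1 * weight p x.2 := by
    rintro ⟨a, b⟩
    simp only [φ, weight, ← prod_mul_distrib]
    refine prod_congr rfl fun e _ ↦ ?_
    by_cases he : e ∈ U
    · simp [he]
    · simp [he, mul_comm]
  have hφF : ∀ x, F (φ x).1 = F x.1 := by
    intro x
    rw [← hF, ← hF x.1]
    congr 1
    ext y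
    by_cases hy : y ∈ U <;> simp [φ, hy]
  have hφG : ∀ x, G (φ x).1 = G x.2 := by
    intro x
    rw [← hG, ← hG x.2]
    congr 1
    ext y
    by_cases hy : y ∈ U <;> simp [φ, hy]
  calc ev p (fun ω ↦ F ω * G ω)
      = ∑ x : Finset α × Finset α, weight p x.1 * weight p x.2 * (F x.1 * G x.1) := by
        rw [Fintype.sum_prod_type]
        refine sum_congr rfl fun ω _ ↦ ?_
        simp only
        rw [← sum_mul, ← mul_sum, sum_weight, mul_one]
    _ = ∑ x : Finset α × Finset α,
          weight p (φ x).1 * weight p (φ x).2 * (F (φ x).1 * G (φ x).1) :=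
        (hφ.bijective.sum_comp
          (fun x ↦ weight p x.1 * weight p x.2 * (F x.1 * G x.1))).symm
    _ = ∑ x : Finset α × Finset α, weight p x.1 * weight p x.2 * (F x.1 * G x.2) := by
        simp_rw [hw, hφF, hφG]
    _ = ev p F * ev p G := by
        rw [Fintype.sum_prod_type, ev, ev, sum_mul_sum]
        exact sum_congr rfl fun _ _ ↦ sum_congr rfl fun _ _ ↦ by ring

/-- Conditioning on `U ⊆ ω` amounts to adding `U` to the random subset. -/
theorem ev_ind_mul (U : Finset α) (F : Finset α → ℝ) :
    ev p (fun ω ↦ ind U ω * F ω) = p ^ #U * ev p (fun ω ↦ F (ω ∪ U)) := by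
  rw [← ev_ind, ← ev_mul_of_indep U (F := ind U) (G := fun ω ↦ F (ω ∪ U))
    (fun ω ↦ ind_inter subset_rfl ω) (fun ω ↦ by rw [sdiff_union_self_eq_union])]
  congr 1
  ext ω
  unfold ind
  split_ifs with h
  · rw [union_eq_left.2 h]
  · simp

/-- The Cauchy–Schwarz inequality with respect to a nonnegative density `H`. -/
theorem ev_abs_mul_sq_le (hp : 0 ≤ p) (hp1 : p ≤ 1) (F : Finset α → ℝ) {H : Finset α → ℝ}
    (hH : ∀ ω, 0 ≤ H ω) :
    ev p (fun ω ↦ |F ω| * H ω) ^ 2 ≤ ev p H * ev p (fun ω ↦ F ω ^ 2 * H ω) := by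
  have h := sum_mul_sq_le_sq_mul_sq univ (fun ω : Finset α ↦ √(weight p ω * H ω))
    (fun ω ↦ √(weight p ω * H ω) * |F ω|)
  have hn : ∀ ω, 0 ≤ weight p ω * H ω := fun ω ↦ mul_nonneg (weight_nonneg hp hp1 ω) (hH ω)
  simp_rw [mul_pow, ← mul_assoc, Real.mul_self_sqrt (hn _), Real.sq_sqrt (hn _), sq_abs] at h
  have h1 : ∀ ω, weight p ω * (|F ω| * H ω) = weight p ω * H ω * |F ω| := fun ω ↦ by ring
  simp only [ev, h1, ← mul_assoc] at h ⊢
  refine h.trans (le_of_eq ?_)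
  congr 1
  exact sum_congr rfl fun _ _ ↦ by ring

end Basic

end RandomSubset

/-! ### Counting the members of a family that are contained in a random set -/

namespace RandomSubset

open Finset

variable {α : Type*} [DecidableEq α] {I : Type*} [Fintype I]

/-- The indices of the members of the family `A` that have an element in common with `U`. -/
def meets (A : I → Finset α) (U : Finset α) : Finset I :=
  univ.filter fun j ↦ ¬ Disjoint (A j) U

/-- The pairs of indices whose members of the family `A` have an element in common. -/
def pairs (A : I → Finset α) : Finset (I × I) :=
  univ.filter fun a ↦ ¬ Disjoint (A a.2) (A a.1)

/-- The union of the two members of the family `A` with indices `a.1` and `a.2`. -/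
def pairSet (A : I → Finset α) (a : I × I) : Finset α :=
  A a.1 ∪ A a.2

/-- The pairs `b` in `pairs A` whose union has an element in common with `U`. -/
def pairsMeeting (A : I → Finset α) (U : Finset α) : Finset (I × I) :=
  (pairs A).filter fun b ↦ ¬ Disjoint (pairSet A b) U

/-- The number of members of the family `A` that are contained in `ω`. -/
noncomputable def total (A : I → Finset α) (ω : Finset α) : ℝ :=
  ∑ i, ind (A i) ω

/-- The expected number of members of `A` that meet `U` and are contained in the random set, given
that it contains `U`. -/
noncomputable def attach (A : I → Finset α) (p : ℝ) (U : Finset α) : ℝ :=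
  ∑ j ∈ meets A U, p ^ #(A j \ U)

variable {A : I → Finset α} {p : ℝ}

theorem meets_mono {U V : Finset α} (h : U ⊆ V) : meets A U ⊆ meets A V := by
  intro j
  simp only [meets, mem_filter, mem_univ, true_and]
  exact mt fun h' ↦ h'.mono_right h

theorem card_meets_union (U V : Finset α) :
    #(meets A (U ∪ V)) ≤ #(meets A U) + #(meets A V) := by
  classical
  refine (card_le_card fun j ↦ ?_).trans (card_union_le _ _)
  simp only [meets, mem_filter, mem_univ, true_and, mem_union, disjoint_union_right]
  tauto

theorem total_mono {ω ω' : Finset α} (h : ω ⊆ ω') : total A ω ≤ total A ω' :=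
  sum_le_sum fun i _ ↦ ind_mono (A i) h

theorem total_sub_total_sdiff (U ω : Finset α) :
    total A ω - total A (ω \ U) = ∑ j ∈ meets A U, ind (A j) ω := by
  unfold total meets
  rw [sum_filter, ← sum_sub_distrib]
  refine sum_congr rfl fun j _ ↦ ?_
  split_ifs with h
  · rw [ind_sdiff_of_disjoint h, sub_self]
  · rw [ind_sdiff_of_not_disjoint h, sub_zero]

theorem total_le_total_sdiff_add (U ω : Finset α) :
    total A ω ≤ total A (ω \ U) + #(meets A U) := by
  have h := total_sub_total_sdiff (A := A) U ω
  have : ∑ j ∈ meets A U, ind (A j) ω ≤ #(meets A U) := by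
    refine (sum_le_sum fun j _ ↦ ind_le_one (A j) ω).trans ?_
    simp
  linarith

theorem card_meets_pairSet_le {D : ℕ} (hD : ∀ i, #(meets A (A i)) ≤ D) (a : I × I) :
    #(meets A (pairSet A a)) ≤ 2 * D := by
  have := card_meets_union (A := A) (A a.1) (A a.2)
  have h1 := hD a.1
  have h2 := hD a.2
  unfold pairSet
  omega

theorem card_meets_cast_le {D : ℕ} (hD : ∀ i, #(meets A (A i)) ≤ D) (a : I × I) (i : I) :
    (#(meets A (pairSet A a ∪ A i)) : ℝ) ≤ 3 * D := by
  have := card_meets_union (A := A) (pairSet A a) (A i)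
  have h1 := card_meets_pairSet_le hD a
  have h2 := hD i
  exact_mod_cast show #(meets A (pairSet A a ∪ A i)) ≤ 3 * D by omega

theorem pow_card_union (V W : Finset α) : p ^ #(V ∪ W) = p ^ #V * p ^ #(W \ V) := by
  rw [← pow_add, ← card_union_of_disjoint disjoint_sdiff, union_sdiff_self_eq_union]

/-- Two applications of the bound on `attach`: a pair meeting `U` can be attached to `U` one member
at a time, starting with one that meets `U`. -/
theorem sum_pairsMeeting_le (hp : 0 ≤ p) {U : Finset α} {L L' : ℝ} (hL'0 : 0 ≤ L')
    (hL : attach A p U ≤ L) (hL' : ∀ i, attach A p (U ∪ A i) ≤ L') :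
    ∑ b ∈ pairsMeeting A U, p ^ #(U ∪ pairSet A b) ≤ 2 * (p ^ #U * (L * L')) := by
  classical
  have key : ∑ i ∈ meets A U, ∑ j ∈ meets A (A i), p ^ #(U ∪ (A i ∪ A j)) ≤
      p ^ #U * (L * L') := by
    calc ∑ i ∈ meets A U, ∑ j ∈ meets A (A i), p ^ #(U ∪ (A i ∪ A j))
        ≤ ∑ i ∈ meets A U, p ^ #(U ∪ A i) * L' := by
          refine sum_le_sum fun i _ ↦ ?_
          refine le_trans ?_ (mul_le_mul_of_nonneg_left (hL' i) (pow_nonneg hp _))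
          rw [attach, mul_sum]
          refine (sum_le_sum_of_subset_of_nonneg (meets_mono subset_union_right)
            fun _ _ _ ↦ pow_nonneg hp _).trans (le_of_eq (sum_congr rfl fun j _ ↦ ?_))
          rw [← union_assoc, pow_card_union]
      _ = p ^ #U * (attach A p U * L') := by
          rw [attach, sum_mul, mul_sum]
          exact sum_congr rfl fun i _ ↦ by rw [pow_card_union, mul_assoc]
      _ ≤ p ^ #U * (L * L') :=
          mul_le_mul_of_nonneg_left (mul_le_mul_of_nonneg_right hL hL'0) (pow_nonneg hp _)
  have split : ∑ b ∈ pairsMeeting A U, p ^ #(U ∪ pairSet A b) ≤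
      ∑ i ∈ meets A U, ∑ j ∈ meets A (A i), p ^ #(U ∪ (A i ∪ A j)) +
      ∑ i ∈ meets A U, ∑ j ∈ meets A (A i), p ^ #(U ∪ (A i ∪ A j)) := by
    simp only [pairsMeeting, pairs, meets, sum_filter]
    rw [Fintype.sum_prod_type]
    have h1 : ∀ i, (if ¬ Disjoint (A i) U then
        ∑ j, if ¬ Disjoint (A j) (A i) then p ^ #(U ∪ (A i ∪ A j)) else 0 else 0) =
        ∑ j, if ¬ Disjoint (A i) U ∧ ¬ Disjoint (A j) (A i) then p ^ #(U ∪ (A i ∪ A j))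
          else 0 := by
      intro i
      split_ifs with h
      · simp [h]
      · simp [h]
    simp_rw [h1]
    nth_rewrite 2 [sum_comm]
    rw [← sum_add_distrib]
    refine sum_le_sum fun i _ ↦ ?_
    rw [← sum_add_distrib]
    refine sum_le_sum fun j _ ↦ ?_
    have h0 : 0 ≤ p ^ #(U ∪ (A i ∪ A j)) := pow_nonneg hp _
    simp only [pairSet, disjoint_union_left, union_comm (A j) (A i), disjoint_comm (a := A i)
      (b := A j)]
    split_ifs <;> first | linarith | (exfalso; tauto)
  linarith

theorem sum_pairs_le (hp : 0 ≤ p) {L : ℝ} {e : ℕ} (hA : ∀ i, #(A i) = e)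
    (h1 : ∀ i, attach A p (A i) ≤ L) :
    ∑ a ∈ pairs A, p ^ #(pairSet A a) ≤ Fintype.card I * p ^ e * L := by
  calc ∑ a ∈ pairs A, p ^ #(pairSet A a) = ∑ i, p ^ e * attach A p (A i) := by
        simp only [pairs, sum_filter, Fintype.sum_prod_type, attach, meets, mul_sum, pairSet]
        refine sum_congr rfl fun i _ ↦ sum_congr rfl fun j _ ↦ ?_
        rw [pow_card_union, hA, mul_ite, mul_zero]
    _ ≤ ∑ i : I, p ^ e * L :=
        sum_le_sum fun i _ ↦ mul_le_mul_of_nonneg_left (h1 i) (pow_nonneg hp _)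
    _ = _ := by simp; ring

theorem sum_meets_le (hp : 0 ≤ p) {L : ℝ} {U : Finset α} (h : attach A p U ≤ L) :
    ∑ j ∈ meets A U, p ^ #(U ∪ A j) ≤ p ^ #U * L := by
  simp_rw [pow_card_union, ← mul_sum]
  exact mul_le_mul_of_nonneg_left h (pow_nonneg hp _)

end RandomSubset

/-! ### Exponentially weighted moments of sums of local terms -/

namespace RandomSubset

open Finset

variable {α : Type*} [DecidableEq α] {I : Type*} [Fintype I]
variable {A : I → Finset α} {p : ℝ}

theorem exp_total_sdiff_le {v : ℝ} (hv : 0 ≤ v) (U ω : Finset α) :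
    Real.exp (v * total A (ω \ U)) ≤ Real.exp (v * total A ω) :=
  Real.exp_le_exp.2 (mul_le_mul_of_nonneg_left (total_mono sdiff_subset) hv)

theorem inter_eq_of_subset {F : Finset α → ℝ} {U V : Finset α} (h : U ⊆ V)
    (hF : ∀ ω, F (ω ∩ U) = F ω) (ω : Finset α) : F (ω ∩ V) = F ω := by
  rw [← hF, ← hF ω, inter_assoc, inter_eq_right.2 h]

theorem sdiff_eq_of_disjoint {F : Finset α → ℝ} {U V : Finset α} (h : Disjoint U V)
    (hF : ∀ ω, F (ω ∩ U) = F ω) (ω : Finset α) : F (ω \ V) = F ω := by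
  rw [← hF, ← hF ω]
  congr 1
  ext x
  have : x ∈ U → x ∉ V := fun h1 h2 ↦ (Finset.disjoint_left.1 h) h1 h2
  simp only [mem_inter, mem_sdiff]
  tauto

variable {κ : ℝ} {Z : I × I → Finset α → ℝ}

/-- The part of the sum of `Z` over all pairs that only looks outside `U`. -/
noncomputable def far (A : I → Finset α) (Z : I × I → Finset α → ℝ) (U ω : Finset α) : ℝ :=
  ∑ b ∈ (pairs A).filter (fun b ↦ Disjoint (pairSet A b) U), Z b ω

theorem far_add_near (U ω : Finset α) :
    far A Z U ω + ∑ b ∈ pairsMeeting A U, Z b ω = ∑ b ∈ pairs A, Z b ω :=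
  sum_filter_add_sum_filter_not _ _ _

theorem abs_far_le_sum (U ω : Finset α) :
    |far A Z U ω| ≤ |∑ b ∈ pairs A, Z b ω| + ∑ b ∈ pairsMeeting A U, |Z b ω| := by
  have h := far_add_near (A := A) (Z := Z) U ω
  have h1 : far A Z U ω = ∑ b ∈ pairs A, Z b ω - ∑ b ∈ pairsMeeting A U, Z b ω := by linarith
  rw [h1]
  exact (abs_sub _ _).trans (add_le_add le_rfl (abs_sum_le_sum_abs _ _))

theorem abs_far_le_far {U V : Finset α} (h : U ⊆ V) (ω : Finset α) :
    |far A Z U ω| ≤ |far A Z V ω| + ∑ b ∈ pairsMeeting A V, |Z b ω| := by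
  have h1 : far A Z U ω = far A Z V ω + ∑ b ∈ (pairs A).filter
      (fun b ↦ Disjoint (pairSet A b) U ∧ ¬ Disjoint (pairSet A b) V), Z b ω := by
    unfold far
    simp only [sum_filter, ← sum_add_distrib]
    refine sum_congr rfl fun b _ ↦ ?_
    have : Disjoint (pairSet A b) V → Disjoint (pairSet A b) U := fun h' ↦ h'.mono_right h
    split_ifs <;> first | (exfalso; tauto) | simp
  rw [h1]
  refine (abs_add_le _ _).trans (add_le_add le_rfl ((abs_sum_le_sum_abs _ _).trans ?_))
  refine sum_le_sum_of_subset_of_nonneg (fun b ↦ ?_) fun _ _ _ ↦ abs_nonneg _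
  simp only [pairsMeeting, mem_filter]
  tauto

variable [Fintype α]

/-- A centred field `Z` indexed by the pairs `a`, such that `Z a` only depends on the random subset
inside `pairSet A a` and has moments at most of the order of those of `κ • ind (pairSet A a)`. -/
structure IsLocalField (A : I → Finset α) (p κ : ℝ) (Z : I × I → Finset α → ℝ) : Prop where
  inter : ∀ a ω, Z a (ω ∩ pairSet A a) = Z a ω
  mean : ∀ a, ev p (Z a) = 0
  abs : ∀ a, ev p (fun ω ↦ |Z a ω|) ≤ 2 * p ^ #(pairSet A a)
  one : ∀ a B, ev p (fun ω ↦ |Z a ω| * ind B ω) ≤ κ * p ^ #(pairSet A a ∪ B)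
  two : ∀ a b B, ev p (fun ω ↦ |Z a ω| * |Z b ω| * ind B ω) ≤
    2 * κ * p ^ #(pairSet A a ∪ pairSet A b ∪ B)

/-- A local factor `F` can be separated from the exponential weight at the price of the largest
change of `total A` that the elements of `U` can cause. -/
theorem ev_mul_mul_exp_le (hp : 0 ≤ p) (hp1 : p ≤ 1) {U : Finset α} {F H : Finset α → ℝ} {v K : ℝ}
    (hv : 0 ≤ v) (hK : #(meets A U) ≤ K) (hF0 : ∀ ω, 0 ≤ F ω) (hH0 : ∀ ω, 0 ≤ H ω)
    (hF : ∀ ω, F (ω ∩ U) = F ω) (hH : ∀ ω, H (ω \ U) = H ω) :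
    ev p (fun ω ↦ F ω * (H ω * Real.exp (v * total A ω))) ≤
      Real.exp (v * K) * (ev p F * ev p (fun ω ↦ H ω * Real.exp (v * total A (ω \ U)))) := by
  rw [← ev_mul_of_indep U hF (G := fun ω ↦ H ω * Real.exp (v * total A (ω \ U)))
    (fun ω ↦ by simp only [hH, Finset.sdiff_idem]), ← ev_const_mul]
  refine ev_mono hp hp1 fun ω ↦ ?_
  have h : Real.exp (v * total A ω) ≤ Real.exp (v * K) * Real.exp (v * total A (ω \ U)) := by
    rw [← Real.exp_add, Real.exp_le_exp, ← mul_add]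
    refine mul_le_mul_of_nonneg_left ?_ hv
    linarith [total_le_total_sdiff_add (A := A) U ω]
  calc F ω * (H ω * Real.exp (v * total A ω))
      ≤ F ω * (H ω * (Real.exp (v * K) * Real.exp (v * total A (ω \ U)))) :=
        mul_le_mul_of_nonneg_left (mul_le_mul_of_nonneg_left h (hH0 ω)) (hF0 ω)
    _ = _ := by ring

theorem ev_mul_exp_le (hp : 0 ≤ p) (hp1 : p ≤ 1) {U : Finset α} {F : Finset α → ℝ} {v K : ℝ}
    (hv : 0 ≤ v) (hK : #(meets A U) ≤ K) (hF0 : ∀ ω, 0 ≤ F ω) (hF : ∀ ω, F (ω ∩ U) = F ω) :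
    ev p (fun ω ↦ F ω * Real.exp (v * total A ω)) ≤
      Real.exp (v * K) * (ev p F * ev p (fun ω ↦ Real.exp (v * total A ω))) := by
  have h := ev_mul_mul_exp_le (A := A) hp hp1 hv hK hF0 (H := fun _ ↦ 1) (fun _ ↦ zero_le_one) hF
    (fun _ ↦ rfl)
  simp only [one_mul] at h
  refine h.trans (mul_le_mul_of_nonneg_left (mul_le_mul_of_nonneg_left ?_ ?_) (Real.exp_nonneg _))
  · exact ev_mono hp hp1 fun ω ↦ exp_total_sdiff_le hv U ω
  · exact ev_nonneg hp hp1 hF0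

theorem far_sdiff (hZ : IsLocalField A p κ Z) (U ω : Finset α) :
    far A Z U (ω \ U) = far A Z U ω :=
  sum_congr rfl fun b hb ↦ sdiff_eq_of_disjoint (mem_filter.1 hb).2 (hZ.inter b) ω

/-- The moment generating function of `total A`. -/
noncomputable def mgf (A : I → Finset α) (p v : ℝ) : ℝ :=
  ev p fun ω ↦ Real.exp (v * total A ω)

theorem mgf_nonneg (hp : 0 ≤ p) (hp1 : p ≤ 1) (v : ℝ) : 0 ≤ mgf A p v :=
  ev_nonneg hp hp1 fun _ ↦ Real.exp_nonneg _

/-- The correlation of `Z a` with the terms that are far from it is only due to the exponential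
weight, and hence to the members of `A` that meet `pairSet A a`. -/
theorem ev_mul_far_mul_exp_le (hp : 0 ≤ p) (hp1 : p ≤ 1) (hZ : IsLocalField A p κ Z) {v : ℝ}
    (hv : 0 ≤ v) (a : I × I) :
    ev p (fun ω ↦ Z a ω * (far A Z (pairSet A a) ω * Real.exp (v * total A ω))) ≤
      v * ∑ j ∈ meets A (pairSet A a), ev p (fun ω ↦ |Z a ω| * ind (A j) ω *
        (|far A Z (pairSet A a) ω| * Real.exp (v * total A ω))) := by
  have h0 : ev p (fun ω ↦ Z a ω *
      (far A Z (pairSet A a) ω * Real.exp (v * total A (ω \ pairSet A a)))) = 0 := by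
    rw [ev_mul_of_indep (pairSet A a) (hZ.inter a)
      (G := fun ω ↦ far A Z (pairSet A a) ω * Real.exp (v * total A (ω \ pairSet A a)))
      (fun ω ↦ by simp only [far_sdiff hZ, Finset.sdiff_idem]), hZ.mean, zero_mul]
  rw [← sub_zero (ev p _), ← h0, ← ev_sub, ← ev_sum, ← ev_const_mul]
  refine ev_mono hp hp1 fun ω ↦ ?_
  have hexp : Real.exp (v * total A ω) - Real.exp (v * total A (ω \ pairSet A a)) ≤
      v * (∑ j ∈ meets A (pairSet A a), ind (A j) ω) * Real.exp (v * total A ω) := by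
    rw [← total_sub_total_sdiff]
    have h := Real.add_one_le_exp (v * total A (ω \ pairSet A a) - v * total A ω)
    have h' : Real.exp (v * total A (ω \ pairSet A a)) =
        Real.exp (v * total A (ω \ pairSet A a) - v * total A ω) *
          Real.exp (v * total A ω) := by
      rw [← Real.exp_add]; congr 1; ring
    nlinarith [Real.exp_pos (v * total A ω)]
  have hexp0 := exp_total_sdiff_le (A := A) hv (pairSet A a) ω
  calc Z a ω * (far A Z (pairSet A a) ω * Real.exp (v * total A ω)) -
        Z a ω * (far A Z (pairSet A a) ω * Real.exp (v * total A (ω \ pairSet A a)))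
      = Z a ω * far A Z (pairSet A a) ω *
        (Real.exp (v * total A ω) - Real.exp (v * total A (ω \ pairSet A a))) := by ring
    _ ≤ |Z a ω| * |far A Z (pairSet A a) ω| *
        (Real.exp (v * total A ω) - Real.exp (v * total A (ω \ pairSet A a))) := by
        rw [← abs_mul]
        exact mul_le_mul_of_nonneg_right (le_abs_self _) (sub_nonneg.2 hexp0)
    _ ≤ |Z a ω| * |far A Z (pairSet A a) ω| *
        (v * (∑ j ∈ meets A (pairSet A a), ind (A j) ω) * Real.exp (v * total A ω)) :=
        mul_le_mul_of_nonneg_left hexp (by positivity)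
    _ = _ := by
        rw [mul_sum, sum_mul, mul_sum, mul_sum]
        exact sum_congr rfl fun j _ ↦ by ring

theorem ev_abs_mul_exp_le (hp : 0 ≤ p) (hp1 : p ≤ 1) (hZ : IsLocalField A p κ Z) {D : ℕ}
    (hD : ∀ i, #(meets A (A i)) ≤ D) {v : ℝ} (hv : 0 ≤ v) (b : I × I) :
    ev p (fun ω ↦ |Z b ω| * Real.exp (v * total A ω)) ≤
      Real.exp (v * (2 * D)) * (2 * p ^ #(pairSet A b) * mgf A p v) := by
  refine (ev_mul_exp_le hp hp1 hv (K := 2 * D) (F := fun ω ↦ |Z b ω|) (U := pairSet A b) ?_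
    (fun ω ↦ abs_nonneg _) (fun ω ↦ by rw [hZ.inter])).trans ?_
  · exact_mod_cast card_meets_pairSet_le hD b
  · exact mul_le_mul_of_nonneg_left (mul_le_mul_of_nonneg_right (hZ.abs b)
      (mgf_nonneg hp hp1 v)) (Real.exp_nonneg _)

theorem ev_abs_mul_abs_mul_exp_le (hp : 0 ≤ p) (hp1 : p ≤ 1) (hZ : IsLocalField A p κ Z) {D : ℕ}
    (hD : ∀ i, #(meets A (A i)) ≤ D) {v : ℝ} (hv : 0 ≤ v) (a b : I × I) (B : Finset α)
    (hB : #(meets A B) ≤ D) :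
    ev p (fun ω ↦ |Z a ω| * |Z b ω| * ind B ω * Real.exp (v * total A ω)) ≤
      Real.exp (v * (5 * D)) * (2 * κ * p ^ #(pairSet A a ∪ pairSet A b ∪ B) * mgf A p v) := by
  refine (ev_mul_exp_le hp hp1 hv (K := 5 * D) (F := fun ω ↦ |Z a ω| * |Z b ω| * ind B ω)
    (U := pairSet A a ∪ pairSet A b ∪ B) ?_
    (fun ω ↦ mul_nonneg (by positivity) (ind_nonneg _ _)) (fun ω ↦ ?_)).trans ?_
  · have h1 := card_meets_union (A := A) (pairSet A a ∪ pairSet A b) B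
    have h2 := card_meets_union (A := A) (pairSet A a) (pairSet A b)
    have h3 := card_meets_pairSet_le hD a
    have h4 := card_meets_pairSet_le hD b
    exact_mod_cast show #(meets A (pairSet A a ∪ pairSet A b ∪ B)) ≤ 5 * D by omega
  · rw [inter_eq_of_subset (subset_union_left.trans subset_union_left) (hZ.inter a),
      inter_eq_of_subset (subset_union_right.trans subset_union_left) (hZ.inter b),
      inter_eq_of_subset (F := ind B) subset_union_right fun ω ↦ ind_inter subset_rfl ω]
  · exact mul_le_mul_of_nonneg_left (mul_le_mul_of_nonneg_right (hZ.two a b B)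
      (mgf_nonneg hp hp1 v)) (Real.exp_nonneg _)

/-- The far field with respect to `pairSet A a` is replaced with the one with respect to
`pairSet A a ∪ A j`, which is independent of the local factor `|Z a| * ind (A j)`. -/
theorem ev_abs_mul_ind_mul_far_le (hp : 0 ≤ p) (hp1 : p ≤ 1) (hZ : IsLocalField A p κ Z)
    (hκ : 0 ≤ κ) {D : ℕ} (hD : ∀ i, #(meets A (A i)) ≤ D) {v : ℝ} (hv : 0 ≤ v) (a : I × I) (j : I) :
    ev p (fun ω ↦ |Z a ω| * ind (A j) ω *
        (|far A Z (pairSet A a) ω| * Real.exp (v * total A ω))) ≤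
      Real.exp (v * (3 * D)) * (κ * p ^ #(pairSet A a ∪ A j)) *
          ev p (fun ω ↦ |∑ b ∈ pairs A, Z b ω| * Real.exp (v * total A ω)) +
        Real.exp (v * (5 * D)) * (4 * κ * mgf A p v) *
          ∑ b ∈ pairsMeeting A (pairSet A a ∪ A j), p ^ #(pairSet A a ∪ A j ∪ pairSet A b) := by
  set U := pairSet A a ∪ A j with hU
  set E : Finset α → ℝ := fun ω ↦ Real.exp (v * total A ω) with hE
  have hE0 : ∀ ω, 0 ≤ E ω := fun ω ↦ Real.exp_nonneg _
  have hm := mgf_nonneg (A := A) hp hp1 v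
  -- The terms between the two far fields.
  have near : ∑ b ∈ pairsMeeting A U,
        ev p (fun ω ↦ |Z a ω| * |Z b ω| * ind (A j) ω * E ω) ≤
      Real.exp (v * (5 * D)) * (2 * κ * mgf A p v) *
        ∑ b ∈ pairsMeeting A U, p ^ #(U ∪ pairSet A b) := by
    rw [mul_sum]
    refine sum_le_sum fun b _ ↦ ?_
    refine (ev_abs_mul_abs_mul_exp_le hp hp1 hZ hD hv a b (A j) (hD j)).trans (le_of_eq ?_)
    rw [hU, union_right_comm]
    ring
  have farU : ev p (fun ω ↦ |far A Z U ω| * Real.exp (v * total A (ω \ U))) ≤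
      ev p (fun ω ↦ |∑ b ∈ pairs A, Z b ω| * E ω) +
        ∑ b ∈ pairsMeeting A U, ev p (fun ω ↦ |Z b ω| * E ω) := by
    rw [← ev_sum, ← ev_add]
    refine ev_mono hp hp1 fun ω ↦ ?_
    rw [← sum_mul, ← add_mul]
    exact mul_le_mul (abs_far_le_sum U ω) (exp_total_sdiff_le hv U ω) (Real.exp_nonneg _)
      (add_nonneg (abs_nonneg _) (sum_nonneg fun _ _ ↦ abs_nonneg _))
  have main : ev p (fun ω ↦ |Z a ω| * ind (A j) ω * (|far A Z U ω| * E ω)) ≤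
      Real.exp (v * (3 * D)) * (κ * p ^ #U) *
          ev p (fun ω ↦ |∑ b ∈ pairs A, Z b ω| * E ω) +
        Real.exp (v * (5 * D)) * (2 * κ * mgf A p v) *
          ∑ b ∈ pairsMeeting A U, p ^ #(U ∪ pairSet A b) := by
    have h1 : ev p (fun ω ↦ |Z a ω| * ind (A j) ω * (|far A Z U ω| * E ω)) ≤
        Real.exp (v * (3 * D)) * (ev p (fun ω ↦ |Z a ω| * ind (A j) ω) *
          ev p (fun ω ↦ |far A Z U ω| * Real.exp (v * total A (ω \ U)))) :=
      ev_mul_mul_exp_le hp hp1 hv (card_meets_cast_le hD a j)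
        (fun ω ↦ mul_nonneg (abs_nonneg _) (ind_nonneg _ _)) (fun ω ↦ abs_nonneg _)
        (fun ω ↦ by
          rw [inter_eq_of_subset subset_union_left (hZ.inter a),
            inter_eq_of_subset (F := ind (A j)) subset_union_right fun ω ↦
              ind_inter subset_rfl ω])
        (fun ω ↦ by rw [far_sdiff hZ])
    refine h1.trans ?_
    have h2 : ∑ b ∈ pairsMeeting A U, ev p (fun ω ↦ |Z b ω| * E ω) ≤
        ∑ b ∈ pairsMeeting A U, Real.exp (v * (2 * D)) * (2 * p ^ #(pairSet A b) * mgf A p v) :=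
      sum_le_sum fun b _ ↦ ev_abs_mul_exp_le hp hp1 hZ hD hv b
    have h3 : p ^ #U * ∑ b ∈ pairsMeeting A U, p ^ #(pairSet A b) ≤
        ∑ b ∈ pairsMeeting A U, p ^ #(U ∪ pairSet A b) := by
      rw [mul_sum]
      refine sum_le_sum fun b _ ↦ ?_
      rw [← pow_add]
      exact pow_le_pow_of_le_one hp hp1 (card_union_le _ _)
    have h4 : Real.exp (v * (5 * D)) = Real.exp (v * (3 * D)) * Real.exp (v * (2 * D)) := by
      rw [← Real.exp_add]; congr 1; ring
    have h5 : 0 ≤ ev p (fun ω ↦ |far A Z U ω| * Real.exp (v * total A (ω \ U))) :=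
      ev_nonneg hp hp1 fun ω ↦ mul_nonneg (abs_nonneg _) (Real.exp_nonneg _)
    calc Real.exp (v * (3 * D)) * (ev p (fun ω ↦ |Z a ω| * ind (A j) ω) *
          ev p (fun ω ↦ |far A Z U ω| * Real.exp (v * total A (ω \ U))))
        ≤ Real.exp (v * (3 * D)) * (κ * p ^ #U *
          (ev p (fun ω ↦ |∑ b ∈ pairs A, Z b ω| * E ω) + ∑ b ∈ pairsMeeting A U,
            Real.exp (v * (2 * D)) * (2 * p ^ #(pairSet A b) * mgf A p v))) := by
          refine mul_le_mul_of_nonneg_left ?_ (Real.exp_nonneg _)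
          exact mul_le_mul (hZ.one a (A j)) (farU.trans (add_le_add le_rfl h2)) h5
            (mul_nonneg hκ (pow_nonneg hp _))
      _ = Real.exp (v * (3 * D)) * (κ * p ^ #U) *
            ev p (fun ω ↦ |∑ b ∈ pairs A, Z b ω| * E ω) +
          Real.exp (v * (5 * D)) * (2 * κ * mgf A p v) *
            (p ^ #U * ∑ b ∈ pairsMeeting A U, p ^ #(pairSet A b)) := by
          rw [h4, ← mul_sum, ← sum_mul, ← mul_sum]
          ring
      _ ≤ _ := by
          refine add_le_add le_rfl (mul_le_mul_of_nonneg_left h3 ?_)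
          positivity
  have step : ev p (fun ω ↦ |Z a ω| * ind (A j) ω * (|far A Z (pairSet A a) ω| * E ω)) ≤
      ev p (fun ω ↦ |Z a ω| * ind (A j) ω * (|far A Z U ω| * E ω)) +
        ∑ b ∈ pairsMeeting A U, ev p (fun ω ↦ |Z a ω| * |Z b ω| * ind (A j) ω * E ω) := by
    rw [← ev_sum, ← ev_add]
    refine ev_mono hp hp1 fun ω ↦ ?_
    have h1 := abs_far_le_far (A := A) (Z := Z) (subset_union_left : pairSet A a ⊆ U) ω
    have h2 : 0 ≤ |Z a ω| * ind (A j) ω := mul_nonneg (abs_nonneg _) (ind_nonneg _ _)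
    refine (mul_le_mul_of_nonneg_left (mul_le_mul_of_nonneg_right h1 (hE0 ω)) h2).trans
      (le_of_eq ?_)
    rw [add_mul, mul_add, sum_mul, mul_sum]
    congr 1
    exact sum_congr rfl fun b _ ↦ by ring
  linarith

end RandomSubset

/-! ### The weighted first moment of a local field -/

namespace RandomSubset

open Finset

variable {α : Type*} [DecidableEq α] [Fintype α] {I : Type*} [Fintype I]
variable {A : I → Finset α} {p κ : ℝ} {Z : I × I → Finset α → ℝ}

/-- The weighted second moment of a local field is bounded in terms of its weighted first absolute
moment. -/
theorem ev_sum_sq_mul_exp_le (hp : 0 ≤ p) (hp1 : p ≤ 1) (hZ : IsLocalField A p κ Z)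
    (hκ : 0 ≤ κ) {D : ℕ} (hD : ∀ i, #(meets A (A i)) ≤ D) {v : ℝ} (hv : 0 ≤ v) {e : ℕ}
    (hA : ∀ i, #(A i) = e) {L₁ L₂ L₃ L₄ : ℝ} (h0₂ : 0 ≤ L₂) (h0₃ : 0 ≤ L₃) (h0₄ : 0 ≤ L₄)
    (h₁ : ∀ i, attach A p (A i) ≤ L₁) (h₂ : ∀ i j, attach A p (A i ∪ A j) ≤ L₂)
    (h₃ : ∀ i j k, attach A p (A i ∪ A j ∪ A k) ≤ L₃)
    (h₄ : ∀ i j k l, attach A p (A i ∪ A j ∪ A k ∪ A l) ≤ L₄) :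
    ev p (fun ω ↦ (∑ a ∈ pairs A, Z a ω) ^ 2 * Real.exp (v * total A ω)) ≤
      Real.exp (v * (5 * D)) * mgf A p v *
          (4 * κ * (Fintype.card I * p ^ e * L₁ * L₂ * L₃) +
            8 * v * κ * (Fintype.card I * p ^ e * L₁ * L₂ * L₃ * L₄)) +
        Real.exp (v * (5 * D)) * (v * κ * (Fintype.card I * p ^ e * L₁ * L₂)) *
          ev p (fun ω ↦ |∑ a ∈ pairs A, Z a ω| * Real.exp (v * total A ω)) := by
  set E : Finset α → ℝ := fun ω ↦ Real.exp (v * total A ω) with hE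
  set P : ℝ := Fintype.card I * p ^ e with hP
  set x := ev p (fun ω ↦ |∑ a ∈ pairs A, Z a ω| * Real.exp (v * total A ω)) with hx
  set m := mgf A p v with hm
  have hE0 : ∀ ω, 0 ≤ E ω := fun ω ↦ Real.exp_nonneg _
  have hm0 : 0 ≤ m := mgf_nonneg hp hp1 v
  have hx0 : 0 ≤ x := ev_nonneg hp hp1 fun ω ↦ mul_nonneg (abs_nonneg _) (Real.exp_nonneg _)
  have hexp {c : ℝ} (hc : c ≤ 5) : Real.exp (v * (c * D)) ≤ Real.exp (v * (5 * D)) :=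
    Real.exp_le_exp.2 (mul_le_mul_of_nonneg_left (mul_le_mul_of_nonneg_right hc D.cast_nonneg) hv)
  have h₂' : ∀ a, attach A p (pairSet A a) ≤ L₂ := fun a ↦ by unfold pairSet; exact h₂ _ _
  have h₃' : ∀ a j, attach A p (pairSet A a ∪ A j) ≤ L₃ := fun a j ↦ by
    unfold pairSet; exact h₃ _ _ _
  have h₄' : ∀ a j k, attach A p (pairSet A a ∪ A j ∪ A k) ≤ L₄ := fun a j k ↦ by
    unfold pairSet; exact h₄ _ _ _ _
  have s1 := sum_pairs_le hp hA h₁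
  have s2 : ∑ a ∈ pairs A, ∑ j ∈ meets A (pairSet A a), p ^ #(pairSet A a ∪ A j) ≤
      P * L₁ * L₂ := by
    refine (sum_le_sum fun a _ ↦ sum_meets_le hp (h₂' a)).trans ?_
    rw [← sum_mul]
    exact mul_le_mul_of_nonneg_right s1 h0₂
  have s4 : ∑ a ∈ pairs A, ∑ b ∈ pairsMeeting A (pairSet A a), p ^ #(pairSet A a ∪ pairSet A b) ≤
      2 * (P * L₁ * L₂ * L₃) := by
    refine (sum_le_sum fun a _ ↦
      sum_pairsMeeting_le hp h0₃ (h₂' a) (h₃' a)).trans ?_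
    rw [← mul_sum, ← sum_mul]
    have := mul_le_mul_of_nonneg_right s1 (mul_nonneg h0₂ h0₃)
    linarith
  have s5 : ∑ a ∈ pairs A, ∑ j ∈ meets A (pairSet A a),
      ∑ b ∈ pairsMeeting A (pairSet A a ∪ A j), p ^ #(pairSet A a ∪ A j ∪ pairSet A b) ≤
      2 * (P * L₁ * L₂ * L₃ * L₄) := by
    refine (sum_le_sum fun a _ ↦ sum_le_sum fun j _ ↦
      sum_pairsMeeting_le hp h0₄ (h₃' a j) (h₄' a j)).trans ?_
    simp_rw [← mul_sum, ← sum_mul]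
    have := mul_le_mul_of_nonneg_right s2 (mul_nonneg h0₃ h0₄)
    linarith
  have near : ∀ a ∈ pairs A,
      ev p (fun ω ↦ Z a ω * ((∑ b ∈ pairsMeeting A (pairSet A a), Z b ω) * E ω)) ≤
      Real.exp (v * (5 * D)) * (2 * κ * m) *
        ∑ b ∈ pairsMeeting A (pairSet A a), p ^ #(pairSet A a ∪ pairSet A b) := by
    intro a _
    calc ev p (fun ω ↦ Z a ω * ((∑ b ∈ pairsMeeting A (pairSet A a), Z b ω) * E ω))
        ≤ ∑ b ∈ pairsMeeting A (pairSet A a),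
            ev p (fun ω ↦ |Z a ω| * |Z b ω| * ind ∅ ω * E ω) := by
          rw [← ev_sum]
          refine ev_mono hp hp1 fun ω ↦ ?_
          rw [sum_mul, mul_sum]
          refine sum_le_sum fun b _ ↦ ?_
          have : ind ∅ ω = 1 := by simp [ind]
          rw [this, mul_one, ← mul_assoc, ← abs_mul]
          exact mul_le_mul_of_nonneg_right (le_abs_self _) (hE0 ω)
      _ ≤ _ := by
          rw [mul_sum]
          refine sum_le_sum fun b _ ↦ ?_
          refine (ev_abs_mul_abs_mul_exp_le hp hp1 hZ hD hv a b ∅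
            (by simp [meets])).trans (le_of_eq ?_)
          rw [union_empty]
          ring
  have split : ev p (fun ω ↦ (∑ a ∈ pairs A, Z a ω) ^ 2 * E ω) =
      ∑ a ∈ pairs A,
        (ev p (fun ω ↦ Z a ω * ((∑ b ∈ pairsMeeting A (pairSet A a), Z b ω) * E ω)) +
          ev p (fun ω ↦ Z a ω * (far A Z (pairSet A a) ω * E ω))) := by
    simp_rw [← ev_add]
    rw [← ev_sum]
    congr 1
    ext ω
    have h : ∀ a, Z a ω * ((∑ b ∈ pairsMeeting A (pairSet A a), Z b ω) * E ω) +
        Z a ω * (far A Z (pairSet A a) ω * E ω) = Z a ω * ((∑ b ∈ pairs A, Z b ω) * E ω) := by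
      intro a
      rw [← far_add_near (A := A) (Z := Z) (pairSet A a) ω]
      ring
    simp_rw [h]
    rw [← sum_mul]
    ring
  rw [split]
  calc ∑ a ∈ pairs A,
        (ev p (fun ω ↦ Z a ω * ((∑ b ∈ pairsMeeting A (pairSet A a), Z b ω) * E ω)) +
          ev p (fun ω ↦ Z a ω * (far A Z (pairSet A a) ω * E ω)))
      ≤ ∑ a ∈ pairs A, (Real.exp (v * (5 * D)) * (2 * κ * m) *
          (∑ b ∈ pairsMeeting A (pairSet A a), p ^ #(pairSet A a ∪ pairSet A b)) +
        v * ∑ j ∈ meets A (pairSet A a),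
          (Real.exp (v * (5 * D)) * (κ * p ^ #(pairSet A a ∪ A j)) * x +
            Real.exp (v * (5 * D)) * (4 * κ * m) *
              ∑ b ∈ pairsMeeting A (pairSet A a ∪ A j),
                p ^ #(pairSet A a ∪ A j ∪ pairSet A b))) := by
        refine sum_le_sum fun a ha ↦ add_le_add (near a ha) ?_
        refine (ev_mul_far_mul_exp_le hp hp1 hZ hv a).trans ?_
        refine mul_le_mul_of_nonneg_left (sum_le_sum fun j _ ↦ ?_) hv
        refine (ev_abs_mul_ind_mul_far_le hp hp1 hZ hκ hD hv a j).trans (add_le_add ?_ le_rfl)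
        refine mul_le_mul_of_nonneg_right (mul_le_mul_of_nonneg_right (hexp (by norm_num)) ?_) hx0
        positivity
    _ = Real.exp (v * (5 * D)) * (2 * κ * m) * (∑ a ∈ pairs A,
          ∑ b ∈ pairsMeeting A (pairSet A a), p ^ #(pairSet A a ∪ pairSet A b)) +
        v * (Real.exp (v * (5 * D)) * κ * x * (∑ a ∈ pairs A, ∑ j ∈ meets A (pairSet A a),
          p ^ #(pairSet A a ∪ A j)) +
          Real.exp (v * (5 * D)) * (4 * κ * m) * (∑ a ∈ pairs A, ∑ j ∈ meets A (pairSet A a),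
            ∑ b ∈ pairsMeeting A (pairSet A a ∪ A j),
              p ^ #(pairSet A a ∪ A j ∪ pairSet A b))) := by
        simp only [sum_add_distrib, mul_sum, mul_add]
        congr 1
        congr 1
        exact sum_congr rfl fun a _ ↦ sum_congr rfl fun j _ ↦ by ring
    _ ≤ Real.exp (v * (5 * D)) * (2 * κ * m) * (2 * (P * L₁ * L₂ * L₃)) +
        v * (Real.exp (v * (5 * D)) * κ * x * (P * L₁ * L₂) +
          Real.exp (v * (5 * D)) * (4 * κ * m) * (2 * (P * L₁ * L₂ * L₃ * L₄))) := by
        gcongr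
    _ = _ := by ring

/-- Exponentially weighted first moment of a local field. Its second moment is at most an explicit
term plus a multiple of the first moment; with the Cauchy–Schwarz inequality, this quadratic
inequality bounds the first moment. -/
theorem ev_abs_sum_mul_exp_le (hp : 0 ≤ p) (hp1 : p ≤ 1) (hZ : IsLocalField A p κ Z)
    (hκ : 0 ≤ κ) {D : ℕ} (hD : ∀ i, #(meets A (A i)) ≤ D) {v : ℝ} (hv : 0 ≤ v) {e : ℕ}
    (hA : ∀ i, #(A i) = e) {L₁ L₂ L₃ L₄ : ℝ} (h0₁ : 0 ≤ L₁) (h0₂ : 0 ≤ L₂) (h0₃ : 0 ≤ L₃)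
    (h0₄ : 0 ≤ L₄)
    (h₁ : ∀ i, attach A p (A i) ≤ L₁) (h₂ : ∀ i j, attach A p (A i ∪ A j) ≤ L₂)
    (h₃ : ∀ i j k, attach A p (A i ∪ A j ∪ A k) ≤ L₃)
    (h₄ : ∀ i j k l, attach A p (A i ∪ A j ∪ A k ∪ A l) ≤ L₄) :
    ev p (fun ω ↦ |∑ a ∈ pairs A, Z a ω| * Real.exp (v * total A ω)) ≤
      Real.exp (v * (5 * D)) * mgf A p v *
        (v * κ * (Fintype.card I * p ^ e * L₁ * L₂) +
          √(4 * κ * (Fintype.card I * p ^ e * L₁ * L₂ * L₃) +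
            8 * v * κ * (Fintype.card I * p ^ e * L₁ * L₂ * L₃ * L₄))) := by
  have hsq := ev_abs_mul_sq_le hp hp1 (fun ω ↦ ∑ a ∈ pairs A, Z a ω)
    (H := fun ω ↦ Real.exp (v * total A ω)) fun ω ↦ Real.exp_nonneg _
  have h2 := ev_sum_sq_mul_exp_le hp hp1 hZ hκ hD hv hA h0₂ h0₃ h0₄ h₁ h₂ h₃ h₄
  set P : ℝ := Fintype.card I * p ^ e with hP
  have hP0 : 0 ≤ P := by positivity
  set x := ev p (fun ω ↦ |∑ a ∈ pairs A, Z a ω| * Real.exp (v * total A ω)) with hx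
  set m := mgf A p v with hm
  set b := v * κ * (P * L₁ * L₂) with hb
  set r := √(4 * κ * (P * L₁ * L₂ * L₃) + 8 * v * κ * (P * L₁ * L₂ * L₃ * L₄)) with hr
  have hr2 : 4 * κ * (P * L₁ * L₂ * L₃) + 8 * v * κ * (P * L₁ * L₂ * L₃ * L₄) = r ^ 2 := by
    rw [hr, Real.sq_sqrt (by positivity)]
  have hm0 : 0 ≤ m := mgf_nonneg hp hp1 v
  have hr0 : 0 ≤ r := Real.sqrt_nonneg _
  have hb0 : 0 ≤ b := by positivity
  have hE1 : 1 ≤ Real.exp (v * (5 * D)) := Real.one_le_exp (by positivity)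
  set E := Real.exp (v * (5 * D)) with hE
  rw [hr2] at h2
  have h3 : x ^ 2 ≤ m * (E * m * r ^ 2 + E * b * x) :=
    hsq.trans (mul_le_mul_of_nonneg_left h2 hm0)
  have h4 : x ^ 2 ≤ (E * m * r) ^ 2 + (E * m * b) * x := by
    have : 0 ≤ m ^ 2 * r ^ 2 * E * (E - 1) := by
      have := sub_nonneg.2 hE1
      positivity
    nlinarith
  have hy : 0 ≤ E * m * r := by positivity
  have hz : 0 ≤ E * m * b := by positivity
  by_contra! hcon
  have h5 : E * m * b + E * m * r < x := by linarith
  nlinarith [mul_pos (sub_pos.2 h5) (lt_of_le_of_lt (add_nonneg hz hy) h5)]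

end RandomSubset

/-! ### Centred indicators as local fields -/

namespace RandomSubset

open Finset

variable {α : Type*} [DecidableEq α] [Fintype α] {I : Type*}
variable {A : I → Finset α} {p : ℝ}

theorem one_sub_pow_le (hp : 0 ≤ p) (k : ℕ) : 1 - p ^ k ≤ k * (1 - p) := by
  have h := one_add_mul_le_pow (a := p - 1) (by linarith) k
  rw [add_sub_cancel] at h
  linarith

/-- A centred indicator has moments that are smaller by a factor `1 - p` than those of the
indicator. -/
theorem ev_abs_ind_sub_mul_ind_le (hp : 0 ≤ p) (hp1 : p ≤ 1) (V B : Finset α) :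
    ev p (fun ω ↦ |ind V ω - p ^ #V| * ind B ω) ≤ 2 * #V * (1 - p) * p ^ #(V ∪ B) := by
  have hpV : p ^ #V ≤ 1 := pow_le_one₀ hp hp1
  have hpV0 : 0 ≤ p ^ #V := pow_nonneg hp _
  have h1 : ev p (fun ω ↦ |ind V ω - p ^ #V| * ind B ω) =
      (1 - p ^ #V) * p ^ #(V ∪ B) + p ^ #V * (p ^ #B - p ^ #(V ∪ B)) := by
    rw [← ev_ind p (V ∪ B), ← ev_ind p B, ← ev_sub, ← ev_const_mul, ← ev_const_mul, ← ev_add]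
    congr 1
    ext ω
    rw [← ind_mul_ind]
    have : ind V ω = 1 ∨ ind V ω = 0 := by unfold ind; split_ifs <;> simp
    rcases this with h | h
    · rw [h, abs_of_nonneg (by linarith)]; ring
    · rw [h, abs_of_nonpos (by linarith)]; ring
  have h2 : p ^ #(V ∪ B) = p ^ #B * p ^ #(V \ B) := by
    rw [union_comm, pow_card_union]
  have h3 : p ^ #V * p ^ #B ≤ p ^ #(V ∪ B) := by
    rw [← pow_add]
    exact pow_le_pow_of_le_one hp hp1 (card_union_le _ _)
  have h4 : 1 - p ^ #(V \ B) ≤ #V * (1 - p) := by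
    refine (one_sub_pow_le hp _).trans (mul_le_mul_of_nonneg_right ?_ (by linarith))
    exact_mod_cast card_le_card sdiff_subset
  have h5 : 0 ≤ (#V : ℝ) * (1 - p) := mul_nonneg (Nat.cast_nonneg _) (by linarith)
  calc ev p (fun ω ↦ |ind V ω - p ^ #V| * ind B ω)
      = (1 - p ^ #V) * p ^ #(V ∪ B) + p ^ #V * p ^ #B * (1 - p ^ #(V \ B)) := by
        rw [h1, h2]; ring
    _ ≤ #V * (1 - p) * p ^ #(V ∪ B) + p ^ #V * p ^ #B * (#V * (1 - p)) :=
        add_le_add (mul_le_mul_of_nonneg_right (one_sub_pow_le hp _) (pow_nonneg hp _))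
          (mul_le_mul_of_nonneg_left h4 (by positivity))
    _ ≤ #V * (1 - p) * p ^ #(V ∪ B) + p ^ #(V ∪ B) * (#V * (1 - p)) :=
        add_le_add le_rfl (mul_le_mul_of_nonneg_right h3 h5)
    _ = _ := by ring

/-- Weighted centred indicators of subsets of `pairSet A a` form a local field, if the weights make
up for the elements of `pairSet A a` that the subsets lack. -/
theorem isLocalField_mul_ind_sub (hp : 0 ≤ p) (hp1 : p ≤ 1) {e : ℕ} {c : I × I → ℝ}
    {V : I × I → Finset α} (hc0 : ∀ a, 0 ≤ c a) (hV : ∀ a, V a ⊆ pairSet A a)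
    (hc : ∀ a, c a ≤ p ^ #(pairSet A a \ V a)) (he : ∀ a, #(V a) ≤ 2 * e) :
    IsLocalField A p (4 * e * (1 - p)) fun a ω ↦ c a * (ind (V a) ω - p ^ #(V a)) := by
  have hq : 0 ≤ 1 - p := by linarith
  have hκ : 0 ≤ 4 * (e : ℝ) * (1 - p) := by positivity
  have hcV : ∀ a B, c a * p ^ #(V a ∪ B) ≤ p ^ #(pairSet A a ∪ B) := by
    intro a B
    refine (mul_le_mul_of_nonneg_right (hc a) (pow_nonneg hp _)).trans ?_
    rw [← pow_add]
    refine pow_le_pow_of_le_one hp hp1 ((card_le_card fun x ↦ ?_).trans (card_union_le _ _))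
    simp only [mem_union, mem_sdiff]
    tauto
  have hone : ∀ a B, ev p (fun ω ↦ |c a * (ind (V a) ω - p ^ #(V a))| * ind B ω) ≤
      4 * e * (1 - p) * p ^ #(pairSet A a ∪ B) := by
    intro a B
    simp_rw [abs_mul, abs_of_nonneg (hc0 a), mul_assoc]
    rw [ev_const_mul]
    calc c a * ev p (fun ω ↦ |ind (V a) ω - p ^ #(V a)| * ind B ω)
        ≤ c a * (2 * #(V a) * (1 - p) * p ^ #(V a ∪ B)) :=
          mul_le_mul_of_nonneg_left (ev_abs_ind_sub_mul_ind_le hp hp1 _ _) (hc0 a)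
      _ = 2 * #(V a) * (1 - p) * (c a * p ^ #(V a ∪ B)) := by ring
      _ ≤ 2 * #(V a) * (1 - p) * p ^ #(pairSet A a ∪ B) :=
          mul_le_mul_of_nonneg_left (hcV a B) (by positivity)
      _ ≤ 2 * (2 * e) * (1 - p) * p ^ #(pairSet A a ∪ B) := by
          have : (#(V a) : ℝ) ≤ 2 * e := by exact_mod_cast he a
          gcongr
      _ = 4 * (e * ((1 - p) * p ^ #(pairSet A a ∪ B))) := by ring
  have habs : ∀ a ω, |c a * (ind (V a) ω - p ^ #(V a))| ≤
      c a * (ind (V a) ω + p ^ #(V a)) := by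
    intro a ω
    rw [abs_mul, abs_of_nonneg (hc0 a)]
    refine mul_le_mul_of_nonneg_left ((abs_sub _ _).trans (le_of_eq ?_)) (hc0 a)
    rw [abs_of_nonneg (ind_nonneg _ _), abs_of_nonneg (pow_nonneg hp _)]
  refine ⟨fun a ω ↦ ?_, fun a ↦ ?_, fun a ↦ ?_, hone, fun a b B ↦ ?_⟩
  · simp only [ind_inter (hV a)]
  · rw [ev_const_mul, ev_sub, ev_ind, ev_const, sub_self, mul_zero]
  · refine (ev_mono hp hp1 (habs a)).trans ?_
    rw [ev_const_mul, ev_add, ev_const, ev_ind]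
    have := hcV a ∅
    simp only [union_empty] at this
    linarith
  · have h1 : ∀ ω, |c a * (ind (V a) ω - p ^ #(V a))| * |c b * (ind (V b) ω - p ^ #(V b))| *
        ind B ω ≤ c b * (|c a * (ind (V a) ω - p ^ #(V a))| * ind (V b ∪ B) ω) +
          c b * p ^ #(V b) * (|c a * (ind (V a) ω - p ^ #(V a))| * ind B ω) := by
      intro ω
      refine (mul_le_mul_of_nonneg_right (mul_le_mul_of_nonneg_left (habs b ω) (abs_nonneg _))
        (ind_nonneg _ _)).trans (le_of_eq ?_)
      rw [← ind_mul_ind]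
      ring
    refine (ev_mono hp hp1 h1).trans ?_
    rw [ev_add, ev_const_mul, ev_const_mul]
    have h2 : p ^ #(V b) * p ^ #(pairSet A a ∪ B) ≤ p ^ #(V b ∪ (pairSet A a ∪ B)) := by
      rw [← pow_add]
      exact pow_le_pow_of_le_one hp hp1 (card_union_le _ _)
    have h3 : pairSet A a ∪ (V b ∪ B) = V b ∪ (pairSet A a ∪ B) := union_left_comm _ _ _
    have h4 := hcV b (pairSet A a ∪ B)
    have h5 : pairSet A b ∪ (pairSet A a ∪ B) = pairSet A a ∪ pairSet A b ∪ B := by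
      rw [union_left_comm, union_assoc]
    rw [h5] at h4
    have h6 := hone a (V b ∪ B)
    rw [h3] at h6
    have h7 := hone a B
    calc c b * ev p (fun ω ↦ |c a * (ind (V a) ω - p ^ #(V a))| * ind (V b ∪ B) ω) +
          c b * p ^ #(V b) * ev p (fun ω ↦ |c a * (ind (V a) ω - p ^ #(V a))| * ind B ω)
        ≤ c b * (4 * e * (1 - p) * p ^ #(V b ∪ (pairSet A a ∪ B))) +
          c b * p ^ #(V b) * (4 * e * (1 - p) * p ^ #(pairSet A a ∪ B)) :=
          add_le_add (mul_le_mul_of_nonneg_left h6 (hc0 b))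
            (mul_le_mul_of_nonneg_left h7 (mul_nonneg (hc0 b) (pow_nonneg hp _)))
      _ = 4 * e * (1 - p) * (c b * p ^ #(V b ∪ (pairSet A a ∪ B)) +
            c b * (p ^ #(V b) * p ^ #(pairSet A a ∪ B))) := by ring
      _ ≤ 4 * e * (1 - p) * (p ^ #(pairSet A a ∪ pairSet A b ∪ B) +
            p ^ #(pairSet A a ∪ pairSet A b ∪ B)) := by
          refine mul_le_mul_of_nonneg_left (add_le_add h4 ?_) hκ
          exact (mul_le_mul_of_nonneg_left h2 (hc0 b)).trans h4
      _ = _ := by ring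

section Fields

variable {e : ℕ}

theorem isLocalField_union (hp : 0 ≤ p) (hp1 : p ≤ 1) (hA : ∀ i, #(A i) = e) :
    IsLocalField A p (4 * e * (1 - p)) fun a ω ↦ 1 *
      (ind (A a.1 ∪ A a.2) ω - p ^ #(A a.1 ∪ A a.2)) :=
  isLocalField_mul_ind_sub (c := fun _ ↦ 1) (V := fun a ↦ A a.1 ∪ A a.2) hp hp1
    (fun _ ↦ zero_le_one) (fun _ ↦ subset_rfl) (fun a ↦ by simp [pairSet])
    (fun a ↦ (card_union_le _ _).trans (by rw [hA, hA]; omega))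

theorem isLocalField_sdiff (hp : 0 ≤ p) (hp1 : p ≤ 1) (hA : ∀ i, #(A i) = e) :
    IsLocalField A p (4 * e * (1 - p)) fun a ω ↦ p ^ e *
      (ind (A a.2 \ A a.1) ω - p ^ #(A a.2 \ A a.1)) :=
  isLocalField_mul_ind_sub (c := fun _ ↦ p ^ e) (V := fun a ↦ A a.2 \ A a.1) hp hp1
    (fun _ ↦ pow_nonneg hp _) (fun _ ↦ sdiff_subset.trans subset_union_right)
    (fun a ↦ by
      rw [← hA a.1]
      refine pow_le_pow_of_le_one hp hp1 (card_le_card fun x ↦ ?_)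
      simp only [pairSet, mem_sdiff, mem_union]
      tauto)
    (fun a ↦ (card_le_card sdiff_subset).trans (by rw [hA]; omega))

theorem isLocalField_snd (hp : 0 ≤ p) (hp1 : p ≤ 1) (hA : ∀ i, #(A i) = e) :
    IsLocalField A p (4 * e * (1 - p)) fun a ω ↦ p ^ e *
      (ind (A a.2) ω - p ^ #(A a.2)) :=
  isLocalField_mul_ind_sub (c := fun _ ↦ p ^ e) (V := fun a ↦ A a.2) hp hp1
    (fun _ ↦ pow_nonneg hp _) (fun _ ↦ subset_union_right)
    (fun a ↦ by
      rw [← hA a.1]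
      refine pow_le_pow_of_le_one hp hp1 (card_le_card fun x ↦ ?_)
      simp only [pairSet, mem_sdiff, mem_union]
      tauto)
    (fun a ↦ by rw [hA]; omega)

end Fields

end RandomSubset

/-! ### The size bias identity -/

namespace RandomSubset

open Finset

variable {α : Type*} [DecidableEq α] {I : Type*} [Fintype I]
variable {A : I → Finset α} {p : ℝ}

theorem total_union_sub (i : I) (ω : Finset α) :
    total A (ω ∪ A i) - total A ω =
      ∑ j ∈ meets A (A i), (ind (A j \ A i) ω - ind (A j) ω) := by
  unfold total meets
  rw [sum_filter, ← sum_sub_distrib]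
  refine sum_congr rfl fun j _ ↦ ?_
  rw [ind_union_right]
  split_ifs with h
  · rw [sdiff_eq_self_of_disjoint h, sub_self]
  · rfl

/-- The number of members of `A` that meet `A i` and are contained in `ω ∪ A i`. -/
noncomputable def nearCount (A : I → Finset α) (i : I) (ω : Finset α) : ℝ :=
  ∑ j ∈ meets A (A i), ind (A j \ A i) ω

theorem total_union_sub_le (i : I) (ω : Finset α) :
    total A (ω ∪ A i) - total A ω ≤ nearCount A i ω := by
  rw [total_union_sub]
  exact sum_le_sum fun j _ ↦ by linarith [ind_nonneg (A j) ω]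

theorem nearCount_union (i : I) (ω : Finset α) : nearCount A i (ω ∪ A i) = nearCount A i ω := by
  unfold nearCount
  refine sum_congr rfl fun j _ ↦ ?_
  rw [ind_union_right, Finset.sdiff_idem]

/-- The standardized value of `total A`. -/
noncomputable def std (A : I → Finset α) (μ σ : ℝ) (ω : Finset α) : ℝ :=
  (total A ω - μ) / σ

/-- The deviation from its mean `1` of the total mass of the kernel in the size bias identity. -/
noncomputable def massDev (A : I → Finset α) (p : ℝ) (e : ℕ) (σ : ℝ) (ω : Finset α) : ℝ :=
  p ^ e * (∑ i, (total A (ω ∪ A i) - total A ω)) / σ ^ 2 - 1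

/-- The sum of `nearCount` over the members of `A` that are contained in the random subset, with the
indicators centred and in units of `σ ^ 2`. -/
noncomputable def nearDev (A : I → Finset α) (p : ℝ) (e : ℕ) (σ : ℝ) (ω : Finset α) : ℝ :=
  (∑ i, (ind (A i) ω - p ^ e) * nearCount A i ω) / σ ^ 2

variable [Fintype α] {e : ℕ} {σ : ℝ}

theorem ev_total (hA : ∀ i, #(A i) = e) : ev p (total A) = Fintype.card I * p ^ e := by
  have : total A = fun ω ↦ ∑ i, ind (A i) ω := rfl
  rw [this, ev_sum]
  simp_rw [ev_ind, hA]
  simp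

/-- The size bias identity. -/
theorem ev_total_sub_mul (hA : ∀ i, #(A i) = e) (F : Finset α → ℝ) :
    ev p (fun ω ↦ (total A ω - Fintype.card I * p ^ e) * F ω) =
      p ^ e * ∑ i, ev p (fun ω ↦ F (ω ∪ A i) - F ω) := by
  have h : ∀ ω, (total A ω - Fintype.card I * p ^ e) * F ω =
      ∑ i, (ind (A i) ω * F ω - p ^ e * F ω) := by
    intro ω
    rw [sum_sub_distrib, ← sum_mul, sum_const, card_univ, nsmul_eq_mul]
    unfold total
    ring
  simp_rw [h]
  rw [ev_sum, mul_sum]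
  refine sum_congr rfl fun i _ ↦ ?_
  rw [ev_sub, ev_ind_mul, ev_const_mul, ev_sub, hA]
  ring

theorem ev_massDev (hA : ∀ i, #(A i) = e) (hσ : 0 < σ)
    (hvar : ev p (fun ω ↦ (total A ω - Fintype.card I * p ^ e) ^ 2) = σ ^ 2) :
    ev p (massDev A p e σ) = 0 := by
  have h := ev_total_sub_mul (p := p) hA (fun ω ↦ total A ω - Fintype.card I * p ^ e)
  simp_rw [← pow_two, hvar, sub_sub_sub_cancel_right] at h
  rw [← ev_sum, ← ev_const_mul] at h
  have h' : massDev A p e σ = fun ω ↦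
      p ^ e * (∑ i, (total A (ω ∪ A i) - total A ω)) * (σ ^ 2)⁻¹ - 1 := by
    ext ω; unfold massDev; rw [div_eq_mul_inv]
  rw [h', ev_sub, ev_const, ev_mul_const, ← h, mul_inv_cancel₀ (by positivity), sub_self]

/-- The error in Stein's identity for a function `G` with increasing derivative `g`. The kernel of
the size bias identity is nonnegative, so that the monotonicity of `g` gives the lower bound at
once. The upper bound follows from replacing the increments of `total A` by `nearCount A i`, which
does not depend on the elements of `A i`, and applying the size bias identity backwards. -/
theorem abs_ev_std_mul_sub_le (hp : 0 ≤ p) (hp1 : p ≤ 1) (hA : ∀ i, #(A i) = e) (hσ : 0 < σ)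
    {G g : ℝ → ℝ} (hg : Monotone g)
    (hG : ∀ x y, x ≤ y → (y - x) * g x ≤ G y - G x ∧ G y - G x ≤ (y - x) * g y) :
    ev p (fun ω ↦ g (std A (Fintype.card I * p ^ e) σ ω) * massDev A p e σ ω) ≤
        ev p (fun ω ↦ std A (Fintype.card I * p ^ e) σ ω *
            G (std A (Fintype.card I * p ^ e) σ ω)) -
          ev p (fun ω ↦ g (std A (Fintype.card I * p ^ e) σ ω)) ∧
      ev p (fun ω ↦ std A (Fintype.card I * p ^ e) σ ω *
            G (std A (Fintype.card I * p ^ e) σ ω)) -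
          ev p (fun ω ↦ g (std A (Fintype.card I * p ^ e) σ ω)) ≤
        ev p (fun ω ↦ g (std A (Fintype.card I * p ^ e) σ ω) * massDev A p e σ ω) +
          ev p (fun ω ↦ g (std A (Fintype.card I * p ^ e) σ ω) * nearDev A p e σ ω) := by
  set w := std A (Fintype.card I * p ^ e) σ with hw
  have hwd : ∀ i ω, w (ω ∪ A i) - w ω = (total A (ω ∪ A i) - total A ω) / σ := by
    intro i ω; simp only [hw, std]; ring
  have hwmono : ∀ i ω, w ω ≤ w (ω ∪ A i) := by
    intro i ω
    rw [← sub_nonneg, hwd]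
    exact div_nonneg (sub_nonneg.2 (total_mono subset_union_left)) hσ.le
  have hid : ev p (fun ω ↦ w ω * G (w ω)) =
      p ^ e / σ * ∑ i, ev p (fun ω ↦ G (w (ω ∪ A i)) - G (w ω)) := by
    have := ev_total_sub_mul (p := p) hA (fun ω ↦ G (w ω))
    rw [div_mul_eq_mul_div, ← this, div_eq_mul_inv, ← ev_mul_const]
    congr 1
    ext ω
    simp only [hw, std]
    ring
  have hmass : ev p (fun ω ↦ g (w ω) * massDev A p e σ ω) + ev p (fun ω ↦ g (w ω)) =
      p ^ e / σ * ∑ i, ev p (fun ω ↦ (w (ω ∪ A i) - w ω) * g (w ω)) := by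
    rw [← ev_add, ← ev_sum, ← ev_const_mul]
    congr 1
    ext ω
    simp_rw [hwd, ← sum_mul, ← sum_div]
    unfold massDev
    field_simp
    ring
  have hnear : ev p (fun ω ↦ g (w ω) * nearDev A p e σ ω) =
      p ^ e / σ * ∑ i, ev p (fun ω ↦ nearCount A i ω / σ * (g (w (ω ∪ A i)) - g (w ω))) := by
    have h1 : ∀ i, p ^ e * ev p (fun ω ↦ nearCount A i ω / σ * (g (w (ω ∪ A i)) - g (w ω))) =
        ev p (fun ω ↦ (ind (A i) ω - p ^ e) * (nearCount A i ω / σ * g (w ω))) := by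
      intro i
      have h2 := ev_ind_mul (p := p) (A i) (fun ω ↦ nearCount A i ω / σ * g (w ω))
      rw [hA] at h2
      simp_rw [sub_mul]
      rw [ev_sub, h2, ev_const_mul, ← mul_sub, ← ev_sub]
      congr 2
      ext ω
      rw [nearCount_union]
      ring
    rw [div_mul_eq_mul_div, mul_sum, sum_congr rfl fun i _ ↦ h1 i, ← ev_sum, div_eq_mul_inv,
      ← ev_mul_const]
    congr 1
    ext ω
    unfold nearDev
    rw [div_eq_mul_inv, sum_mul, mul_sum, sum_mul]
    refine sum_congr rfl fun i _ ↦ ?_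
    field_simp
  have hpe : 0 ≤ p ^ e / σ := div_nonneg (pow_nonneg hp _) hσ.le
  rw [hid]
  constructor
  · rw [le_sub_iff_add_le, hmass]
    refine mul_le_mul_of_nonneg_left (sum_le_sum fun i _ ↦ ?_) hpe
    exact ev_mono hp hp1 fun ω ↦ (hG _ _ (hwmono i ω)).1
  · have : p ^ e / σ * ∑ i, ev p (fun ω ↦ G (w (ω ∪ A i)) - G (w ω)) ≤
        p ^ e / σ * ∑ i, ev p (fun ω ↦ (w (ω ∪ A i) - w ω) * g (w ω)) +
        p ^ e / σ * ∑ i, ev p (fun ω ↦ nearCount A i ω / σ * (g (w (ω ∪ A i)) - g (w ω))) := by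
      rw [← mul_add, ← sum_add_distrib]
      refine mul_le_mul_of_nonneg_left (sum_le_sum fun i _ ↦ ?_) hpe
      rw [← ev_add]
      refine ev_mono hp hp1 fun ω ↦ ?_
      have h1 := (hG _ _ (hwmono i ω)).2
      have h2 : w (ω ∪ A i) - w ω ≤ nearCount A i ω / σ := by
        rw [hwd]
        exact div_le_div_of_nonneg_right (total_union_sub_le i ω) hσ.le
      have h3 := mul_le_mul_of_nonneg_right h2 (sub_nonneg.2 (hg (hwmono i ω)))
      linarith
    linarith

/-- The weighted mean of the two error terms in Stein's identity. -/
theorem ev_errors_mul_exp_le (hp : 0 ≤ p) (hp1 : p ≤ 1) (hA : ∀ i, #(A i) = e) (hσ : 0 < σ)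
    (hvar : ev p (fun ω ↦ (total A ω - Fintype.card I * p ^ e) ^ 2) = σ ^ 2) {D : ℕ}
    (hD : ∀ i, #(meets A (A i)) ≤ D) {v : ℝ} (hv : 0 ≤ v)
    {L₁ L₂ L₃ L₄ : ℝ} (h0₁ : 0 ≤ L₁) (h0₂ : 0 ≤ L₂) (h0₃ : 0 ≤ L₃)
    (h0₄ : 0 ≤ L₄)
    (h₁ : ∀ i, attach A p (A i) ≤ L₁) (h₂ : ∀ i j, attach A p (A i ∪ A j) ≤ L₂)
    (h₃ : ∀ i j k, attach A p (A i ∪ A j ∪ A k) ≤ L₃)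
    (h₄ : ∀ i j k l, attach A p (A i ∪ A j ∪ A k ∪ A l) ≤ L₄) :
    ev p (fun ω ↦ (|massDev A p e σ ω| + |nearDev A p e σ ω|) * Real.exp (v * total A ω)) ≤
      4 / σ ^ 2 * (Real.exp (v * (5 * D)) * mgf A p v *
        (v * (4 * e * (1 - p)) * (Fintype.card I * p ^ e * L₁ * L₂) +
          √(4 * (4 * e * (1 - p)) * (Fintype.card I * p ^ e * L₁ * L₂ * L₃) +
            8 * v * (4 * e * (1 - p)) * (Fintype.card I * p ^ e * L₁ * L₂ * L₃ * L₄)))) := by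
  have hκ : 0 ≤ 4 * (e : ℝ) * (1 - p) := by
    have : 0 ≤ 1 - p := by linarith
    positivity
  set R := Real.exp (v * (5 * D)) * mgf A p v *
        (v * (4 * e * (1 - p)) * (Fintype.card I * p ^ e * L₁ * L₂) +
          √(4 * (4 * e * (1 - p)) * (Fintype.card I * p ^ e * L₁ * L₂ * L₃) +
            8 * v * (4 * e * (1 - p)) * (Fintype.card I * p ^ e * L₁ * L₂ * L₃ * L₄))) with hR
  set Z₁ : I × I → Finset α → ℝ := fun a ω ↦ 1 *
      (ind (A a.1 ∪ A a.2) ω - p ^ #(A a.1 ∪ A a.2)) with hZ₁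
  set Z₂ : I × I → Finset α → ℝ := fun a ω ↦ p ^ e *
      (ind (A a.2 \ A a.1) ω - p ^ #(A a.2 \ A a.1)) with hZ₂
  set Z₃ : I × I → Finset α → ℝ := fun a ω ↦ p ^ e *
      (ind (A a.2) ω - p ^ #(A a.2)) with hZ₃
  have l₁ : IsLocalField A p (4 * e * (1 - p)) Z₁ := isLocalField_union hp hp1 hA
  have l₂ : IsLocalField A p (4 * e * (1 - p)) Z₂ := isLocalField_sdiff hp hp1 hA
  have l₃ : IsLocalField A p (4 * e * (1 - p)) Z₃ := isLocalField_snd hp hp1 hA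
  have b₁ := ev_abs_sum_mul_exp_le hp hp1 l₁ hκ hD hv hA h0₁ h0₂ h0₃ h0₄ h₁ h₂ h₃ h₄
  have b₂ := ev_abs_sum_mul_exp_le hp hp1 l₂ hκ hD hv hA h0₁ h0₂ h0₃ h0₄ h₁ h₂ h₃ h₄
  have b₃ := ev_abs_sum_mul_exp_le hp hp1 l₃ hκ hD hv hA h0₁ h0₂ h0₃ h0₄ h₁ h₂ h₃ h₄
  rw [← hR] at b₁ b₂ b₃
  have hpairs : ∀ f : I → I → ℝ, ∑ a ∈ pairs A, f a.1 a.2 = ∑ i, ∑ j ∈ meets A (A i), f i j := by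
    intro f
    simp only [pairs, meets, sum_filter, Fintype.sum_prod_type]
  have hnear : ∀ ω, nearDev A p e σ ω =
      (∑ a ∈ pairs A, Z₁ a ω - ∑ a ∈ pairs A, Z₂ a ω) / σ ^ 2 := by
    intro ω
    unfold nearDev
    congr 1
    rw [← sum_sub_distrib, hpairs (fun i j ↦ Z₁ (i, j) ω - Z₂ (i, j) ω)]
    refine sum_congr rfl fun i _ ↦ ?_
    rw [nearCount, mul_sum]
    refine sum_congr rfl fun j _ ↦ ?_
    simp only [hZ₁, hZ₂]
    rw [pow_card_union, hA, sub_mul, ind_mul_ind, union_sdiff_self_eq_union]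
    ring
  have hmass : ∀ ω, massDev A p e σ ω =
      (∑ a ∈ pairs A, Z₂ a ω - ∑ a ∈ pairs A, Z₃ a ω) / σ ^ 2 := by
    -- Both sides have mean zero, and their difference is constant.
    obtain ⟨k, hk⟩ : ∃ k, ∀ ω, massDev A p e σ ω =
        (∑ a ∈ pairs A, Z₂ a ω - ∑ a ∈ pairs A, Z₃ a ω) * (σ ^ 2)⁻¹ + k := by
      refine ⟨p ^ e * (∑ i, ∑ j ∈ meets A (A i), (p ^ #(A j \ A i) - p ^ #(A j))) * (σ ^ 2)⁻¹ - 1,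
        fun ω ↦ ?_⟩
      unfold massDev
      rw [← sum_sub_distrib, hpairs (fun i j ↦ Z₂ (i, j) ω - Z₃ (i, j) ω), div_eq_mul_inv,
        ← add_sub_assoc, ← add_mul]
      congr 2
      simp_rw [total_union_sub, mul_sum]
      rw [← sum_add_distrib]
      refine sum_congr rfl fun i _ ↦ ?_
      rw [← sum_add_distrib]
      refine sum_congr rfl fun j _ ↦ ?_
      simp only [hZ₂, hZ₃]
      ring
    have h0 : k = 0 := by
      have h1 := ev_massDev hA hσ hvar
      have h2 : massDev A p e σ = fun ω ↦
        (∑ a ∈ pairs A, Z₂ a ω - ∑ a ∈ pairs A, Z₃ a ω) * (σ ^ 2)⁻¹ + k := funext hk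
      rw [h2, ev_add, ev_const, ev_mul_const, ev_sub, ev_sum, ev_sum,
        sum_congr rfl fun a _ ↦ l₂.mean a, sum_congr rfl fun a _ ↦ l₃.mean a] at h1
      simpa using h1
    intro ω
    rw [hk, h0, add_zero, div_eq_mul_inv]
  have hσ2 : 0 < σ ^ 2 := by positivity
  have hpt : ∀ ω, (|massDev A p e σ ω| + |nearDev A p e σ ω|) * Real.exp (v * total A ω) ≤
      1 / σ ^ 2 * (|∑ a ∈ pairs A, Z₁ a ω| * Real.exp (v * total A ω) +
        (|∑ a ∈ pairs A, Z₂ a ω| * Real.exp (v * total A ω) +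
        (|∑ a ∈ pairs A, Z₂ a ω| * Real.exp (v * total A ω) +
          |∑ a ∈ pairs A, Z₃ a ω| * Real.exp (v * total A ω)))) := by
    intro ω
    rw [hmass, hnear, abs_div, abs_div, abs_of_pos hσ2, ← add_div]
    have h1 := abs_sub (∑ a ∈ pairs A, Z₁ a ω) (∑ a ∈ pairs A, Z₂ a ω)
    have h2 := abs_sub (∑ a ∈ pairs A, Z₂ a ω) (∑ a ∈ pairs A, Z₃ a ω)
    rw [div_mul_eq_mul_div, div_eq_mul_inv, mul_comm _ (σ ^ 2)⁻¹, one_div]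
    refine mul_le_mul_of_nonneg_left ?_ (inv_nonneg.2 hσ2.le)
    rw [← add_mul, ← add_mul, ← add_mul]
    exact mul_le_mul_of_nonneg_right (by linarith) (Real.exp_nonneg _)
  refine (ev_mono hp hp1 hpt).trans ?_
  rw [ev_const_mul, ev_add, ev_add, ev_add]
  calc 1 / σ ^ 2 * _ ≤ 1 / σ ^ 2 * (R + (R + (R + R))) :=
        mul_le_mul_of_nonneg_left (by linarith) (by positivity)
    _ = _ := by ring

end RandomSubset

/-! ### The Mills ratio of the standard normal distribution -/

namespace NormalApprox

open Set Real

/-- The ratio of the standard normal distribution function to its density. -/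
noncomputable def mills (w : ℝ) : ℝ :=
  √(2 * π) * exp (w ^ 2 / 2) * cdf (gaussianReal 0 1) w

theorem gaussianPDFReal_zero_one (x : ℝ) :
    gaussianPDFReal 0 1 x = (√(2 * π))⁻¹ * exp (-(x ^ 2 / 2)) := by
  simp [gaussianPDFReal, neg_div]

theorem cdf_gaussian_eq_integral (w : ℝ) :
    cdf (gaussianReal 0 1) w = ∫ x in Iic w, gaussianPDFReal 0 1 x := by
  rw [cdf_eq_real, measureReal_def, gaussianReal_apply_eq_integral 0 one_ne_zero,
    ENNReal.toReal_ofReal]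
  exact integral_nonneg fun x ↦ gaussianPDFReal_nonneg 0 1 x

theorem hasDerivAt_cdf_gaussian (w : ℝ) :
    HasDerivAt (cdf (gaussianReal 0 1)) (gaussianPDFReal 0 1 w) w := by
  have hint := integrable_gaussianPDFReal 0 1
  have hc : Continuous (gaussianPDFReal 0 1) := by
    simp_rw [funext gaussianPDFReal_zero_one]
    fun_prop
  have h : ⇑(cdf (gaussianReal 0 1)) = fun x ↦
      cdf (gaussianReal 0 1) 0 + ∫ y in (0 : ℝ)..x, gaussianPDFReal 0 1 y := by
    ext x
    rw [cdf_gaussian_eq_integral, cdf_gaussian_eq_integral,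
      ← intervalIntegral.integral_Iic_sub_Iic hint.integrableOn hint.integrableOn]
    ring
  rw [h]
  exact (intervalIntegral.integral_hasDerivAt_right (hint.intervalIntegrable)
    (hc.stronglyMeasurableAtFilter _ _) hc.continuousAt).const_add _

theorem integrable_exp_mul_pdf (w : ℝ) :
    Integrable fun s ↦ exp (w * s) * gaussianPDFReal 0 1 s := by
  have h := ((integrable_gaussianPDFReal 0 1).comp_sub_right w).const_mul (exp (w ^ 2 / 2))
  refine h.congr (Filter.Eventually.of_forall fun s ↦ ?_)
  simp only [gaussianPDFReal_zero_one]
  rw [mul_left_comm, mul_left_comm (exp (w * s)), ← exp_add, ← exp_add]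
  congr 2
  ring

/-- The substitution `s = w - x` exhibits `mills` as a mixture of exponential functions, so that
it is monotone and convex. -/
theorem mills_eq_integral (w : ℝ) :
    mills w = √(2 * π) * ∫ s in Ici 0, exp (w * s) * gaussianPDFReal 0 1 s := by
  rw [mills, cdf_gaussian_eq_integral, mul_assoc, ← integral_indicator measurableSet_Iic,
    ← integral_indicator measurableSet_Ici,
    ← integral_sub_left_eq_self _ volume w, ← integral_const_mul]
  congr 2
  ext s
  by_cases hs : 0 ≤ s
  · rw [indicator_of_mem (by simpa using hs), indicator_of_mem (by simpa using hs),
      gaussianPDFReal_zero_one, gaussianPDFReal_zero_one, mul_left_comm,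
      mul_left_comm (exp (w * s)), ← exp_add, ← exp_add]
    congr 2
    ring
  · rw [indicator_of_notMem (by simpa using hs), indicator_of_notMem (by simpa using hs),
      mul_zero]

theorem mills_nonneg (w : ℝ) : 0 ≤ mills w :=
  mul_nonneg (by positivity) (cdf_nonneg _ _)

theorem monotone_mills : Monotone mills := by
  intro x y hxy
  rw [mills_eq_integral, mills_eq_integral]
  refine mul_le_mul_of_nonneg_left ?_ (sqrt_nonneg _)
  refine setIntegral_mono_on (integrable_exp_mul_pdf x).integrableOn
    (integrable_exp_mul_pdf y).integrableOn measurableSet_Ici fun s hs ↦ ?_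
  exact mul_le_mul_of_nonneg_right (exp_le_exp.2 (mul_le_mul_of_nonneg_right hxy hs))
    (gaussianPDFReal_nonneg _ _ _)

theorem convexOn_mills : ConvexOn ℝ univ mills := by
  refine ⟨convex_univ, fun x _ y _ a b ha hb hab ↦ ?_⟩
  simp only [mills_eq_integral, smul_eq_mul]
  rw [mul_left_comm a, mul_left_comm b, ← mul_add, ← integral_const_mul a, ← integral_const_mul b,
    ← integral_add ((integrable_exp_mul_pdf x).integrableOn.const_mul a)
      ((integrable_exp_mul_pdf y).integrableOn.const_mul b)]
  refine mul_le_mul_of_nonneg_left ?_ (sqrt_nonneg _)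
  refine setIntegral_mono_on (integrable_exp_mul_pdf _).integrableOn
    (((integrable_exp_mul_pdf x).integrableOn.const_mul a).add
      ((integrable_exp_mul_pdf y).integrableOn.const_mul b)) measurableSet_Ici fun s _ ↦ ?_
  have h := convexOn_exp.2 (mem_univ (x * s)) (mem_univ (y * s)) ha hb hab
  simp only [smul_eq_mul] at h
  have h' : (a * x + b * y) * s = a * (x * s) + b * (y * s) := by ring
  rw [h']
  linarith [mul_le_mul_of_nonneg_right h (gaussianPDFReal_nonneg 0 1 s)]

theorem hasDerivAt_mills (w : ℝ) : HasDerivAt mills (1 + w * mills w) w := by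
  have h1 : HasDerivAt (fun w : ℝ ↦ √(2 * π) * exp (w ^ 2 / 2))
      (√(2 * π) * (exp (w ^ 2 / 2) * w)) w := by
    have h2 : HasDerivAt (fun w : ℝ ↦ w ^ 2 / 2) w w := by
      have := ((hasDerivAt_id w).pow 2).div_const 2
      simpa using this
    exact (h2.exp).const_mul _
  have h3 := h1.mul (hasDerivAt_cdf_gaussian w)
  refine h3.congr_deriv ?_
  rw [gaussianPDFReal_zero_one, mills]
  have h4 : √(2 * π) * exp (w ^ 2 / 2) * ((√(2 * π))⁻¹ * exp (-(w ^ 2 / 2))) = 1 := by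
    have h5 : √(2 * π) ≠ 0 := by positivity
    rw [exp_neg]
    field_simp
  rw [h4]
  ring

theorem monotone_mul_mills : Monotone fun w ↦ w * mills w := by
  have hd : Differentiable ℝ mills := fun w ↦ (hasDerivAt_mills w).differentiableAt
  have h := convexOn_mills.monotoneOn_deriv (fun x _ ↦ hd x)
  intro x y hxy
  have := h (mem_univ x) (mem_univ y) hxy
  rw [(hasDerivAt_mills x).deriv, (hasDerivAt_mills y).deriv] at this
  simpa using this

theorem neg_one_le_mul_mills (w : ℝ) : -1 ≤ w * mills w := by
  have h : 0 ≤ deriv mills w := monotone_mills.deriv_nonneg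
  rw [(hasDerivAt_mills w).deriv] at h
  linarith

/-- The monotonicity of `w * mills w` in differential form. -/
theorem mills_mul_add_nonneg (w : ℝ) : 0 ≤ (1 + w ^ 2) * mills w + w := by
  have h : 0 ≤ deriv (fun w ↦ w * mills w) w := monotone_mul_mills.deriv_nonneg
  have h' := (hasDerivAt_id w).mul (hasDerivAt_mills w)
  have h'' : deriv (fun w ↦ w * mills w) w = 1 * mills w + id w * (1 + w * mills w) := h'.deriv
  rw [h''] at h
  simp only [id] at h
  linarith

theorem mills_le (w : ℝ) : mills w ≤ √(2 * π) * exp (w ^ 2 / 2) :=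
  mul_le_of_le_one_right (by positivity) (cdf_le_one _ _)

theorem cdf_gaussian_neg (w : ℝ) :
    cdf (gaussianReal 0 1) (-w) = 1 - cdf (gaussianReal 0 1) w := by
  have h1 : ∫ x in Ioi w, gaussianPDFReal 0 1 x = cdf (gaussianReal 0 1) (-w) := by
    rw [cdf_gaussian_eq_integral, ← integral_comp_neg_Ioi]
    simp [gaussianPDFReal_zero_one]
  have h2 := intervalIntegral.integral_Iic_add_Ioi (b := w) (f := gaussianPDFReal 0 1) (μ := volume)
    (integrable_gaussianPDFReal 0 1).integrableOn (integrable_gaussianPDFReal 0 1).integrableOn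
  rw [integral_gaussianPDFReal_eq_one 0 one_ne_zero, h1, ← cdf_gaussian_eq_integral] at h2
  linarith

theorem mills_neg (w : ℝ) :
    mills (-w) = √(2 * π) * exp (w ^ 2 / 2) * (1 - cdf (gaussianReal 0 1) w) := by
  rw [mills, cdf_gaussian_neg, neg_sq]

theorem one_le_mul_mills_neg {t : ℝ} (ht : 0 ≤ t) : 1 ≤ 2 * (1 + t) * mills (-t) := by
  rcases le_total t 1 with h | h
  · have h1 := mills_mul_add_nonneg (-1)
    have h2 : mills (-1) ≤ mills (-t) := monotone_mills (neg_le_neg h)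
    nlinarith
  · have h1 := mills_mul_add_nonneg (-t)
    have h3 : t ≤ (1 + t ^ 2) * mills (-t) := by nlinarith
    have h4 : 1 + t ^ 2 ≤ 2 * (1 + t) * t := by nlinarith
    have h5 := mul_le_mul_of_nonneg_right h4 (mills_nonneg (-t))
    nlinarith

/-- A lower bound for the tail of the standard normal distribution. -/
theorem exp_le_mul_one_sub_cdf {t : ℝ} (ht : 0 ≤ t) :
    exp (-(t ^ 2 / 2)) ≤ 2 * √(2 * π) * (1 + t) * (1 - cdf (gaussianReal 0 1) t) := by
  have h := one_le_mul_mills_neg ht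
  rw [mills_neg] at h
  have h1 := mul_le_mul_of_nonneg_left h (exp_nonneg (-(t ^ 2 / 2)))
  have h2 : exp (-(t ^ 2 / 2)) * exp (t ^ 2 / 2) = 1 := by rw [← exp_add]; simp
  calc exp (-(t ^ 2 / 2)) = exp (-(t ^ 2 / 2)) * 1 := (mul_one _).symm
    _ ≤ _ := h1
    _ = (exp (-(t ^ 2 / 2)) * exp (t ^ 2 / 2)) * (2 * √(2 * π) * (1 + t) *
          (1 - cdf (gaussianReal 0 1) t)) := by ring
    _ = _ := by rw [h2, one_mul]

theorem one_sub_cdf_pos {t : ℝ} (ht : 0 ≤ t) : 0 < 1 - cdf (gaussianReal 0 1) t := by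
  have h := (exp_pos (-(t ^ 2 / 2))).trans_le (exp_le_mul_one_sub_cdf ht)
  exact pos_of_mul_pos_right h (by positivity)

theorem sqrt_two_pi_le : √(2 * π) ≤ 2.51 := by
  rw [sqrt_le_left (by norm_num)]
  have := pi_lt_d2
  norm_num
  linarith

/-! ### A convex form of the solution of Stein's equation -/

/-- Tangent inequalities for a function whose derivative is monotone. -/
theorem sub_mul_le_of_hasDerivAt {H h : ℝ → ℝ} (hH : ∀ x, HasDerivAt H (h x) x)
    (hh : Monotone h) {x y : ℝ} (hxy : x ≤ y) :
    (y - x) * h x ≤ H y - H x ∧ H y - H x ≤ (y - x) * h y := by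
  rcases hxy.eq_or_lt with rfl | hlt
  · simp
  · obtain ⟨z, hz, h'⟩ := exists_hasDerivAt_eq_slope H h hlt
      (fun z _ ↦ (hH z).continuousAt.continuousWithinAt) fun z _ ↦ hH z
    have hpos : 0 < y - x := sub_pos.2 hlt
    have h1 : H y - H x = (y - x) * h z := by
      rw [h']; field_simp
    rw [h1]
    exact ⟨mul_le_mul_of_nonneg_left (hh hz.1.le) hpos.le,
      mul_le_mul_of_nonneg_left (hh hz.2.le) hpos.le⟩

/-- The derivative of `steinPrimitive t`. It is `w * f w` for the solution `f` of Stein's equation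
`f' w - w * f w = 1_{w ≤ t} - Φ t`. -/
noncomputable def steinDeriv (t w : ℝ) : ℝ :=
  if w ≤ t then (1 - cdf (gaussianReal 0 1) t) * (w * mills w)
  else cdf (gaussianReal 0 1) t * (w * mills (-w))

/-- The function `f w + (w - t)⁺ - (1 - Φ t) * w`, with `f` the solution of Stein's equation for the
half-line up to `t`. In contrast to `f`, it is convex. -/
noncomputable def steinPrimitive (t w : ℝ) : ℝ :=
  if w ≤ t then (1 - cdf (gaussianReal 0 1) t) * (mills w - w)
  else cdf (gaussianReal 0 1) t * (mills (-w) + w) - t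

theorem one_sub_cdf_mul_mills (t : ℝ) :
    (1 - cdf (gaussianReal 0 1) t) * mills t = cdf (gaussianReal 0 1) t * mills (-t) := by
  rw [mills_neg, mills]
  ring

theorem steinDeriv_of_le {t w : ℝ} (h : t ≤ w) :
    steinDeriv t w = cdf (gaussianReal 0 1) t * (w * mills (-w)) := by
  unfold steinDeriv
  split_ifs with h'
  · obtain rfl := le_antisymm h h'
    linear_combination t * one_sub_cdf_mul_mills t
  · rfl

theorem steinPrimitive_of_le {t w : ℝ} (h : t ≤ w) :
    steinPrimitive t w = cdf (gaussianReal 0 1) t * (mills (-w) + w) - t := by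
  unfold steinPrimitive
  split_ifs with h'
  · obtain rfl := le_antisymm h h'
    linear_combination one_sub_cdf_mul_mills t
  · rfl

theorem monotone_steinDeriv (t : ℝ) : Monotone (steinDeriv t) := by
  have h1 : MonotoneOn (steinDeriv t) (Iic t) := by
    intro x hx y hy hxy
    simp only [mem_Iic] at hx hy
    simp only [steinDeriv, hx, hy, if_true]
    exact mul_le_mul_of_nonneg_left (monotone_mul_mills hxy) (sub_nonneg.2 (cdf_le_one _ _))
  have h2 : MonotoneOn (steinDeriv t) (Ici t) := by
    intro x hx y hy hxy
    rw [steinDeriv_of_le hx, steinDeriv_of_le hy]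
    refine mul_le_mul_of_nonneg_left ?_ (cdf_nonneg _ _)
    have := monotone_mul_mills (neg_le_neg hxy)
    simp only at this
    linarith
  exact h1.Iic_union_Ici h2

theorem steinPrimitive_sub (t : ℝ) {x y : ℝ} (hxy : x ≤ y) :
    (y - x) * steinDeriv t x ≤ steinPrimitive t y - steinPrimitive t x ∧
      steinPrimitive t y - steinPrimitive t x ≤ (y - x) * steinDeriv t y := by
  have hH : ∀ x, HasDerivAt (fun x ↦ mills x - x) (x * mills x) x := fun x ↦
    ((hasDerivAt_mills x).sub (hasDerivAt_id x)).congr_deriv (by ring)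
  have key := fun {x y : ℝ} ↦ sub_mul_le_of_hasDerivAt hH monotone_mul_mills (x := x) (y := y)
  have hk : 0 ≤ 1 - cdf (gaussianReal 0 1) t := sub_nonneg.2 (cdf_le_one _ _)
  have hc : 0 ≤ cdf (gaussianReal 0 1) t := cdf_nonneg _ _
  have left : ∀ {x y : ℝ}, x ≤ y → y ≤ t →
      (y - x) * steinDeriv t x ≤ steinPrimitive t y - steinPrimitive t x ∧
      steinPrimitive t y - steinPrimitive t x ≤ (y - x) * steinDeriv t y := by
    intro x y hxy hy
    have h := key hxy
    simp only [steinDeriv, steinPrimitive, hy, hxy.trans hy, if_true]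
    constructor
    · have := mul_le_mul_of_nonneg_left h.1 hk
      linarith
    · have := mul_le_mul_of_nonneg_left h.2 hk
      linarith
  have right : ∀ {x y : ℝ}, x ≤ y → t ≤ x →
      (y - x) * steinDeriv t x ≤ steinPrimitive t y - steinPrimitive t x ∧
      steinPrimitive t y - steinPrimitive t x ≤ (y - x) * steinDeriv t y := by
    intro x y hxy hx
    have h := key (neg_le_neg hxy)
    rw [steinDeriv_of_le hx, steinDeriv_of_le (hx.trans hxy), steinPrimitive_of_le hx,
      steinPrimitive_of_le (hx.trans hxy)]
    constructor
    · have := mul_le_mul_of_nonneg_left h.2 hc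
      linarith
    · have := mul_le_mul_of_nonneg_left h.1 hc
      linarith
  rcases le_total y t with hy | hy
  · exact left hxy hy
  rcases le_total t x with hx | hx
  · exact right hxy hx
  · have h1 := left hx le_rfl
    have h2 := right hy le_rfl
    have m1 := mul_le_mul_of_nonneg_left (monotone_steinDeriv t hx) (sub_nonneg.2 hy)
    have m2 := mul_le_mul_of_nonneg_left (monotone_steinDeriv t hy) (sub_nonneg.2 hx)
    constructor <;> linarith [h1.1, h1.2, h2.1, h2.2]

/-- Stein's equation, in terms of `steinPrimitive` and its derivative. -/
theorem mul_steinPrimitive_sub (t w : ℝ) :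
    w * steinPrimitive t w - steinDeriv t w =
      w * max (w - t) 0 - (1 - cdf (gaussianReal 0 1) t) * w ^ 2 := by
  unfold steinPrimitive steinDeriv
  split_ifs with h
  · rw [max_eq_right (by linarith)]; ring
  · rw [max_eq_left (by linarith)]; ring

theorem abs_steinDeriv_of_nonpos {t w : ℝ} (ht : 0 ≤ t) (hw : w ≤ 0) :
    |steinDeriv t w| ≤ 1 - cdf (gaussianReal 0 1) t := by
  have hk : 0 ≤ 1 - cdf (gaussianReal 0 1) t := sub_nonneg.2 (cdf_le_one _ _)
  rw [steinDeriv, if_pos (hw.trans ht), abs_mul, abs_of_nonneg hk]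
  refine mul_le_of_le_one_right hk ?_
  rw [abs_le]
  exact ⟨neg_one_le_mul_mills w,
    (mul_nonpos_of_nonpos_of_nonneg hw (mills_nonneg w)).trans zero_le_one⟩

theorem abs_steinDeriv_of_mem {t w : ℝ} (hw : 0 ≤ w) (hwt : w ≤ t) :
    |steinDeriv t w| ≤
      (1 - cdf (gaussianReal 0 1) t) * (t * (√(2 * π) * exp (w ^ 2 / 2))) := by
  have hk : 0 ≤ 1 - cdf (gaussianReal 0 1) t := sub_nonneg.2 (cdf_le_one _ _)
  rw [steinDeriv, if_pos hwt, abs_of_nonneg (mul_nonneg hk (mul_nonneg hw (mills_nonneg w)))]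
  exact mul_le_mul_of_nonneg_left (mul_le_mul hwt (mills_le w) (mills_nonneg w) (hw.trans hwt)) hk

theorem abs_steinDeriv_of_lt {t w : ℝ} (ht : 0 ≤ t) (hwt : t < w) : |steinDeriv t w| ≤ 1 := by
  have hw : 0 ≤ w := ht.trans hwt.le
  rw [steinDeriv_of_le hwt.le, abs_of_nonneg
    (mul_nonneg (cdf_nonneg _ _) (mul_nonneg hw (mills_nonneg _)))]
  have h1 : w * mills (-w) ≤ 1 := by linarith [neg_one_le_mul_mills (-w)]
  exact mul_le_one₀ (cdf_le_one _ _) (mul_nonneg hw (mills_nonneg _)) h1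

end NormalApprox

/-! ### Moderate deviations from a weighted bound on the errors in Stein's identity -/

namespace RandomSubset

open Finset NormalApprox

variable {α : Type*} [DecidableEq α] [Fintype α] {I : Type*} [Fintype I]
variable {A : I → Finset α} {p : ℝ} {e : ℕ} {σ : ℝ}

/-- The sum of the absolute values of the two error terms in Stein's identity. -/
noncomputable def steinError (A : I → Finset α) (p : ℝ) (e : ℕ) (σ : ℝ) (ω : Finset α) : ℝ :=
  |massDev A p e σ ω| + |nearDev A p e σ ω|

theorem hasDerivAt_ev_exp (w : Finset α → ℝ) (u : ℝ) :
    HasDerivAt (fun u ↦ ev p fun ω ↦ Real.exp (u * w ω))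
      (ev p fun ω ↦ w ω * Real.exp (u * w ω)) u := by
  unfold ev
  refine HasDerivAt.fun_sum fun ω _ ↦ ?_
  have h := ((hasDerivAt_id u).mul_const (w ω)).exp.const_mul (weight p ω)
  refine h.congr_deriv ?_
  simp only [id]
  ring

/-- The error in Stein's identity for a function with increasing derivative `g`, in absolute
value. -/
theorem abs_ev_std_mul_sub_le_ev_steinError (hp : 0 ≤ p) (hp1 : p ≤ 1) (hA : ∀ i, #(A i) = e)
    (hσ : 0 < σ) {G g : ℝ → ℝ} (hg : Monotone g)
    (hG : ∀ x y, x ≤ y → (y - x) * g x ≤ G y - G x ∧ G y - G x ≤ (y - x) * g y) :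
    |ev p (fun ω ↦ std A (Fintype.card I * p ^ e) σ ω *
          G (std A (Fintype.card I * p ^ e) σ ω)) -
        ev p (fun ω ↦ g (std A (Fintype.card I * p ^ e) σ ω))| ≤
      ev p (fun ω ↦ |g (std A (Fintype.card I * p ^ e) σ ω)| * steinError A p e σ ω) := by
  obtain ⟨h1, h2⟩ := abs_ev_std_mul_sub_le hp hp1 hA hσ hg hG
  set w := std A (Fintype.card I * p ^ e) σ with hw
  have h3 : ev p (fun ω ↦ |g (w ω)| * steinError A p e σ ω) =
      ev p (fun ω ↦ |g (w ω) * massDev A p e σ ω|) +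
        ev p (fun ω ↦ |g (w ω) * nearDev A p e σ ω|) := by
    rw [← ev_add]
    congr 1
    ext ω
    rw [abs_mul, abs_mul, steinError]
    ring
  have h4 := abs_ev_le hp hp1 (fun ω ↦ g (w ω) * massDev A p e σ ω)
  have h5 := abs_ev_le hp hp1 (fun ω ↦ g (w ω) * nearDev A p e σ ω)
  have h6 := abs_le.1 h4
  have h7 := abs_le.1 h5
  have h8 := (abs_nonneg _).trans h5
  rw [h3, abs_le]
  constructor <;> linarith [h6.1, h6.2, h7.1, h7.2]

/-- Stein's identity for exponential functions is a differential inequality for the moment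
generating function. -/
theorem ev_exp_std_le (hp : 0 ≤ p) (hp1 : p ≤ 1) (hA : ∀ i, #(A i) = e) (hσ : 0 < σ) {t δ : ℝ}
    (hQ : ∀ u, 0 ≤ u → u ≤ t →
      ev p (fun ω ↦ steinError A p e σ ω *
        Real.exp (u * std A (Fintype.card I * p ^ e) σ ω)) ≤
      δ * ev p (fun ω ↦ Real.exp (u * std A (Fintype.card I * p ^ e) σ ω)))
    {u : ℝ} (hu : 0 ≤ u) (hut : u ≤ t) :
    ev p (fun ω ↦ Real.exp (u * std A (Fintype.card I * p ^ e) σ ω)) ≤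
      Real.exp ((1 + δ) * u ^ 2 / 2) := by
  set w := std A (Fintype.card I * p ^ e) σ with hw
  set M : ℝ → ℝ := fun u ↦ ev p (fun ω ↦ Real.exp (u * w ω)) with hM
  have hder : ∀ u, 0 ≤ u → u ≤ t → ev p (fun ω ↦ w ω * Real.exp (u * w ω)) ≤
      u * (1 + δ) * M u := by
    intro u hu hut
    have hd : ∀ x, HasDerivAt (fun x ↦ Real.exp (u * x)) (u * Real.exp (u * x)) x := by
      intro x
      have h := ((hasDerivAt_id x).const_mul u).exp
      refine h.congr_deriv ?_
      simp only [id]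
      ring
    have hmono : Monotone fun x ↦ u * Real.exp (u * x) := fun x y hxy ↦
      mul_le_mul_of_nonneg_left (Real.exp_le_exp.2 (mul_le_mul_of_nonneg_left hxy hu)) hu
    have h := abs_ev_std_mul_sub_le_ev_steinError (A := A) hp hp1 hA hσ hmono
      (fun x y hxy ↦ sub_mul_le_of_hasDerivAt hd hmono hxy)
    rw [← hw] at h
    have h1 : ev p (fun ω ↦ |u * Real.exp (u * w ω)| * steinError A p e σ ω) =
        u * ev p (fun ω ↦ steinError A p e σ ω * Real.exp (u * w ω)) := by
      rw [← ev_const_mul]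
      congr 1
      ext ω
      rw [abs_of_nonneg (mul_nonneg hu (Real.exp_nonneg _))]
      ring
    rw [h1, ev_const_mul] at h
    have h2 := mul_le_mul_of_nonneg_left (hQ u hu hut) hu
    have h3 := (abs_le.1 h).2
    simp only [hM]
    linarith
  have hM' := fun u ↦ hasDerivAt_ev_exp (p := p) w u
  have hN : ∀ u, HasDerivAt (fun u ↦ M u * Real.exp (-((1 + δ) * u ^ 2 / 2)))
      (ev p (fun ω ↦ w ω * Real.exp (u * w ω)) * Real.exp (-((1 + δ) * u ^ 2 / 2)) +
        M u * (Real.exp (-((1 + δ) * u ^ 2 / 2)) * -((1 + δ) * u))) u := by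
    intro u
    refine (hM' u).mul (HasDerivAt.exp ?_)
    have h := ((((hasDerivAt_id u).pow 2).const_mul (1 + δ)).div_const 2).neg
    refine h.congr_deriv ?_
    simp only [id]
    ring
  have hanti : AntitoneOn (fun u ↦ M u * Real.exp (-((1 + δ) * u ^ 2 / 2))) (Set.Icc 0 t) := by
    refine antitoneOn_of_deriv_nonpos (convex_Icc 0 t)
      (fun u _ ↦ (hN u).continuousAt.continuousWithinAt)
      (fun u _ ↦ (hN u).differentiableAt.differentiableWithinAt) fun u hu' ↦ ?_
    rw [interior_Icc] at hu'
    rw [(hN u).deriv]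
    have h := hder u hu'.1.le hu'.2.le
    have h1 := mul_le_mul_of_nonneg_right h (Real.exp_nonneg (-((1 + δ) * u ^ 2 / 2)))
    linarith
  have h := hanti (Set.left_mem_Icc.2 (hu.trans hut)) (Set.mem_Icc.2 ⟨hu, hut⟩) hu
  simp only [hM, zero_mul, Real.exp_zero, ev_const] at h
  rw [Real.exp_neg, ← div_eq_mul_inv, div_le_iff₀ (Real.exp_pos _)] at h
  simpa using h

theorem monotone_ite_lt (t : ℝ) : Monotone fun x : ℝ ↦ if t < x then (1 : ℝ) else 0 := by
  intro x y hxy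
  simp only
  split_ifs with h1 h2
  · rfl
  · exact absurd (h1.trans_le hxy) h2
  · norm_num
  · rfl

theorem max_sub_zero_sub (t x y : ℝ) (hxy : x ≤ y) :
    (y - x) * (if t < x then (1 : ℝ) else 0) ≤ max (y - t) 0 - max (x - t) 0 ∧
      max (y - t) 0 - max (x - t) 0 ≤ (y - x) * (if t < y then (1 : ℝ) else 0) := by
  rcases le_or_gt x t with hx | hx <;> rcases le_or_gt y t with hy | hy
  · rw [if_neg (not_lt.2 hx), if_neg (not_lt.2 hy), max_eq_right (by linarith),
      max_eq_right (by linarith)]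
    constructor <;> linarith
  · rw [if_neg (not_lt.2 hx), if_pos hy, max_eq_left (by linarith), max_eq_right (by linarith)]
    constructor <;> linarith
  · linarith
  · rw [if_pos hx, if_pos hy, max_eq_left (by linarith), max_eq_left (by linarith)]
    constructor <;> linarith

/-- Stein's method: the error in the normal approximation of the tail probability. -/
theorem abs_ev_tail_sub_le (hp : 0 ≤ p) (hp1 : p ≤ 1) (hA : ∀ i, #(A i) = e) (hσ : 0 < σ)
    (hvar : ev p (fun ω ↦ (total A ω - Fintype.card I * p ^ e) ^ 2) = σ ^ 2) (t : ℝ) :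
    |ev p (fun ω ↦ if t < std A (Fintype.card I * p ^ e) σ ω then (1 : ℝ) else 0) -
        (1 - cdf (gaussianReal 0 1) t)| ≤
      ev p (fun ω ↦ (|steinDeriv t (std A (Fintype.card I * p ^ e) σ ω)| +
        if t < std A (Fintype.card I * p ^ e) σ ω then (1 : ℝ) else 0) *
          steinError A p e σ ω) := by
  have h1 := abs_ev_std_mul_sub_le_ev_steinError (A := A) hp hp1 hA hσ (monotone_steinDeriv t)
    (fun x y hxy ↦ steinPrimitive_sub t hxy)
  have h2 := abs_ev_std_mul_sub_le_ev_steinError (A := A) hp hp1 hA hσ (monotone_ite_lt t)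
    (max_sub_zero_sub t)
  set w := std A (Fintype.card I * p ^ e) σ with hw
  have hw2 : ev p (fun ω ↦ w ω ^ 2) = 1 := by
    have : (fun ω ↦ w ω ^ 2) = fun ω ↦
        (total A ω - Fintype.card I * p ^ e) ^ 2 * (σ ^ 2)⁻¹ := by
      ext ω
      simp only [hw, std]
      rw [div_pow, div_eq_mul_inv]
    rw [this, ev_mul_const, hvar, mul_inv_cancel₀ (by positivity)]
  rw [← ev_sub] at h1
  simp_rw [mul_steinPrimitive_sub] at h1
  rw [ev_sub, ev_const_mul, hw2, mul_one] at h1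
  have h3 : ev p (fun ω ↦ |if t < w ω then (1 : ℝ) else 0| * steinError A p e σ ω) =
      ev p (fun ω ↦ (if t < w ω then (1 : ℝ) else 0) * steinError A p e σ ω) := by
    congr 1
    ext ω
    congr 1
    split_ifs <;> simp
  rw [h3] at h2
  simp_rw [add_mul]
  rw [ev_add]
  have h4 := abs_le.1 h1
  have h5 := abs_le.1 h2
  rw [abs_le]
  constructor <;> linarith [h4.1, h4.2, h5.1, h5.2]

/-- On `[0, t]`, the function `exp (x ^ 2 / 2)` is dominated by a sum of exponentials. -/
theorem exp_sq_div_two_le_sum {t x : ℝ} (hx : 0 ≤ x) (hxt : x ≤ t) :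
    Real.exp (x ^ 2 / 2) ≤ Real.exp (1 / 2) *
      ∑ j ∈ range (⌊t⌋₊ + 1), Real.exp (-((j : ℝ) ^ 2 / 2)) * Real.exp (j * x) := by
  have hmem : ⌊x⌋₊ ∈ range (⌊t⌋₊ + 1) := by
    rw [mem_range, Nat.lt_succ_iff]
    exact Nat.floor_mono hxt
  have h1 := Nat.floor_le hx
  have h2 := (Nat.lt_floor_add_one x).le
  calc Real.exp (x ^ 2 / 2)
      ≤ Real.exp (1 / 2) * (Real.exp (-((⌊x⌋₊ : ℝ) ^ 2 / 2)) * Real.exp (⌊x⌋₊ * x)) := by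
        rw [← Real.exp_add, ← Real.exp_add, Real.exp_le_exp]
        nlinarith
    _ ≤ _ := by
        refine mul_le_mul_of_nonneg_left ?_ (Real.exp_nonneg _)
        exact single_le_sum (f := fun j : ℕ ↦ Real.exp (-((j : ℝ) ^ 2 / 2)) * Real.exp (j * x))
          (fun j _ ↦ by positivity) hmem

theorem abs_steinDeriv_add_ite_le {t : ℝ} (ht : 0 ≤ t) (x : ℝ) :
    |steinDeriv t x| + (if t < x then (1 : ℝ) else 0) ≤
      (1 - cdf (gaussianReal 0 1) t) + (1 - cdf (gaussianReal 0 1) t) * (t * (√(2 * Real.pi) *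
        (Real.exp (1 / 2) * ∑ j ∈ range (⌊t⌋₊ + 1),
          Real.exp (-((j : ℝ) ^ 2 / 2)) * Real.exp (j * x)))) +
        2 * (Real.exp (-t ^ 2) * Real.exp (t * x)) := by
  have hk : 0 ≤ 1 - cdf (gaussianReal 0 1) t := sub_nonneg.2 (cdf_le_one _ _)
  have h2 : 0 ≤ (1 - cdf (gaussianReal 0 1) t) * (t * (√(2 * Real.pi) *
        (Real.exp (1 / 2) * ∑ j ∈ range (⌊t⌋₊ + 1),
          Real.exp (-((j : ℝ) ^ 2 / 2)) * Real.exp (j * x)))) := by positivity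
  have h3 : 0 ≤ 2 * (Real.exp (-t ^ 2) * Real.exp (t * x)) := by positivity
  rcases le_or_gt x 0 with hx | hx
  · rw [if_neg (by linarith)]
    linarith [abs_steinDeriv_of_nonpos ht hx]
  rcases le_or_gt x t with hxt | hxt
  · rw [if_neg (by linarith)]
    have h4 := abs_steinDeriv_of_mem hx.le hxt
    have h5 : (1 - cdf (gaussianReal 0 1) t) * (t * (√(2 * Real.pi) * Real.exp (x ^ 2 / 2))) ≤
      (1 - cdf (gaussianReal 0 1) t) * (t * (√(2 * Real.pi) *
        (Real.exp (1 / 2) * ∑ j ∈ range (⌊t⌋₊ + 1),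
          Real.exp (-((j : ℝ) ^ 2 / 2)) * Real.exp (j * x)))) := by
      gcongr
      exact exp_sq_div_two_le_sum hx.le hxt
    linarith
  · rw [if_pos hxt]
    have h4 := abs_steinDeriv_of_lt ht hxt
    have h5 : 1 ≤ Real.exp (-t ^ 2) * Real.exp (t * x) := by
      rw [← Real.exp_add]
      exact Real.one_le_exp (by nlinarith)
    linarith

/-- Moderate deviations, from a bound on the exponentially weighted mean of the error terms in
Stein's identity. -/
theorem abs_tail_div_sub_one_le (hp : 0 ≤ p) (hp1 : p ≤ 1) (hA : ∀ i, #(A i) = e) (hσ : 0 < σ)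
    (hvar : ev p (fun ω ↦ (total A ω - Fintype.card I * p ^ e) ^ 2) = σ ^ 2) {t δ : ℝ}
    (ht : 0 ≤ t) (hδ : 0 ≤ δ)
    (hQ : ∀ u, 0 ≤ u → u ≤ t →
      ev p (fun ω ↦ steinError A p e σ ω *
        Real.exp (u * std A (Fintype.card I * p ^ e) σ ω)) ≤
      δ * ev p (fun ω ↦ Real.exp (u * std A (Fintype.card I * p ^ e) σ ω))) :
    |ev p (fun ω ↦ if t < std A (Fintype.card I * p ^ e) σ ω then (1 : ℝ) else 0) /
        (1 - cdf (gaussianReal 0 1) t) - 1| ≤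
      20 * δ * Real.exp (δ * t ^ 2 / 2) * (1 + t ^ 2) := by
  have hmain := abs_ev_tail_sub_le (A := A) hp hp1 hA hσ hvar t
  have hmgf := fun {u : ℝ} ↦ ev_exp_std_le (A := A) hp hp1 hA hσ hQ (u := u)
  set w := std A (Fintype.card I * p ^ e) σ with hw
  set k := 1 - cdf (gaussianReal 0 1) t with hk
  have hk0 : 0 < k := one_sub_cdf_pos ht
  set E := Real.exp (δ * t ^ 2 / 2) with hE
  have hE1 : 1 ≤ E := Real.one_le_exp (by positivity)
  set Q := steinError A p e σ with hQdef
  have hQ0 : ∀ ω, 0 ≤ Q ω := fun ω ↦ add_nonneg (abs_nonneg _) (abs_nonneg _)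
  have hwt : ∀ u, 0 ≤ u → u ≤ t → Real.exp (-(u ^ 2 / 2)) *
      ev p (fun ω ↦ Q ω * Real.exp (u * w ω)) ≤ δ * E := by
    intro u hu hut
    have h1 := (hQ u hu hut).trans (mul_le_mul_of_nonneg_left (hmgf hu hut) hδ)
    have h2 := mul_le_mul_of_nonneg_left h1 (Real.exp_nonneg (-(u ^ 2 / 2)))
    refine h2.trans ?_
    rw [mul_left_comm, ← Real.exp_add]
    refine mul_le_mul_of_nonneg_left (Real.exp_le_exp.2 ?_) hδ
    have : δ * u ^ 2 ≤ δ * t ^ 2 := by gcongr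
    linarith
  have h0 : ev p Q ≤ δ := by
    have := hQ 0 le_rfl ht
    simpa [ev_const] using this
  have hbound : ev p (fun ω ↦ (|steinDeriv t (w ω)| + if t < w ω then (1 : ℝ) else 0) * Q ω) ≤
      k * δ + k * (t * (√(2 * Real.pi) * (Real.exp (1 / 2) * ((t + 1) * (δ * E))))) +
        2 * (Real.exp (-(t ^ 2 / 2)) * (δ * E)) := by
    have h1 : ∀ ω, (|steinDeriv t (w ω)| + if t < w ω then (1 : ℝ) else 0) * Q ω ≤
        k * Q ω + k * (t * (√(2 * Real.pi) * (Real.exp (1 / 2) * ∑ j ∈ range (⌊t⌋₊ + 1),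
          Real.exp (-((j : ℝ) ^ 2 / 2)) * (Q ω * Real.exp (j * w ω))))) +
          2 * (Real.exp (-t ^ 2) * (Q ω * Real.exp (t * w ω))) := by
      intro ω
      refine (mul_le_mul_of_nonneg_right (abs_steinDeriv_add_ite_le ht (w ω)) (hQ0 ω)).trans
        (le_of_eq ?_)
      have : ∀ j : ℕ, Real.exp (-((j : ℝ) ^ 2 / 2)) * (Q ω * Real.exp (j * w ω)) =
          Real.exp (-((j : ℝ) ^ 2 / 2)) * Real.exp (j * w ω) * Q ω := fun j ↦ by ring
      simp_rw [this]
      rw [← sum_mul]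
      ring
    refine (ev_mono hp hp1 h1).trans ?_
    simp only [ev_add, ev_const_mul, ev_sum]
    have h2 : ∑ j ∈ range (⌊t⌋₊ + 1), Real.exp (-((j : ℝ) ^ 2 / 2)) *
        ev p (fun ω ↦ Q ω * Real.exp (j * w ω)) ≤ (t + 1) * (δ * E) := by
      calc _ ≤ ∑ j ∈ range (⌊t⌋₊ + 1), δ * E := by
            refine sum_le_sum fun j hj ↦ hwt j j.cast_nonneg ?_
            rw [mem_range, Nat.lt_succ_iff] at hj
            exact (Nat.cast_le.2 hj).trans (Nat.floor_le ht)
        _ = (⌊t⌋₊ + 1) * (δ * E) := by simp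
        _ ≤ _ := by
            have := Nat.floor_le ht
            gcongr
    have h3 : Real.exp (-t ^ 2) * ev p (fun ω ↦ Q ω * Real.exp (t * w ω)) ≤
        Real.exp (-(t ^ 2 / 2)) * (δ * E) := by
      have : Real.exp (-t ^ 2) = Real.exp (-(t ^ 2 / 2)) * Real.exp (-(t ^ 2 / 2)) := by
        rw [← Real.exp_add]; congr 1; ring
      rw [this, mul_assoc]
      exact mul_le_mul_of_nonneg_left (hwt t ht le_rfl) (Real.exp_nonneg _)
    have h4 : 0 ≤ k := hk0.le
    gcongr
  have htail := exp_le_mul_one_sub_cdf ht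
  rw [← hk] at htail
  have hfin : k * δ + k * (t * (√(2 * Real.pi) * (Real.exp (1 / 2) * ((t + 1) * (δ * E))))) +
        2 * (Real.exp (-(t ^ 2 / 2)) * (δ * E)) ≤ k * (20 * δ * E * (1 + t ^ 2)) := by
    have hs := sqrt_two_pi_le
    have hs0 : 0 ≤ √(2 * Real.pi) := Real.sqrt_nonneg _
    have he : Real.exp (1 / 2) ≤ 1.65 := by
      have h1 := Real.exp_one_lt_d9
      have h2 : Real.exp (1 / 2) ^ 2 = Real.exp 1 := by
        rw [← Real.exp_nat_mul]; norm_num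
      nlinarith [Real.exp_pos (1 / 2)]
    have hδE : 0 ≤ δ * E := mul_nonneg hδ (by linarith)
    have h1 : δ ≤ δ * E := le_mul_of_one_le_right hδ hE1
    calc k * δ + k * (t * (√(2 * Real.pi) * (Real.exp (1 / 2) * ((t + 1) * (δ * E))))) +
        2 * (Real.exp (-(t ^ 2 / 2)) * (δ * E))
        ≤ k * (δ * E) + k * (t * (2.51 * (1.65 * ((t + 1) * (δ * E))))) +
          2 * ((2 * 2.51 * (1 + t) * k) * (δ * E)) := by
          have h5 : Real.exp (-(t ^ 2 / 2)) ≤ 2 * 2.51 * (1 + t) * k := by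
            refine htail.trans ?_
            gcongr
          gcongr
      _ = k * (δ * E) * (1 + 2.51 * 1.65 * (t * (t + 1)) + 4 * 2.51 * (1 + t)) := by ring
      _ ≤ k * (δ * E) * (20 * (1 + t ^ 2)) := by
          refine mul_le_mul_of_nonneg_left ?_ (mul_nonneg hk0.le hδE)
          nlinarith [sq_nonneg (t - 1)]
      _ = _ := by ring
  rw [div_sub_one hk0.ne', abs_div, abs_of_pos hk0, div_le_iff₀ hk0, mul_comm]
  exact hmain.trans (hbound.trans hfin)

end RandomSubset

/-! ### Moderate deviations from bounds on `attach` -/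

namespace RandomSubset

open Finset NormalApprox

variable {α : Type*} [DecidableEq α] [Fintype α] {I : Type*} [Fintype I]
variable {A : I → Finset α} {p : ℝ} {e : ℕ} {σ : ℝ}

/-- The bound on the weighted error terms in units of the rate `θ`, where `s₀` is the order of
magnitude of the standard deviation `σ`. Since `s₀ / σ ≤ 4 / 3`, the constants are sufficient if
`8 * (4 / 3) ^ 3 ≤ 19` and `16 / 405 + 32 * (4 / 3) / 1079 ≤ 81 / 1024`. -/
theorem errors_bound_le {q P s₀ θ c u t B₁ B₂ B₃ B₄ : ℝ} (he : 1 ≤ e) (hσ : 0 < σ) (hs₀ : 0 < s₀)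
    (hθ : 0 < θ) (hc : 0 < c) (hu : 0 ≤ u) (hut : u ≤ t) (hB₁ : 0 ≤ B₁) (hB₂ : 0 ≤ B₂)
    (hB₃ : 0 ≤ B₃) (hB₄ : 0 ≤ B₄)
    (hP0 : 0 ≤ q * P) (hP : q * P ≤ s₀ / θ) (hσs : 3 / 4 * s₀ ≤ σ) (hct : c * (1 + t) * θ ≤ 1)
    (n₁ : 19 * e * (B₁ * B₂) ≤ c) (n₂ : 405 * e * (B₁ * B₂ * B₃) ≤ c ^ 2)
    (n₃ : 1079 * e * (B₁ * B₂ * B₃ * B₄) ≤ c ^ 3) :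
    4 / σ ^ 2 * (u / σ * (4 * e * q) * (P * (B₁ * (s₀ * θ)) * (B₂ * (s₀ * θ))) +
      √(4 * (4 * e * q) * (P * (B₁ * (s₀ * θ)) * (B₂ * (s₀ * θ)) * (B₃ * (s₀ * θ))) +
        8 * (u / σ) * (4 * e * q) *
          (P * (B₁ * (s₀ * θ)) * (B₂ * (s₀ * θ)) * (B₃ * (s₀ * θ)) * (B₄ * (s₀ * θ))))) ≤
      2 * c * (1 + u) * θ := by
  have he0 : (0 : ℝ) < e := by exact_mod_cast he
  have hr : s₀ / σ ≤ 4 / 3 := by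
    rw [div_le_iff₀ hσ]; linarith
  have hr0 : 0 ≤ s₀ / σ := by positivity
  have hPθ : 0 ≤ q * P * θ := mul_nonneg hP0 hθ.le
  have hP' : q * P * θ ≤ s₀ := by rwa [le_div_iff₀ hθ] at hP
  have h1 : 4 / σ ^ 2 * (u / σ * (4 * e * q) * (P * (B₁ * (s₀ * θ)) * (B₂ * (s₀ * θ)))) ≤
      2 * c * u * θ := by
    calc 4 / σ ^ 2 * (u / σ * (4 * e * q) * (P * (B₁ * (s₀ * θ)) * (B₂ * (s₀ * θ))))
        = 16 / σ ^ 3 * (u * e * (B₁ * B₂) * s₀ ^ 2 * θ) * (q * P * θ) := by field_simp; ring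
      _ ≤ 16 / σ ^ 3 * (u * e * (B₁ * B₂) * s₀ ^ 2 * θ) * s₀ :=
          mul_le_mul_of_nonneg_left hP' (by positivity)
      _ = 16 * (u * e * (B₁ * B₂) * θ) * (s₀ / σ) ^ 3 := by field_simp
      _ ≤ 16 * (u * e * (B₁ * B₂) * θ) * (4 / 3) ^ 3 :=
          mul_le_mul_of_nonneg_left (pow_le_pow_left₀ hr0 hr 3) (by positivity)
      _ ≤ 2 * (19 * e * (B₁ * B₂)) * u * θ := by
          have : 0 ≤ u * e * (B₁ * B₂) * θ := by positivity
          linarith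
      _ ≤ _ := by gcongr
  have h2 : 4 / σ ^ 2 *
      √(4 * (4 * e * q) * (P * (B₁ * (s₀ * θ)) * (B₂ * (s₀ * θ)) * (B₃ * (s₀ * θ))) +
        8 * (u / σ) * (4 * e * q) *
          (P * (B₁ * (s₀ * θ)) * (B₂ * (s₀ * θ)) * (B₃ * (s₀ * θ)) * (B₄ * (s₀ * θ)))) ≤
      2 * c * θ := by
    rw [div_mul_eq_mul_div, div_le_iff₀ (by positivity), ← le_div_iff₀' (by norm_num : (0 : ℝ) < 4)]
    refine Real.sqrt_le_iff.2 ⟨by positivity, ?_⟩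
    have huθ : c * (u * θ) ≤ 1 := by
      refine le_trans ?_ hct
      have : u * θ ≤ (1 + t) * θ := mul_le_mul_of_nonneg_right (by linarith) hθ.le
      nlinarith
    have hB : 1079 * e * (B₁ * B₂ * B₃ * B₄) * (u * θ) ≤ c ^ 2 := by
      calc 1079 * e * (B₁ * B₂ * B₃ * B₄) * (u * θ) ≤ c ^ 3 * (u * θ) := by gcongr
        _ = c ^ 2 * (c * (u * θ)) := by ring
        _ ≤ c ^ 2 := mul_le_of_le_one_right (by positivity) huθ
    calc 4 * (4 * e * q) * (P * (B₁ * (s₀ * θ)) * (B₂ * (s₀ * θ)) * (B₃ * (s₀ * θ))) +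
        8 * (u / σ) * (4 * e * q) *
          (P * (B₁ * (s₀ * θ)) * (B₂ * (s₀ * θ)) * (B₃ * (s₀ * θ)) * (B₄ * (s₀ * θ)))
        = (16 * e * (B₁ * B₂ * B₃) * (s₀ ^ 3 * θ ^ 2) +
            32 * e * (B₁ * B₂ * B₃ * B₄) * (u * θ) * (s₀ / σ) * (s₀ ^ 3 * θ ^ 2)) *
              (q * P * θ) := by field_simp; ring
      _ ≤ (16 * e * (B₁ * B₂ * B₃) * (s₀ ^ 3 * θ ^ 2) +
            32 * e * (B₁ * B₂ * B₃ * B₄) * (u * θ) * (4 / 3) * (s₀ ^ 3 * θ ^ 2)) * s₀ := by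
          gcongr
      _ = 16 * (e * (B₁ * B₂ * B₃)) * (s₀ ^ 4 * θ ^ 2) +
            32 * (4 / 3) * (e * (B₁ * B₂ * B₃ * B₄) * (u * θ)) * (s₀ ^ 4 * θ ^ 2) := by ring
      _ ≤ 16 * (c ^ 2 / 405) * (s₀ ^ 4 * θ ^ 2) +
            32 * (4 / 3) * (c ^ 2 / 1079) * (s₀ ^ 4 * θ ^ 2) := by
          have i1 : e * (B₁ * B₂ * B₃) ≤ c ^ 2 / 405 := by
            rw [le_div_iff₀ (by norm_num)]; linarith
          have i2 : e * (B₁ * B₂ * B₃ * B₄) * (u * θ) ≤ c ^ 2 / 1079 := by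
            rw [le_div_iff₀ (by norm_num)]; linarith
          gcongr
      _ ≤ 81 / 1024 * (c ^ 2 * (s₀ ^ 4 * θ ^ 2)) := by
          have : 0 ≤ c ^ 2 * (s₀ ^ 4 * θ ^ 2) := by positivity
          linarith
      _ ≤ (2 * c * θ * σ ^ 2 / 4) ^ 2 := by
          have h3 : (3 / 4 * s₀) ^ 4 ≤ σ ^ 4 := pow_le_pow_left₀ (by positivity) hσs 4
          have h4 : 0 ≤ c ^ 2 * θ ^ 2 := by positivity
          nlinarith [mul_le_mul_of_nonneg_left h3 h4]
  calc _ = _ + _ := mul_add _ _ _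
    _ ≤ 2 * c * u * θ + 2 * c * θ := add_le_add h1 h2
    _ = _ := by ring

/-- Moderate deviations for the number of members of a family of sets that are contained in a random
set. -/
theorem abs_tail_div_sub_one_le_of_attach (hp : 0 ≤ p) (hp1 : p ≤ 1) (hA : ∀ i, #(A i) = e)
    (he : 1 ≤ e) (hσ : 0 < σ)
    (hvar : ev p (fun ω ↦ (total A ω - Fintype.card I * p ^ e) ^ 2) = σ ^ 2) {D : ℕ}
    (hD : ∀ i, #(meets A (A i)) ≤ D) {t s₀ θ c B₁ B₂ B₃ B₄ : ℝ} (ht : 0 ≤ t) (hs₀ : 0 < s₀)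
    (hθ : 0 < θ) (hc : 0 < c) (hB₁ : 0 ≤ B₁) (hB₂ : 0 ≤ B₂) (hB₃ : 0 ≤ B₃) (hB₄ : 0 ≤ B₄)
    (hP : (1 - p) * (Fintype.card I * p ^ e) ≤ s₀ / θ) (hσs : 3 / 4 * s₀ ≤ σ)
    (hct : c * (1 + t) * θ ≤ 1)
    (n₁ : 19 * e * (B₁ * B₂) ≤ c) (n₂ : 405 * e * (B₁ * B₂ * B₃) ≤ c ^ 2)
    (n₃ : 1079 * e * (B₁ * B₂ * B₃ * B₄) ≤ c ^ 3)
    (h₁ : ∀ i, attach A p (A i) ≤ B₁ * (s₀ * θ))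
    (h₂ : ∀ i j, attach A p (A i ∪ A j) ≤ B₂ * (s₀ * θ))
    (h₃ : ∀ i j k, attach A p (A i ∪ A j ∪ A k) ≤ B₃ * (s₀ * θ))
    (h₄ : ∀ i j k l, attach A p (A i ∪ A j ∪ A k ∪ A l) ≤ B₄ * (s₀ * θ)) :
    |ev p (fun ω ↦ if t < std A (Fintype.card I * p ^ e) σ ω then (1 : ℝ) else 0) /
        (1 - cdf (gaussianReal 0 1) t) - 1| ≤
      40 * (c * ((1 + t) * θ * Real.exp (5 * D * t / σ))) *
        Real.exp (c * ((1 + t) * θ * Real.exp (5 * D * t / σ)) * t ^ 2) * (1 + t ^ 2) := by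
  set δ := 2 * (c * ((1 + t) * θ * Real.exp (5 * D * t / σ))) with hδ
  have hδ0 : 0 ≤ δ := by positivity
  refine (abs_tail_div_sub_one_le (δ := δ) hp hp1 hA hσ hvar ht hδ0 fun u hu hut ↦ ?_).trans
    (le_of_eq ?_)
  · set μ : ℝ := Fintype.card I * p ^ e with hμ
    have hexp : ∀ ω, Real.exp (u * std A μ σ ω) =
        Real.exp (-(u * μ / σ)) * Real.exp (u / σ * total A ω) := by
      intro ω
      rw [← Real.exp_add]
      congr 1
      simp only [std]
      ring
    have hm : ev p (fun ω ↦ Real.exp (u * std A μ σ ω)) =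
        Real.exp (-(u * μ / σ)) * mgf A p (u / σ) := by
      simp_rw [hexp]
      rw [ev_const_mul, mgf]
    have hQ : ev p (fun ω ↦ steinError A p e σ ω * Real.exp (u * std A μ σ ω)) =
        Real.exp (-(u * μ / σ)) *
          ev p (fun ω ↦ steinError A p e σ ω * Real.exp (u / σ * total A ω)) := by
      rw [← ev_const_mul]
      congr 1
      ext ω
      rw [hexp]
      ring
    have hmain := ev_errors_mul_exp_le (A := A) hp hp1 hA hσ hvar hD (div_nonneg hu hσ.le)
      (by positivity : 0 ≤ B₁ * (s₀ * θ)) (by positivity : 0 ≤ B₂ * (s₀ * θ))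
      (by positivity : 0 ≤ B₃ * (s₀ * θ)) (by positivity : 0 ≤ B₄ * (s₀ * θ)) h₁ h₂ h₃ h₄
    have hb := errors_bound_le (e := e) (q := 1 - p) (P := μ) he hσ hs₀ hθ hc hu hut hB₁ hB₂ hB₃
      hB₄ (mul_nonneg (sub_nonneg.2 hp1) (by positivity)) hP hσs hct n₁ n₂ n₃
    have hm0 : 0 ≤ mgf A p (u / σ) := mgf_nonneg hp hp1 _
    have hbound : ev p (fun ω ↦ steinError A p e σ ω * Real.exp (u / σ * total A ω)) ≤
        δ * mgf A p (u / σ) := by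
      refine hmain.trans ?_
      rw [mul_left_comm]
      calc _ ≤ Real.exp (u / σ * (5 * D)) * mgf A p (u / σ) * (2 * c * (1 + u) * θ) :=
            mul_le_mul_of_nonneg_left hb (by positivity)
        _ ≤ Real.exp (5 * D * t / σ) * mgf A p (u / σ) * (2 * c * (1 + t) * θ) := by
            have : u / σ * (5 * D) ≤ 5 * D * t / σ := by
              rw [div_mul_eq_mul_div]
              have : u * (5 * D) ≤ 5 * D * t := by
                have : (0 : ℝ) ≤ 5 * D := by positivity
                nlinarith
              gcongr
            gcongr
        _ = _ := by rw [hδ]; ring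
    rw [hm, hQ, mul_left_comm δ]
    exact mul_le_mul_of_nonneg_left hbound (Real.exp_nonneg _)
  · rw [hδ]
    congr 1
    congr 1
    · ring
    · congr 1; ring

end RandomSubset

/-! ### Random graphs as random sets of pairs of vertices -/

namespace SubgraphCount

open Finset RandomSubset

/-- The possible edges of a graph on `n` vertices. -/
abbrev Pair (n : ℕ) : Type :=
  {x : Sym2 (Fin n) // ¬ x.IsDiag}

open Classical in
/-- The possible edges that belong to a given set. -/
noncomputable def edgesIn {n : ℕ} (S : Set (Sym2 (Fin n))) : Finset (Pair n) :=
  univ.filter fun x ↦ x.1 ∈ S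

theorem mem_edgesIn {n : ℕ} {S : Set (Sym2 (Fin n))} {x : Pair n} :
    x ∈ edgesIn S ↔ x.1 ∈ S := by
  simp [edgesIn]

/-- Graphs on `n` vertices correspond to sets of possible edges. -/
noncomputable def graphEquiv (n : ℕ) : Finset (Pair n) ≃ SimpleGraph (Fin n) where
  toFun ω := SimpleGraph.fromEdgeSet (Subtype.val '' (ω : Set (Pair n)))
  invFun G := edgesIn G.edgeSet
  left_inv ω := by
    ext x
    rw [mem_edgesIn, SimpleGraph.edgeSet_fromEdgeSet]
    simp only [Set.mem_sdiff, Set.mem_image, SetLike.mem_coe]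
    constructor
    · rintro ⟨⟨y, hy, hyx⟩, -⟩
      rwa [← Subtype.ext hyx]
    · exact fun h ↦ ⟨⟨x, h, rfl⟩, x.2⟩
  right_inv G := by
    rw [← SimpleGraph.edgeSet_inj, SimpleGraph.edgeSet_fromEdgeSet]
    ext x
    simp only [Set.mem_sdiff, Set.mem_image, SetLike.mem_coe, mem_edgesIn]
    constructor
    · rintro ⟨⟨y, hy, rfl⟩, -⟩
      exact hy
    · exact fun h ↦ ⟨⟨⟨x, G.not_isDiag_of_mem_edgeSet h⟩, h, rfl⟩,
        G.not_isDiag_of_mem_edgeSet h⟩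

theorem mem_edgeSet_graphEquiv {n : ℕ} {ω : Finset (Pair n)} {x : Pair n} :
    x.1 ∈ (graphEquiv n ω).edgeSet ↔ x ∈ ω := by
  rw [← mem_edgesIn (S := (graphEquiv n ω).edgeSet)]
  change x ∈ (graphEquiv n).symm (graphEquiv n ω) ↔ _
  rw [Equiv.symm_apply_apply]

theorem card_edgesIn {n : ℕ} {S : Set (Sym2 (Fin n))} (hS : ∀ x ∈ S, ¬ x.IsDiag) :
    #(edgesIn S) = S.ncard := by
  rw [← Set.ncard_coe_finset, ← Set.ncard_image_of_injective _ Subtype.val_injective]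
  congr 1
  ext x
  simp only [Set.mem_image, SetLike.mem_coe, mem_edgesIn]
  constructor
  · rintro ⟨y, hy, rfl⟩
    exact hy
  · exact fun h ↦ ⟨⟨x, hS x h⟩, h, rfl⟩

theorem real_singleton_graphEquiv {n : ℕ} (p : unitInterval) (ω : Finset (Pair n)) :
    (SimpleGraph.binomialRandom (Fin n) p).real {graphEquiv n ω} = weight (p : ℝ) ω := by
  have h1 : (graphEquiv n ω).edgeSet.ncard = #ω := by
    rw [← card_edgesIn fun x h ↦ (graphEquiv n ω).not_isDiag_of_mem_edgeSet h]
    change #((graphEquiv n).symm (graphEquiv n ω)) = _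
    rw [Equiv.symm_apply_apply]
  have h2 : (Nat.card (Fin n)).choose 2 = Fintype.card (Pair n) := by
    rw [Sym2.card_subtype_not_diag, Nat.card_eq_fintype_card]
  rw [weight_eq, measureReal_def, SimpleGraph.binomialRandom_singleton, h1, h2, card_compl]
  simp

instance instMeasurableSingletonClassGraph {n : ℕ} :
    MeasurableSingletonClass (SimpleGraph (Fin n)) :=
  ⟨fun G ↦ by
    have h := SimpleGraph.measurable_edgeSet (V := Fin n) (measurableSet_singleton G.edgeSet)
    have h' : SimpleGraph.edgeSet ⁻¹' {G.edgeSet} = {G} := by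
      ext H
      simp
    rwa [h'] at h⟩

theorem integral_binomialRandom {n : ℕ} (p : unitInterval) (F : SimpleGraph (Fin n) → ℝ) :
    ∫ G, F G ∂(SimpleGraph.binomialRandom (Fin n) p) =
      ev (p : ℝ) fun ω ↦ F (graphEquiv n ω) := by
  classical
  rw [integral_fintype .of_finite, ev, ← (graphEquiv n).sum_comp]
  exact sum_congr rfl fun ω _ ↦ by rw [real_singleton_graphEquiv, smul_eq_mul]

theorem real_binomialRandom {n : ℕ} (p : unitInterval) (P : SimpleGraph (Fin n) → Prop)
    [DecidablePred P] :
    (SimpleGraph.binomialRandom (Fin n) p).real {G | P G} =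
      ev (p : ℝ) fun ω ↦ if P (graphEquiv n ω) then (1 : ℝ) else 0 := by
  rw [← integral_binomialRandom p fun G ↦ if P G then (1 : ℝ) else 0,
    ← integral_indicator_one (Set.toFinite _).measurableSet]
  congr 1
  ext G
  simp [Set.indicator_apply]

variable {V : Type*} {G₀ : SimpleGraph V} {n : ℕ}

/-- The possible copies of `G₀`, as a family of sets of possible edges. -/
noncomputable def copyEdges (G₀ : SimpleGraph V) (n : ℕ) (Γ : copies G₀ n) : Finset (Pair n) :=
  edgesIn Γ.1.edgeSet

noncomputable instance instFintypeCopies : Fintype (copies G₀ n) :=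
  Fintype.ofFinite _

theorem ncard_eq_card_filter_copies (P : (⊤ : SimpleGraph (Fin n)).Subgraph → Prop)
    [DecidablePred P] :
    {Γ | Γ ∈ copies G₀ n ∧ P Γ}.ncard = #(univ.filter fun Γ : copies G₀ n ↦ P Γ.1) := by
  rw [← Set.ncard_coe_finset, ← Set.ncard_image_of_injective _ Subtype.val_injective]
  congr 1
  ext Γ
  simp only [Set.mem_image, SetLike.mem_coe, mem_filter, mem_univ, true_and, Set.mem_ofPred_eq]
  constructor
  · rintro ⟨h1, h2⟩
    exact ⟨⟨Γ, h1⟩, h2, rfl⟩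
  · rintro ⟨⟨Γ', h1⟩, h2, rfl⟩
    exact ⟨h1, h2⟩

theorem count_graphEquiv (ω : Finset (Pair n)) :
    count G₀ (graphEquiv n ω) = total (copyEdges G₀ n) ω := by
  classical
  set G := graphEquiv n ω with hG
  have h1 : total (copyEdges G₀ n) ω =
      #(univ.filter fun Γ : copies G₀ n ↦ Γ.1.edgeSet ⊆ G.edgeSet) := by
    rw [← Finset.sum_boole]
    unfold total ind
    refine sum_congr rfl fun Γ _ ↦ ?_
    congr 1
    rw [eq_iff_iff]
    constructor
    · intro h x hx
      have hd : ¬ x.IsDiag := SimpleGraph.not_isDiag_of_mem_edgeSet _ (Γ.1.edgeSet_subset hx)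
      exact mem_edgeSet_graphEquiv.2 (h (mem_edgesIn.2 hx : (⟨x, hd⟩ : Pair n) ∈ _))
    · intro h x hx
      exact mem_edgeSet_graphEquiv.1 (h (mem_edgesIn.1 hx))
  have h2 : G.copyCount G₀ = {Γ : G.Subgraph | Nonempty (G₀ ≃g Γ.coe)}.ncard := by
    rw [SimpleGraph.copyCount, ← Set.ncard_coe_finset]
    congr 1
    ext Γ
    simp
  rw [count, h1, h2, ← ncard_eq_card_filter_copies fun Γ ↦ Γ.edgeSet ⊆ G.edgeSet]
  congr 1
  -- A subgraph of `G` is a subgraph of the complete graph whose edges are edges of `G`.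
  refine Set.ncard_congr (fun Γ _ ↦ ⟨Γ.verts, Γ.Adj, fun h ↦ h.adj_sub.ne, Γ.edge_vert, Γ.symm⟩)
    ?_ ?_ ?_
  · intro Γ hΓ
    refine ⟨hΓ, fun x ↦ ?_⟩
    induction x using Sym2.ind with
    | _ a b => exact fun h ↦ Γ.adj_sub h
  · intro Γ Γ' _ _ h
    simp only [SimpleGraph.Subgraph.mk.injEq] at h
    exact SimpleGraph.Subgraph.ext h.1 h.2
  · rintro Γ ⟨h1, h2⟩
    exact ⟨⟨Γ.verts, Γ.Adj, fun {a b} h ↦ h2 (show s(a, b) ∈ Γ.edgeSet from h), Γ.edge_vert,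
      Γ.symm⟩, h1, rfl⟩

theorem card_meets_copyEdges (Γ : copies G₀ n) :
    #(meets (copyEdges G₀ n) (copyEdges G₀ n Γ)) = D G₀ n := by
  classical
  rw [D_eq Γ.2]
  have h : neighborhood G₀ n Γ.1 =
      {Γ' | Γ' ∈ copies G₀ n ∧ (Γ'.edgeSet ∩ Γ.1.edgeSet).Nonempty} := rfl
  rw [h, ncard_eq_card_filter_copies fun Γ' ↦ (Γ'.edgeSet ∩ Γ.1.edgeSet).Nonempty]
  unfold meets
  congr 1
  refine filter_congr fun Γ' _ ↦ ?_
  rw [Finset.not_disjoint_iff]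
  constructor
  · rintro ⟨x, h1, h2⟩
    exact ⟨x.1, mem_edgesIn.1 h1, mem_edgesIn.1 h2⟩
  · rintro ⟨x, h1, h2⟩
    have hd : ¬ x.IsDiag := SimpleGraph.not_isDiag_of_mem_edgeSet _ (Γ.1.edgeSet_subset h2)
    exact ⟨⟨x, hd⟩, mem_edgesIn.2 h1, mem_edgesIn.2 h2⟩

theorem sigma_sq_eq (p : unitInterval) :
    ev (p : ℝ) (fun ω ↦ (total (copyEdges G₀ n) ω - ev (p : ℝ) (total (copyEdges G₀ n))) ^ 2) =
      sigma G₀ n p ^ 2 := by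
  rw [sigma, Real.sq_sqrt (variance_nonneg _ _),
    variance_eq_integral Measurable.of_discrete.aemeasurable, integral_binomialRandom,
    integral_binomialRandom]
  simp_rw [count_graphEquiv]

theorem W_graphEquiv (p : unitInterval) (ω : Finset (Pair n)) :
    W G₀ n p (graphEquiv n ω) =
      std (copyEdges G₀ n) (ev (p : ℝ) (total (copyEdges G₀ n))) (sigma G₀ n p) ω := by
  rw [W, std, count_graphEquiv, integral_binomialRandom]
  simp_rw [count_graphEquiv]

end SubgraphCount

/-! ### Labelled copies -/

namespace SubgraphCount

open Finset RandomSubset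

variable {V : Type*} {G₀ : SimpleGraph V} {n : ℕ}

/-- The image of `G₀` under an embedding of its vertices. -/
def image (G₀ : SimpleGraph V) (ι : V ↪ Fin n) : (⊤ : SimpleGraph (Fin n)).Subgraph where
  verts := Set.range ι
  Adj := Relation.Map G₀.Adj ι ι
  adj_sub := by
    rintro _ _ ⟨x, y, h, rfl, rfl⟩
    exact fun h' ↦ h.ne (ι.injective h')
  edge_vert := by
    rintro _ _ ⟨x, y, -, rfl, rfl⟩
    exact ⟨x, rfl⟩
  symm := ⟨by
    rintro _ _ ⟨x, y, h, rfl, rfl⟩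
    exact ⟨y, x, h.symm, rfl, rfl⟩⟩

/-- An embedding of the vertices is an isomorphism onto the image. -/
noncomputable def imageIso (G₀ : SimpleGraph V) (ι : V ↪ Fin n) : G₀ ≃g (image G₀ ι).coe where
  toEquiv := Equiv.ofInjective ι ι.injective
  map_rel_iff' := by
    intro a b
    constructor
    · rintro ⟨x, y, h, hx, hy⟩
      rwa [← ι.injective hx, ← ι.injective hy]
    · exact fun h ↦ ⟨a, b, h, rfl, rfl⟩

/-- The copy of `G₀` with a given labelling of the vertices. -/
def labelled (G₀ : SimpleGraph V) (ι : V ↪ Fin n) : copies G₀ n :=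
  ⟨image G₀ ι, ⟨imageIso G₀ ι⟩⟩

theorem edgeSet_image (ι : V ↪ Fin n) :
    (image G₀ ι).edgeSet = Sym2.map ι '' G₀.edgeSet := by
  ext x
  induction x using Sym2.ind with
  | _ a b =>
    rw [SimpleGraph.Subgraph.mem_edgeSet]
    constructor
    · rintro ⟨x, y, h, rfl, rfl⟩
      exact ⟨s(x, y), h, rfl⟩
    · rintro ⟨y, hy, h⟩
      induction y using Sym2.ind with
      | _ c d =>
        rw [Sym2.map_mk] at h
        rw [← SimpleGraph.Subgraph.mem_edgeSet, ← h]
        exact ⟨c, d, hy, rfl, rfl⟩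

/-- Each copy of `G₀` has as many labellings as `G₀` has automorphisms. -/
theorem card_labellings (Γ : copies G₀ n) :
    Nat.card {ι : V ↪ Fin n // labelled G₀ ι = Γ} = Nat.card (G₀ ≃g G₀) := by
  obtain ⟨Γ, ⟨ψ⟩⟩ := Γ
  let lab : (G₀ ≃g G₀) → V ↪ Fin n := fun φ ↦
    (φ.toEquiv.toEmbedding.trans ψ.toEquiv.toEmbedding).trans (Function.Embedding.subtype _)
  have hlab : ∀ φ v, lab φ v = ψ (φ v) := fun _ _ ↦ rfl
  have himage : ∀ φ, labelled G₀ (lab φ) = ⟨Γ, ⟨ψ⟩⟩ := by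
    intro φ
    refine Subtype.ext (SimpleGraph.Subgraph.ext ?_ ?_)
    · ext x
      constructor
      · rintro ⟨v, rfl⟩
        exact (ψ (φ v)).2
      · intro hx
        refine ⟨φ.symm (ψ.symm ⟨x, hx⟩), ?_⟩
        rw [hlab]
        simp
    · ext x y
      constructor
      · rintro ⟨a, b, h, rfl, rfl⟩
        rw [hlab, hlab]
        exact ψ.map_adj_iff.2 (φ.map_adj_iff.2 h)
      · intro h
        refine ⟨φ.symm (ψ.symm ⟨x, h.fst_mem⟩), φ.symm (ψ.symm ⟨y, h.snd_mem⟩), ?_, ?_, ?_⟩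
        · exact φ.symm.map_adj_iff.2 (ψ.symm.map_adj_iff.2 h)
        · rw [hlab]; simp
        · rw [hlab]; simp
  refine (Nat.card_congr (Equiv.ofBijective (fun φ ↦ ⟨lab φ, himage φ⟩) ⟨?_, ?_⟩)).symm
  · intro φ φ' h
    have h' : lab φ = lab φ' := congrArg Subtype.val h
    ext v
    have h1 := DFunLike.congr_fun h' v
    rw [hlab, hlab] at h1
    exact ψ.injective (Subtype.ext h1)
  · rintro ⟨ι, hι⟩
    have h : image G₀ ι = Γ := congrArg Subtype.val hι
    subst h
    refine ⟨(imageIso G₀ ι).trans ψ.symm, ?_⟩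
    refine Subtype.ext (DFunLike.ext _ _ fun v ↦ ?_)
    rw [hlab]
    simp only [RelIso.trans_apply, RelIso.apply_symm_apply]
    rfl

theorem sum_labelled [Fintype V] (F : copies G₀ n → ℝ) :
    ∑ ι : V ↪ Fin n, F (labelled G₀ ι) = Nat.card (G₀ ≃g G₀) * ∑ Γ, F Γ := by
  classical
  rw [← sum_fiberwise' univ (labelled G₀) F, mul_sum]
  refine sum_congr rfl fun Γ _ ↦ ?_
  rw [sum_const, nsmul_eq_mul, ← card_labellings Γ, Nat.card_eq_fintype_card,
    Fintype.card_subtype]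

theorem card_iso_pos [Finite V] : 0 < Nat.card (G₀ ≃g G₀) := by
  have : Finite (G₀ ≃g G₀) := DFunLike.finite _
  exact Nat.card_pos

theorem exists_labelled_eq [Finite V] (Γ : copies G₀ n) :
    ∃ ι : V ↪ Fin n, labelled G₀ ι = Γ := by
  have h := card_labellings Γ
  have h' := card_iso_pos (G₀ := G₀)
  rw [← h] at h'
  obtain ⟨⟨ι, hι⟩⟩ := (Nat.card_pos_iff.1 h').1
  exact ⟨ι, hι⟩

theorem mem_copyEdges_labelled {ι : V ↪ Fin n} {x : Pair n} :
    x ∈ copyEdges G₀ n (labelled G₀ ι) ↔ ∃ y ∈ G₀.edgeSet, Sym2.map ι y = x.1 := by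
  have h : (labelled G₀ ι).1.edgeSet = Sym2.map ι '' G₀.edgeSet := edgeSet_image ι
  rw [copyEdges, mem_edgesIn, h, Set.mem_image]

theorem card_copyEdges [Finite V] (Γ : copies G₀ n) :
    #(copyEdges G₀ n Γ) = G₀.edgeSet.ncard := by
  obtain ⟨ι, rfl⟩ := exists_labelled_eq Γ
  rw [copyEdges, card_edgesIn fun x hx ↦
    SimpleGraph.not_isDiag_of_mem_edgeSet _ (SimpleGraph.Subgraph.edgeSet_subset _ hx)]
  have h : (labelled G₀ ι).1.edgeSet = Sym2.map ι '' G₀.edgeSet := edgeSet_image ι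
  rw [h, Set.ncard_image_of_injective _ (Sym2.map.injective ι.injective)]

theorem card_copies [Fintype V] :
    (Nat.card (G₀ ≃g G₀) : ℝ) * Fintype.card (copies G₀ n) = n.descFactorial (Fintype.card V) := by
  have h := sum_labelled (G₀ := G₀) (n := n) fun _ ↦ 1
  simp only [sum_const, card_univ, nsmul_eq_mul, mul_one] at h
  rw [← h, Fintype.card_embedding_eq, Fintype.card_fin]

end SubgraphCount

/-! ### The minimum `Ψ_min` -/

namespace SubgraphCount

open Finset RandomSubset

variable {V : Type*} {G₀ : SimpleGraph V} {n : ℕ}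

theorem psiMin_le [Finite V] (p : unitInterval) (H : G₀.Subgraph) (hH : H.edgeSet.Nonempty) :
    psiMin G₀ n p ≤ (n : ℝ) ^ H.verts.ncard * (p : ℝ) ^ H.edgeSet.ncard :=
  ciInf_le (f := fun H : {H : G₀.Subgraph // H.edgeSet.Nonempty} ↦
    (n : ℝ) ^ H.1.verts.ncard * (p : ℝ) ^ H.1.edgeSet.ncard) (Set.finite_range _).bddBelow ⟨H, hH⟩

theorem exists_psiMin_eq [Finite V] (hG₀ : G₀.edgeSet.Nonempty) (p : unitInterval) :
    ∃ H : G₀.Subgraph, H.edgeSet.Nonempty ∧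
      psiMin G₀ n p = (n : ℝ) ^ H.verts.ncard * (p : ℝ) ^ H.edgeSet.ncard := by
  have : Nonempty {H : G₀.Subgraph // H.edgeSet.Nonempty} := ⟨⟨⊤, by simpa using hG₀⟩⟩
  obtain ⟨H, h⟩ := exists_eq_ciInf_of_finite
    (f := fun H : {H : G₀.Subgraph // H.edgeSet.Nonempty} ↦
      (n : ℝ) ^ H.1.verts.ncard * (p : ℝ) ^ H.1.edgeSet.ncard)
  exact ⟨H.1, H.2, h.symm⟩

theorem psiMin_pos [Finite V] (hG₀ : G₀.edgeSet.Nonempty) (hn : 0 < n) {p : unitInterval}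
    (hp : 0 < p) : 0 < psiMin G₀ n p := by
  obtain ⟨H, -, h⟩ := exists_psiMin_eq (n := n) hG₀ p
  have : (0 : ℝ) < p := hp
  rw [h]
  positivity

/-! ### Attaching a further copy to a union of copies -/

open Classical in
/-- The vertices of `G₀` that are not isolated. -/
noncomputable def nonisolated (G₀ : SimpleGraph V) [Fintype V] : Finset V :=
  univ.filter fun v ↦ ∃ u, G₀.Adj v u

theorem mem_nonisolated [Fintype V] {y : Sym2 V} (hy : y ∈ G₀.edgeSet) {v : V} (hv : v ∈ y) :
    v ∈ nonisolated G₀ := by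
  obtain ⟨u, rfl⟩ := hv
  simp only [nonisolated, mem_filter, mem_univ, true_and]
  exact ⟨u, hy⟩

/-- `S` contains the endpoints of all edges in `U`. -/
def Covers (S : Finset (Fin n)) (U : Finset (Pair n)) : Prop :=
  ∀ x ∈ U, ∀ v ∈ x.1, v ∈ S

theorem Covers.union {S S' : Finset (Fin n)} {U U' : Finset (Pair n)} (h : Covers S U)
    (h' : Covers S' U') : Covers (S ∪ S') (U ∪ U') := by
  intro x hx v hv
  rcases mem_union.1 hx with hx | hx
  · exact mem_union_left _ (h x hx v hv)
  · exact mem_union_right _ (h' x hx v hv)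

theorem exists_covers [Fintype V] (Γ : copies G₀ n) :
    ∃ S : Finset (Fin n), #S = #(nonisolated G₀) ∧ Covers S (copyEdges G₀ n Γ) := by
  obtain ⟨ι, rfl⟩ := exists_labelled_eq Γ
  refine ⟨(nonisolated G₀).map ι, card_map _, fun x hx v hv ↦ ?_⟩
  obtain ⟨y, hy, hyx⟩ := mem_copyEdges_labelled.1 hx
  rw [← hyx, Sym2.mem_map] at hv
  obtain ⟨u, hu, rfl⟩ := hv
  exact mem_map_of_mem ι (mem_nonisolated hy hu)

theorem card_embeddings_le [Fintype V] [DecidableEq V] (K : Finset V) (S : Finset (Fin n)) :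
    #(univ.filter fun ι : V ↪ Fin n ↦ ∀ v ∈ K, ι v ∈ S) ≤ #S ^ #K * n ^ (Fintype.card V - #K) := by
  have h : #(Fintype.piFinset fun v ↦ if v ∈ K then S else (univ : Finset (Fin n))) =
      #S ^ #K * n ^ (Fintype.card V - #K) := by
    rw [Fintype.card_piFinset]
    have : ∀ v, #(if v ∈ K then S else (univ : Finset (Fin n))) = if v ∈ K then #S else n := by
      intro v; split_ifs <;> simp
    simp_rw [this]
    rw [prod_ite, prod_const, prod_const, ← card_compl]
    congr 3
    · ext; simp
    · ext; simp
  rw [← h]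
  refine card_le_card_of_injOn (fun ι ↦ ι) (fun ι hι ↦ ?_) DFunLike.coe_injective.injOn
  simp only [coe_filter, mem_univ, true_and, Set.mem_ofPred_eq] at hι
  simp only [SetLike.mem_coe, Fintype.mem_piFinset]
  intro v
  split_ifs with hv
  · exact hι v hv
  · exact mem_univ _

/-- The vertices of `G₀` that a labelled copy shares with `S` carry the subgraph of `G₀` whose
presence in the random graph is granted by `U`. -/
theorem pow_card_sdiff_mul_psiMin_le [Fintype V] {p : unitInterval}
    {S : Finset (Fin n)} {U : Finset (Pair n)} (hS : Covers S U) (ι : V ↪ Fin n)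
    (hι : ¬ Disjoint (copyEdges G₀ n (labelled G₀ ι)) U) :
    (p : ℝ) ^ #(copyEdges G₀ n (labelled G₀ ι) \ U) * psiMin G₀ n p ≤
      (n : ℝ) ^ #((nonisolated G₀).filter fun v ↦ ι v ∈ S) * (p : ℝ) ^ G₀.edgeSet.ncard := by
  classical
  set A := copyEdges G₀ n (labelled G₀ ι) with hA
  set K := (nonisolated G₀).filter fun v ↦ ι v ∈ S with hK
  have hp0 : (0 : ℝ) ≤ p := p.2.1
  have hp1 : (p : ℝ) ≤ 1 := p.2.2
  let H : G₀.Subgraph := (⊤ : G₀.Subgraph).induce K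
  have hmem : ∀ x ∈ A ∩ U, ∃ y ∈ H.edgeSet, Sym2.map ι y = x.1 := by
    intro x hx
    obtain ⟨hxA, hxU⟩ := mem_inter.1 hx
    obtain ⟨y, hy, hyx⟩ := mem_copyEdges_labelled.1 hxA
    have hyK : ∀ v ∈ y, v ∈ K := fun v hv ↦ mem_filter.2
      ⟨mem_nonisolated hy hv, hS x hxU _ (by rw [← hyx]; exact Sym2.mem_map.2 ⟨v, hv, rfl⟩)⟩
    refine ⟨y, ?_, hyx⟩
    induction y using Sym2.ind with
    | _ a b =>
      rw [SimpleGraph.Subgraph.mem_edgeSet]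
      exact ⟨hyK a (Sym2.mem_mk_left _ _), hyK b (Sym2.mem_mk_right _ _), hy⟩
  have hne : H.edgeSet.Nonempty := by
    obtain ⟨x, h1, h2⟩ := not_disjoint_iff.1 hι
    obtain ⟨y, hy, -⟩ := hmem x (mem_inter.2 ⟨h1, h2⟩)
    exact ⟨y, hy⟩
  have hcard : #(A ∩ U) ≤ H.edgeSet.ncard := by
    rw [← Set.ncard_image_of_injective _ (Sym2.map.injective ι.injective),
      ← Set.ncard_coe_finset, ← Set.ncard_image_of_injective _ Subtype.val_injective]
    refine Set.ncard_le_ncard ?_ (Set.toFinite _)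
    rintro _ ⟨x, hx, rfl⟩
    obtain ⟨y, hy, hyx⟩ := hmem x hx
    exact ⟨y, hy, hyx⟩
  have he : G₀.edgeSet.ncard ≤ #(A \ U) + H.edgeSet.ncard := by
    rw [← card_copyEdges (labelled G₀ ι), ← hA, ← card_sdiff_add_card_inter A U]
    omega
  have hv : H.verts.ncard = #K := by
    simp [H, Set.ncard_coe_finset]
  have hψ := psiMin_le (n := n) p H hne
  rw [hv] at hψ
  calc (p : ℝ) ^ #(A \ U) * psiMin G₀ n p
      ≤ (p : ℝ) ^ #(A \ U) * ((n : ℝ) ^ #K * (p : ℝ) ^ H.edgeSet.ncard) :=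
        mul_le_mul_of_nonneg_left hψ (pow_nonneg hp0 _)
    _ = (n : ℝ) ^ #K * (p : ℝ) ^ (#(A \ U) + H.edgeSet.ncard) := by rw [pow_add]; ring
    _ ≤ _ := mul_le_mul_of_nonneg_left (pow_le_pow_of_le_one hp0 hp1 he) (by positivity)

/-- The bound on `attach` for the copies of `G₀`: a sum over the possible sets of vertices that the
attached copy shares with `S`. -/
theorem attach_copyEdges_le [Fintype V] {p : unitInterval} (hψ : 0 < psiMin G₀ n p)
    {S : Finset (Fin n)} {U : Finset (Pair n)} (hS : Covers S U) :
    attach (copyEdges G₀ n) (p : ℝ) U ≤ (1 + #S : ℝ) ^ #(nonisolated G₀) *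
      ((n : ℝ) ^ Fintype.card V * (p : ℝ) ^ G₀.edgeSet.ncard /
        (Nat.card (G₀ ≃g G₀) * psiMin G₀ n p)) := by
  classical
  have hp0 : (0 : ℝ) ≤ p := p.2.1
  have ha : (0 : ℝ) < Nat.card (G₀ ≃g G₀) := Nat.cast_pos.2 card_iso_pos
  set ψ := psiMin G₀ n p with hψdef
  set e := G₀.edgeSet.ncard with he
  have h1 : Nat.card (G₀ ≃g G₀) * attach (copyEdges G₀ n) (p : ℝ) U = ∑ ι : V ↪ Fin n,
      if ¬ Disjoint (copyEdges G₀ n (labelled G₀ ι)) U then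
        (p : ℝ) ^ #(copyEdges G₀ n (labelled G₀ ι) \ U) else 0 := by
    rw [RandomSubset.attach, meets, sum_filter, ← sum_labelled]
  have h2 : ∀ ι : V ↪ Fin n, (if ¬ Disjoint (copyEdges G₀ n (labelled G₀ ι)) U then
        (p : ℝ) ^ #(copyEdges G₀ n (labelled G₀ ι) \ U) else 0) ≤
      ∑ K ∈ (nonisolated G₀).powerset,
        if ∀ v ∈ K, ι v ∈ S then (n : ℝ) ^ #K * (p : ℝ) ^ e / ψ else 0 := by
    intro ι
    have h0 : ∀ K ∈ (nonisolated G₀).powerset,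
        0 ≤ if ∀ v ∈ K, ι v ∈ S then (n : ℝ) ^ #K * (p : ℝ) ^ e / ψ else 0 := by
      intro K _
      split_ifs <;> positivity
    split_ifs with hι
    · refine sum_nonneg h0
    · refine le_trans ?_ (single_le_sum h0
        (mem_powerset.2 (filter_subset (fun v ↦ ι v ∈ S) (nonisolated G₀))))
      rw [if_pos fun v hv ↦ (mem_filter.1 hv).2, le_div_iff₀ hψ]
      exact pow_card_sdiff_mul_psiMin_le hS ι hι
  have h3 : Nat.card (G₀ ≃g G₀) * attach (copyEdges G₀ n) (p : ℝ) U ≤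
      (1 + #S : ℝ) ^ #(nonisolated G₀) * ((n : ℝ) ^ Fintype.card V * (p : ℝ) ^ e / ψ) := by
    rw [h1]
    refine (sum_le_sum fun ι _ ↦ h2 ι).trans ?_
    rw [sum_comm]
    have h4 : ∀ K ∈ (nonisolated G₀).powerset,
        (∑ ι : V ↪ Fin n, if ∀ v ∈ K, ι v ∈ S then (n : ℝ) ^ #K * (p : ℝ) ^ e / ψ else 0) ≤
          (#S : ℝ) ^ #K * 1 ^ (#(nonisolated G₀) - #K) *
            ((n : ℝ) ^ Fintype.card V * (p : ℝ) ^ e / ψ) := by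
      intro K _
      rw [← sum_filter, sum_const, nsmul_eq_mul, one_pow, mul_one]
      have h5 : (#(univ.filter fun ι : V ↪ Fin n ↦ ∀ v ∈ K, ι v ∈ S) : ℝ) ≤
          (#S : ℝ) ^ #K * (n : ℝ) ^ (Fintype.card V - #K) := by
        exact_mod_cast card_embeddings_le K S
      refine (mul_le_mul_of_nonneg_right h5 (by positivity)).trans (le_of_eq ?_)
      have h6 : (n : ℝ) ^ (Fintype.card V - #K) * (n : ℝ) ^ #K = (n : ℝ) ^ Fintype.card V := by
        rw [← pow_add, Nat.sub_add_cancel (card_le_univ K)]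
      rw [← h6]
      ring
    refine (sum_le_sum h4).trans (le_of_eq ?_)
    rw [← sum_mul, sum_pow_mul_eq_add_pow, add_comm]
  rw [← le_div_iff₀' ha] at h3
  refine h3.trans (le_of_eq ?_)
  field_simp

end SubgraphCount

/-! ### A lower bound for the variance -/

namespace RandomSubset

open Finset

theorem ev_total_sub_ev_sq {α : Type*} [DecidableEq α] [Fintype α] {I : Type*} [Fintype I]
    {A : I → Finset α} {p : ℝ} {e : ℕ} (hA : ∀ i, #(A i) = e) :
    ev p (fun ω ↦ (total A ω - ev p (total A)) ^ 2) =
      ∑ i, ∑ j, (p ^ #(A i ∪ A j) - p ^ (2 * e)) := by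
  have h1 : ∀ ω, (total A ω - ev p (total A)) ^ 2 =
      (∑ i, ∑ j, ind (A i ∪ A j) ω) - 2 * ev p (total A) * total A ω + ev p (total A) ^ 2 := by
    intro ω
    have : ∑ i, ∑ j, ind (A i ∪ A j) ω = total A ω ^ 2 := by
      rw [pow_two, total, sum_mul_sum]
      exact sum_congr rfl fun i _ ↦ sum_congr rfl fun j _ ↦ (ind_mul_ind _ _ _).symm
    rw [this]
    ring
  have h2 : ∀ i, ev p (fun ω ↦ ∑ j, ind (A i ∪ A j) ω) = ∑ j, p ^ #(A i ∪ A j) := by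
    intro i
    rw [ev_sum]
    exact sum_congr rfl fun j _ ↦ ev_ind p _
  simp_rw [h1]
  rw [ev_add, ev_sub, ev_const, ev_const_mul, ev_sum, sum_congr rfl fun i _ ↦ h2 i, ev_total hA]
  simp_rw [sum_sub_distrib, sum_const, card_univ, nsmul_eq_mul]
  ring

end RandomSubset

namespace SubgraphCount

open Finset RandomSubset

theorem sq_card_le_card_mul_sum {X Y : Type*} [Fintype X] [Fintype Y] [DecidableEq Y] (ρ : X → Y) :
    (Fintype.card X : ℝ) ^ 2 ≤
      Fintype.card Y * ∑ x, ∑ x', if ρ x = ρ x' then (1 : ℝ) else 0 := by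
  have h1 : (Fintype.card X : ℝ) = ∑ y, ∑ x, if ρ x = y then (1 : ℝ) else 0 := by
    rw [sum_comm]
    simp
  have h2 : ∑ x, ∑ x', (if ρ x = ρ x' then (1 : ℝ) else 0) =
      ∑ y, (∑ x, if ρ x = y then (1 : ℝ) else 0) ^ 2 := by
    simp_rw [pow_two, sum_mul_sum]
    rw [sum_comm (s := (univ : Finset Y))]
    refine sum_congr rfl fun x _ ↦ ?_
    rw [sum_comm (s := (univ : Finset Y))]
    refine sum_congr rfl fun x' _ ↦ ?_
    simp [eq_comm]
  rw [h1, h2]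
  exact sq_sum_le_card_mul_sum_sq

variable {V : Type*} {G₀ : SimpleGraph V} {n : ℕ}

theorem three_quarters_mul_pow_le [Fintype V] (hn : 4 * Fintype.card V ^ 2 ≤ n) (hn0 : 0 < n) :
    3 / 4 * (n : ℝ) ^ Fintype.card V ≤ n.descFactorial (Fintype.card V) := by
  set v := Fintype.card V with hv
  have hn' : (4 : ℝ) * v ^ 2 ≤ n := by exact_mod_cast hn
  have hn0' : (0 : ℝ) < n := by exact_mod_cast hn0
  have hvn : v ≤ n := by nlinarith
  have h1 : ((n - v : ℕ) : ℝ) ^ v ≤ n.descFactorial v := by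
    have h2 := Nat.pow_sub_le_descFactorial n v
    have h3 : (n - v) ^ v ≤ (n + 1 - v) ^ v := Nat.pow_le_pow_left (by omega) v
    exact_mod_cast h3.trans h2
  refine le_trans ?_ h1
  have hvn' : (v : ℝ) ≤ n := by exact_mod_cast hvn
  have h2 : 1 + (v : ℝ) * (-(v / n)) ≤ (1 + -(v / n)) ^ v :=
    one_add_mul_le_pow (by
      have : (v : ℝ) / n ≤ 1 := (div_le_one hn0').2 hvn'
      linarith) v
  have h3 : (v : ℝ) * (v / n) ≤ 1 / 4 := by
    rw [← mul_div_assoc, div_le_iff₀ hn0']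
    linarith
  calc 3 / 4 * (n : ℝ) ^ v ≤ (1 + -(v / n)) ^ v * (n : ℝ) ^ v := by
        refine mul_le_mul_of_nonneg_right ?_ (by positivity)
        linarith
    _ = ((n - v : ℕ) : ℝ) ^ v := by
        rw [← mul_pow, Nat.cast_sub hvn]
        congr 1
        field_simp
        ring

/-- Two labelled copies that agree on a subgraph `H` with an edge are positively correlated. -/
theorem mul_pow_le_pow_card_union_sub [Finite V] {p : unitInterval} {H : G₀.Subgraph}
    (hH : H.edgeSet.Nonempty) {ι ι' : V ↪ Fin n} (h : ∀ v ∈ H.verts, ι v = ι' v) :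
    (1 - p : ℝ) * (p : ℝ) ^ (2 * G₀.edgeSet.ncard - H.edgeSet.ncard) ≤
      (p : ℝ) ^ #(copyEdges G₀ n (labelled G₀ ι) ∪ copyEdges G₀ n (labelled G₀ ι')) -
        (p : ℝ) ^ (2 * G₀.edgeSet.ncard) := by
  have hp0 : (0 : ℝ) ≤ p := p.2.1
  have hp1 : (p : ℝ) ≤ 1 := p.2.2
  set B := copyEdges G₀ n (labelled G₀ ι) with hB
  set B' := copyEdges G₀ n (labelled G₀ ι') with hB'
  have hcard : #(B ∪ B') + #(B ∩ B') = 2 * G₀.edgeSet.ncard := by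
    rw [card_union_add_card_inter, hB, hB', card_copyEdges, card_copyEdges]
    ring
  have hsub : H.edgeSet.ncard ≤ #(B ∩ B') := by
    rw [← Set.ncard_image_of_injective _ (Sym2.map.injective ι.injective),
      ← Set.ncard_coe_finset, ← Set.ncard_image_of_injective ((B ∩ B' : Finset (Pair n)) :
        Set (Pair n)) Subtype.val_injective]
    refine Set.ncard_le_ncard ?_ (Set.toFinite _)
    rintro _ ⟨y, hy, rfl⟩
    have hyG : y ∈ G₀.edgeSet := H.edgeSet_subset hy
    have hd : ¬ (Sym2.map ι y).IsDiag := by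
      rw [Sym2.isDiag_map ι.injective]
      exact G₀.not_isDiag_of_mem_edgeSet hyG
    have heq : Sym2.map ι' y = Sym2.map ι y :=
      Sym2.map_congr fun v hv ↦ (h v (H.mem_verts_of_mem_edge hy hv)).symm
    refine ⟨⟨Sym2.map ι y, hd⟩, ?_, rfl⟩
    exact mem_coe.2 (mem_inter.2 ⟨mem_copyEdges_labelled.2 ⟨y, hyG, rfl⟩,
      mem_copyEdges_labelled.2 ⟨y, hyG, heq⟩⟩)
  have hpos : 1 ≤ H.edgeSet.ncard := (Set.ncard_pos (Set.toFinite _)).2 hH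
  have h1 : (p : ℝ) ^ #(B ∩ B') ≤ p := pow_le_of_le_one hp0 hp1 (by omega)
  calc (1 - p : ℝ) * (p : ℝ) ^ (2 * G₀.edgeSet.ncard - H.edgeSet.ncard)
      ≤ (1 - (p : ℝ) ^ #(B ∩ B')) * (p : ℝ) ^ #(B ∪ B') :=
        mul_le_mul (by linarith) (pow_le_pow_of_le_one hp0 hp1 (by omega)) (pow_nonneg hp0 _)
          (by linarith)
    _ = _ := by rw [← hcard, pow_add]; ring

/-- The variance is at least of the order that comes from the pairs of copies sharing a subgraph
that attains the minimum in `psiMin`. -/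
theorem le_sigma_sq [Fintype V] (hG₀ : G₀.edgeSet.Nonempty) (hn : 4 * Fintype.card V ^ 2 ≤ n)
    (hn0 : 0 < n) {p : unitInterval} (hp : 0 < p) :
    9 / 16 * ((1 - p) * ((n : ℝ) ^ Fintype.card V * (p : ℝ) ^ G₀.edgeSet.ncard) ^ 2 /
      ((Nat.card (G₀ ≃g G₀) : ℝ) ^ 2 * psiMin G₀ n p)) ≤ sigma G₀ n p ^ 2 := by
  classical
  obtain ⟨H, hH, hψ⟩ := exists_psiMin_eq (n := n) hG₀ p
  have hp0 : (0 : ℝ) < p := hp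
  have hp1 : (p : ℝ) ≤ 1 := p.2.2
  have hn' : (0 : ℝ) < n := by exact_mod_cast hn0
  set e := G₀.edgeSet.ncard with he
  set k := H.edgeSet.ncard with hk
  set a : ℝ := (Nat.card (G₀ ≃g G₀) : ℝ) with ha
  have ha0 : 0 < a := Nat.cast_pos.2 card_iso_pos
  set N : ℝ := (n.descFactorial (Fintype.card V) : ℝ) with hN
  have hke : k ≤ e := Set.ncard_le_ncard H.edgeSet_subset (Set.toFinite _)
  set f : copies G₀ n → copies G₀ n → ℝ := fun Γ Γ' ↦
    (p : ℝ) ^ #(copyEdges G₀ n Γ ∪ copyEdges G₀ n Γ') - (p : ℝ) ^ (2 * e) with hf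
  have hf0 : ∀ Γ Γ', 0 ≤ f Γ Γ' := by
    intro Γ Γ'
    refine sub_nonneg.2 (pow_le_pow_of_le_one hp0.le hp1 ((card_union_le _ _).trans ?_))
    rw [card_copyEdges, card_copyEdges]
    omega
  have hvar : a ^ 2 * sigma G₀ n p ^ 2 =
      ∑ ι : V ↪ Fin n, ∑ ι' : V ↪ Fin n, f (labelled G₀ ι) (labelled G₀ ι') := by
    rw [← sigma_sq_eq, ev_total_sub_ev_sq card_copyEdges]
    have h1 : ∀ ι : V ↪ Fin n, ∑ ι' : V ↪ Fin n, f (labelled G₀ ι) (labelled G₀ ι') =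
        a * ∑ Γ', f (labelled G₀ ι) Γ' := fun ι ↦ sum_labelled _
    simp_rw [h1]
    rw [sum_labelled fun Γ ↦ a * ∑ Γ', f Γ Γ', ← mul_sum, pow_two, mul_assoc]
  set C : ℝ := (1 - p : ℝ) * (p : ℝ) ^ (2 * e - k) with hC
  have hC0 : 0 ≤ C := mul_nonneg (by linarith) (by positivity)
  let ρ : (V ↪ Fin n) → (H.verts → Fin n) := fun ι v ↦ ι v
  have hlow : C * ∑ ι : V ↪ Fin n, ∑ ι' : V ↪ Fin n, (if ρ ι = ρ ι' then (1 : ℝ) else 0) ≤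
      a ^ 2 * sigma G₀ n p ^ 2 := by
    rw [hvar, mul_sum]
    refine sum_le_sum fun ι _ ↦ ?_
    rw [mul_sum]
    refine sum_le_sum fun ι' _ ↦ ?_
    split_ifs with h
    · rw [mul_one]
      exact mul_pow_le_pow_card_union_sub hH fun v hv ↦ congrFun h ⟨v, hv⟩
    · rw [mul_zero]
      exact hf0 _ _
  have hcs := sq_card_le_card_mul_sum ρ
  rw [Fintype.card_embedding_eq, Fintype.card_fin, Fintype.card_fun, Fintype.card_fin,
    Fintype.card_eq_nat_card (α := H.verts), Nat.card_coe_set_eq, ← hN, Nat.cast_pow] at hcs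
  have hNle := three_quarters_mul_pow_le hn hn0
  rw [← hN] at hNle
  have h2 : C * (9 / 16 * ((n : ℝ) ^ Fintype.card V) ^ 2) ≤
      (n : ℝ) ^ H.verts.ncard * (a ^ 2 * sigma G₀ n p ^ 2) := by
    calc C * (9 / 16 * ((n : ℝ) ^ Fintype.card V) ^ 2)
        = C * (3 / 4 * (n : ℝ) ^ Fintype.card V) ^ 2 := by ring
      _ ≤ C * N ^ 2 := by gcongr
      _ ≤ C * ((n : ℝ) ^ H.verts.ncard * ∑ ι : V ↪ Fin n, ∑ ι' : V ↪ Fin n,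
            (if ρ ι = ρ ι' then (1 : ℝ) else 0)) := mul_le_mul_of_nonneg_left hcs hC0
      _ = (n : ℝ) ^ H.verts.ncard * (C * ∑ ι : V ↪ Fin n, ∑ ι' : V ↪ Fin n,
            (if ρ ι = ρ ι' then (1 : ℝ) else 0)) := by ring
      _ ≤ _ := mul_le_mul_of_nonneg_left hlow (by positivity)
  have hpow : (p : ℝ) ^ (2 * e - k) * (p : ℝ) ^ k = ((p : ℝ) ^ e) ^ 2 := by
    rw [← pow_add, ← pow_mul]
    congr 1
    omega
  rw [hψ, ← mul_div_assoc, div_le_iff₀ (by positivity)]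
  calc 9 / 16 * ((1 - p : ℝ) * ((n : ℝ) ^ Fintype.card V * (p : ℝ) ^ e) ^ 2)
      = C * (9 / 16 * ((n : ℝ) ^ Fintype.card V) ^ 2) * (p : ℝ) ^ k := by
        rw [hC, mul_pow, ← hpow]; ring
    _ ≤ (n : ℝ) ^ H.verts.ncard * (a ^ 2 * sigma G₀ n p ^ 2) * (p : ℝ) ^ k :=
        mul_le_mul_of_nonneg_right h2 (by positivity)
    _ = _ := by ring

end SubgraphCount

/-! ### Comparison of the constants -/

namespace SubgraphCount

open Finset

/-- The constant is a bound for `exp 4`. -/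
theorem add_one_pow_le_mul_pow {w : ℕ} (hw : 1 ≤ w) :
    ((w : ℝ) + 1) ^ (4 * w) ≤ 55 * (w : ℝ) ^ (4 * w) := by
  have hw' : (0 : ℝ) < w := by exact_mod_cast hw
  have h1 : (1 + 1 / (w : ℝ)) ^ w ≤ Real.exp 1 := by
    calc (1 + 1 / (w : ℝ)) ^ w ≤ (Real.exp (1 / w)) ^ w := by
          gcongr
          linarith [Real.add_one_le_exp (1 / (w : ℝ))]
      _ = Real.exp 1 := by
          rw [← Real.exp_nat_mul]
          congr 1
          field_simp
  have h2 : (1 + 1 / (w : ℝ)) ^ (4 * w) ≤ 55 := by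
    calc (1 + 1 / (w : ℝ)) ^ (4 * w) = ((1 + 1 / (w : ℝ)) ^ w) ^ 4 := by rw [← pow_mul, mul_comm]
      _ ≤ 2.7182818286 ^ 4 := by
          gcongr
          exact h1.trans Real.exp_one_lt_d9.le
      _ ≤ 55 := by norm_num
  calc ((w : ℝ) + 1) ^ (4 * w) = (1 + 1 / (w : ℝ)) ^ (4 * w) * (w : ℝ) ^ (4 * w) := by
        rw [← mul_pow]
        congr 1
        field_simp
    _ ≤ _ := by gcongr

/-- A weak form of Stirling's bound. The step from `w` to `w + 1` needs `55 ≤ 9 * (w + 1)`. -/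
theorem pow_le_nine_pow_mul_factorial_pow {w : ℕ} (hw : 1 ≤ w) :
    (w : ℝ) ^ (4 * w) ≤ 9 ^ w * (w.factorial : ℝ) ^ 5 := by
  obtain h | h := le_or_gt w 5
  · interval_cases w <;> norm_num [Nat.factorial]
  · induction w, h using Nat.le_induction with
    | base => norm_num [Nat.factorial]
    | succ w h ih =>
      have h' : (6 : ℝ) ≤ w := by exact_mod_cast h
      have ih' := ih (by omega)
      have h1 := add_one_pow_le_mul_pow (w := w) (by omega)
      rw [Nat.factorial_succ]
      push_cast
      calc ((w : ℝ) + 1) ^ (4 * (w + 1)) = ((w : ℝ) + 1) ^ (4 * w) * ((w : ℝ) + 1) ^ 4 := by ring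
        _ ≤ 55 * (9 ^ w * (w.factorial : ℝ) ^ 5) * ((w : ℝ) + 1) ^ 4 := by
          gcongr
          exact h1.trans (by gcongr)
        _ = (9 ^ w * (w.factorial : ℝ) ^ 5 * ((w : ℝ) + 1) ^ 4) * 55 := by ring
        _ ≤ (9 ^ w * (w.factorial : ℝ) ^ 5 * ((w : ℝ) + 1) ^ 4) * (9 * ((w : ℝ) + 1)) := by
          gcongr
          linarith
        _ = _ := by ring

/-- The left-hand side is the combinatorial factor in the bound on `attach` for a union of `j`
copies that have `w` nonisolated vertices each. -/
theorem one_add_mul_pow_le {w : ℕ} (hw : 2 ≤ w) (j : ℕ) :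
    (1 + (j : ℝ) * w) ^ w ≤ ((j + 1 / 2 : ℝ)) ^ w * (w : ℝ) ^ w := by
  have : (2 : ℝ) ≤ w := by exact_mod_cast hw
  rw [← mul_pow]
  gcongr
  nlinarith

/-- A lower bound for the square of the constant `c G₀` in terms of the number `w` of vertices that
are covered by the `e` edges. -/
theorem le_c_sq {V : Type*} [Fintype V] (G₀ : SimpleGraph V) {w : ℕ} (hw : w ≤ Fintype.card V) :
    2 ^ (9 + 15 * G₀.edgeSet.ncard) * (w.factorial : ℝ) ^ 5 * (G₀.edgeSet.ncard : ℝ) ^ 2 ≤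
      c G₀ ^ 2 := by
  have ha0 : (0 : ℝ) < Nat.card (G₀ ≃g G₀) := Nat.cast_pos.2 card_iso_pos
  set a : ℝ := (Nat.card (G₀ ≃g G₀) : ℝ) with ha
  set e := G₀.edgeSet.ncard with he
  have hav : a ≤ (Fintype.card V).factorial := by
    classical
    rw [ha]
    norm_cast
    rw [← Fintype.card_perm, ← Nat.card_eq_fintype_card]
    exact Nat.card_le_card_of_injective (fun f : G₀ ≃g G₀ ↦ (f.toEquiv : Equiv.Perm V))
      RelIso.toEquiv_injective
  have hwv : (w.factorial : ℝ) ≤ (Fintype.card V).factorial := by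
    exact_mod_cast Nat.factorial_le hw
  have h1 : c G₀ ^ 2 =
      2 ^ (9 + 15 * e) * ((Fintype.card V).factorial : ℝ) ^ 8 * (e : ℝ) ^ 2 / a ^ 3 := by
    rw [c, div_pow, mul_pow, mul_pow, Nat.card_eq_fintype_card, ← pow_mul,
      ← Real.rpow_natCast (2 ^ _), ← Real.rpow_natCast (_ ^ (3 / 2 : ℝ)), ← Real.rpow_mul (by simp),
      ← Real.rpow_mul ha0.le, ← Real.rpow_natCast 2, ← Real.rpow_natCast a]
    congr 4
    · push_cast; ring
    · norm_num
  rw [h1, le_div_iff₀ (by positivity)]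
  calc 2 ^ (9 + 15 * e) * (w.factorial : ℝ) ^ 5 * (e : ℝ) ^ 2 * a ^ 3
      ≤ 2 ^ (9 + 15 * e) * ((Fintype.card V).factorial : ℝ) ^ 5 * (e : ℝ) ^ 2 *
        ((Fintype.card V).factorial : ℝ) ^ 3 := by gcongr
    _ = _ := by ring

theorem c_pos {V : Type*} [Finite V] {G₀ : SimpleGraph V} (hG₀ : G₀.edgeSet.Nonempty) :
    0 < c G₀ := by
  have h1 : (0 : ℝ) < Nat.card (G₀ ≃g G₀) := Nat.cast_pos.2 card_iso_pos
  have h2 : (0 : ℝ) < G₀.edgeSet.ncard := Nat.cast_pos.2 ((Set.ncard_pos (Set.toFinite _)).2 hG₀)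
  rw [c]
  positivity

section Numerics

variable {w e : ℕ} {c : ℝ}

/-- The first one of the conditions on the constant `c` in `errors_bound_le`, for the factors
`(1 + j * w) ^ w`. The base `225 / 16 * 9` of the power that results is at most `2 ^ 7`, and
`7 * w ≤ 14 * e`. -/
theorem attach_product_two_le (hw : 2 ≤ w) (hwe : w ≤ 2 * e) (hc : 0 ≤ c)
    (h : 2 ^ (9 + 15 * e) * (w.factorial : ℝ) ^ 5 * (e : ℝ) ^ 2 ≤ c ^ 2) :
    19 * e * ((1 + w : ℝ) ^ w * (1 + 2 * w) ^ w) ≤ c := by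
  have h1 := one_add_mul_pow_le hw 1
  have h2 := one_add_mul_pow_le hw 2
  push_cast at h1 h2
  rw [one_mul] at h1
  refine abs_le_of_sq_le_sq' ?_ hc |>.2
  refine le_trans ?_ h
  have h3 := pow_le_nine_pow_mul_factorial_pow (w := w) (by omega)
  calc (19 * e * ((1 + w : ℝ) ^ w * (1 + 2 * w) ^ w)) ^ 2
      ≤ (19 * e * (((1 + 1 / 2 : ℝ) ^ w * (w : ℝ) ^ w) * ((2 + 1 / 2 : ℝ) ^ w *
          (w : ℝ) ^ w))) ^ 2 := by
        gcongr
    _ = 361 * (225 / 16) ^ w * (e : ℝ) ^ 2 * (w : ℝ) ^ (4 * w) := by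
        have : (225 / 16 : ℝ) ^ w = ((1 + 1 / 2 : ℝ) ^ w) ^ 2 * ((2 + 1 / 2 : ℝ) ^ w) ^ 2 := by
          rw [← mul_pow, ← mul_pow, ← pow_mul, mul_comm w 2, pow_mul]
          norm_num
        rw [this]
        ring
    _ ≤ 361 * (225 / 16) ^ w * (e : ℝ) ^ 2 * (9 ^ w * (w.factorial : ℝ) ^ 5) := by gcongr
    _ = 361 * (225 / 16 * 9) ^ w * (w.factorial : ℝ) ^ 5 * (e : ℝ) ^ 2 := by
        rw [mul_pow]; ring
    _ ≤ 2 ^ 9 * (2 ^ 7) ^ w * (w.factorial : ℝ) ^ 5 * (e : ℝ) ^ 2 := by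
        gcongr <;> norm_num
    _ ≤ _ := by
        rw [← pow_mul, ← pow_add]
        gcongr ?_ * _ * _
        exact pow_le_pow_right₀ one_le_two (by omega)

/-- The second one of the conditions on `c`, with the base `105 / 8 * 9 ≤ 2 ^ 7`. -/
theorem attach_product_three_le (hw : 2 ≤ w) (hwe : w ≤ 2 * e)
    (h : 2 ^ (9 + 15 * e) * (w.factorial : ℝ) ^ 5 * (e : ℝ) ^ 2 ≤ c ^ 2) :
    405 * e * ((1 + w : ℝ) ^ w * (1 + 2 * w) ^ w * (1 + 3 * w) ^ w) ≤ c ^ 2 := by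
  have he : (1 : ℝ) ≤ e := by exact_mod_cast (by omega : 1 ≤ e)
  have h1 := one_add_mul_pow_le hw 1
  have h2 := one_add_mul_pow_le hw 2
  have h3 := one_add_mul_pow_le hw 3
  push_cast at h1 h2 h3
  rw [one_mul] at h1
  refine le_trans ?_ h
  have h4 := pow_le_nine_pow_mul_factorial_pow (w := w) (by omega)
  have h5 : (w : ℝ) ^ (3 * w) ≤ (w : ℝ) ^ (4 * w) :=
    pow_le_pow_right₀ (by exact_mod_cast (by omega : 1 ≤ w)) (by omega)
  calc 405 * e * ((1 + w : ℝ) ^ w * (1 + 2 * w) ^ w * (1 + 3 * w) ^ w)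
      ≤ 405 * e * (((1 + 1 / 2 : ℝ) ^ w * (w : ℝ) ^ w) * ((2 + 1 / 2 : ℝ) ^ w * (w : ℝ) ^ w) *
          ((3 + 1 / 2 : ℝ) ^ w * (w : ℝ) ^ w)) := by
        gcongr
    _ = 405 * (105 / 8) ^ w * (e : ℝ) * (w : ℝ) ^ (3 * w) := by
        have : (105 / 8 : ℝ) ^ w =
            (1 + 1 / 2 : ℝ) ^ w * (2 + 1 / 2 : ℝ) ^ w * (3 + 1 / 2 : ℝ) ^ w := by
          rw [← mul_pow, ← mul_pow]
          norm_num
        rw [this]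
        ring
    _ ≤ 405 * (105 / 8) ^ w * (e : ℝ) * (9 ^ w * (w.factorial : ℝ) ^ 5) := by
        gcongr
        exact h5.trans h4
    _ = 405 * (105 / 8 * 9) ^ w * (w.factorial : ℝ) ^ 5 * (e : ℝ) := by
        rw [mul_pow]; ring
    _ ≤ 2 ^ 9 * (2 ^ 7) ^ w * (w.factorial : ℝ) ^ 5 * (e : ℝ) ^ 2 := by
        gcongr
        · norm_num
        · norm_num
        · nlinarith
    _ ≤ _ := by
        rw [← pow_mul, ← pow_add]
        gcongr ?_ * _ * _
        exact pow_le_pow_right₀ one_le_two (by omega)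

/-- The third one of the conditions on `c`, with the base `945 / 16 * 9 ≤ 532`, the square of which
is at most `2 ^ 19`. -/
theorem attach_product_four_le (hw : 2 ≤ w) (hwe : w ≤ 2 * e) (hc : 0 ≤ c)
    (h : 2 ^ (9 + 15 * e) * (w.factorial : ℝ) ^ 5 * (e : ℝ) ^ 2 ≤ c ^ 2) :
    1079 * e * ((1 + w : ℝ) ^ w * (1 + 2 * w) ^ w * (1 + 3 * w) ^ w * (1 + 4 * w) ^ w) ≤ c ^ 3 := by
  have he : (1 : ℝ) ≤ e := by exact_mod_cast (by omega : 1 ≤ e)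
  have hf : (1 : ℝ) ≤ w.factorial := by exact_mod_cast w.factorial_pos
  have h1 := one_add_mul_pow_le hw 1
  have h2 := one_add_mul_pow_le hw 2
  have h3 := one_add_mul_pow_le hw 3
  have h4 := one_add_mul_pow_le hw 4
  push_cast at h1 h2 h3 h4
  rw [one_mul] at h1
  have h5 := pow_le_nine_pow_mul_factorial_pow (w := w) (by omega)
  have h6 : 1079 * e * ((1 + w : ℝ) ^ w * (1 + 2 * w) ^ w * (1 + 3 * w) ^ w * (1 + 4 * w) ^ w) ≤
      1079 * (532 : ℝ) ^ w * (w.factorial : ℝ) ^ 5 * e := by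
    calc 1079 * e * ((1 + w : ℝ) ^ w * (1 + 2 * w) ^ w * (1 + 3 * w) ^ w * (1 + 4 * w) ^ w)
        ≤ 1079 * e * (((1 + 1 / 2 : ℝ) ^ w * (w : ℝ) ^ w) * ((2 + 1 / 2 : ℝ) ^ w * (w : ℝ) ^ w) *
            ((3 + 1 / 2 : ℝ) ^ w * (w : ℝ) ^ w) * ((4 + 1 / 2 : ℝ) ^ w * (w : ℝ) ^ w)) := by
          gcongr
      _ = 1079 * (945 / 16) ^ w * (e : ℝ) * (w : ℝ) ^ (4 * w) := by
        have : (945 / 16 : ℝ) ^ w = (1 + 1 / 2 : ℝ) ^ w * (2 + 1 / 2 : ℝ) ^ w *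
            (3 + 1 / 2 : ℝ) ^ w * (4 + 1 / 2 : ℝ) ^ w := by
          rw [← mul_pow, ← mul_pow, ← mul_pow]
          norm_num
        rw [this]
        ring
      _ ≤ 1079 * (945 / 16) ^ w * (e : ℝ) * (9 ^ w * (w.factorial : ℝ) ^ 5) := by gcongr
      _ = 1079 * (945 / 16 * 9) ^ w * (w.factorial : ℝ) ^ 5 * (e : ℝ) := by
        rw [mul_pow]; ring
      _ ≤ _ := by
        gcongr
        norm_num
  refine h6.trans (abs_le_of_sq_le_sq' ?_ (by positivity)).2
  calc (1079 * (532 : ℝ) ^ w * (w.factorial : ℝ) ^ 5 * e) ^ 2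
      = 1079 ^ 2 * (532 ^ 2) ^ w * ((w.factorial : ℝ) ^ 10 * (e : ℝ) ^ 2) := by
        rw [← pow_mul 532, mul_comm 2 w, pow_mul]; ring
    _ ≤ 2 ^ 27 * (2 ^ 19) ^ w * ((w.factorial : ℝ) ^ 15 * (e : ℝ) ^ 6) := by
        gcongr <;> norm_num
    _ ≤ 2 ^ (3 * (9 + 15 * e)) * ((w.factorial : ℝ) ^ 15 * (e : ℝ) ^ 6) := by
        rw [← pow_mul, ← pow_add]
        gcongr ?_ * _
        exact pow_le_pow_right₀ one_le_two (by omega)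
    _ = (2 ^ (9 + 15 * e) * (w.factorial : ℝ) ^ 5 * (e : ℝ) ^ 2) ^ 3 := by ring
    _ ≤ (c ^ 2) ^ 3 := by gcongr
    _ = (c ^ 3) ^ 2 := by ring

end Numerics

end SubgraphCount

/-! ### The error bound for subgraph counts -/

namespace SubgraphCount

open Finset RandomSubset NormalApprox

variable {V : Type*} {G₀ : SimpleGraph V} {n : ℕ}

theorem card_nonisolated_le [Fintype V] : #(nonisolated G₀) ≤ 2 * G₀.edgeSet.ncard := by
  classical
  have h1 : G₀.edgeSet.ncard = #G₀.edgeFinset := by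
    rw [← SimpleGraph.coe_edgeFinset, Set.ncard_coe_finset]
  rw [h1, ← G₀.sum_degrees_eq_twice_card_edges]
  calc #(nonisolated G₀) = ∑ v ∈ nonisolated G₀, 1 := by simp
    _ ≤ ∑ v ∈ nonisolated G₀, G₀.degree v := by
        refine sum_le_sum fun v hv ↦ ?_
        simp only [nonisolated, mem_filter, mem_univ, true_and] at hv
        exact (G₀.degree_pos_iff_exists_adj v).2 hv
    _ ≤ ∑ v, G₀.degree v := sum_le_sum_of_subset (subset_univ _)

theorem two_le_card_nonisolated [Fintype V] (hG₀ : G₀.edgeSet.Nonempty) :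
    2 ≤ #(nonisolated G₀) := by
  obtain ⟨y, hy⟩ := hG₀
  induction y using Sym2.ind with
  | _ u v =>
    exact one_lt_card.2 ⟨u, mem_nonisolated hy (Sym2.mem_mk_left u v), v,
      mem_nonisolated hy (Sym2.mem_mk_right u v), (show G₀.Adj u v from hy).ne⟩

/-- The bound with the error term `c * ((1 + t) * θ * exp (5 * D * t / σ))`, which does not exceed
`c * s t`, under the assumption that `c * ((1 + t) * θ) ≤ 1`, where `θ = 1 / √(q * Ψ_min)`. -/
theorem abs_tail_div_sub_one_le_of_small [Fintype V] (hG₀ : G₀.edgeSet.Nonempty)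
    (hn : 4 * Fintype.card V ^ 2 ≤ n) (hn0 : 0 < n) {p : unitInterval} (hp₀ : 0 < p) (hp₁ : p < 1)
    {t θ : ℝ} (ht : 0 ≤ t) (hθ : θ = 1 / √((1 - p : ℝ) * psiMin G₀ n p))
    (hct : c G₀ * (1 + t) * θ ≤ 1) :
    |(SimpleGraph.binomialRandom (Fin n) p).real {G | t < W G₀ n p G} /
        (1 - cdf (gaussianReal 0 1) t) - 1| ≤
      40 * (c G₀ * ((1 + t) * θ * Real.exp (5 * D G₀ n * t / sigma G₀ n p))) *
        Real.exp (c G₀ * ((1 + t) * θ * Real.exp (5 * D G₀ n * t / sigma G₀ n p)) * t ^ 2) *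
        (1 + t ^ 2) := by
  classical
  have hp0 : (0 : ℝ) < p := hp₀
  have hp1 : (p : ℝ) < 1 := hp₁
  have hn' : (0 : ℝ) < n := by exact_mod_cast hn0
  have hψ : 0 < psiMin G₀ n p := psiMin_pos hG₀ hn0 hp₀
  have hq : 0 < 1 - (p : ℝ) := by linarith
  have ha : (0 : ℝ) < Nat.card (G₀ ≃g G₀) := Nat.cast_pos.2 card_iso_pos
  have hvar := le_sigma_sq hG₀ hn hn0 hp₀
  have hcop := card_copies (G₀ := G₀) (n := n)
  have hatt := @attach_copyEdges_le V G₀ n _ p hψ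
  set e := G₀.edgeSet.ncard with he
  set a : ℝ := (Nat.card (G₀ ≃g G₀) : ℝ) with haa
  set Ψ := psiMin G₀ n p with hΨ
  set q : ℝ := 1 - (p : ℝ) with hqq
  set M : ℝ := (n : ℝ) ^ Fintype.card V * (p : ℝ) ^ e with hM
  have hM0 : 0 < M := by positivity
  set w := #(nonisolated G₀) with hw
  have hw2 : 2 ≤ w := two_le_card_nonisolated hG₀
  have hwe : w ≤ 2 * e := card_nonisolated_le
  have hc : 0 < c G₀ := c_pos hG₀
  have hcsq := le_c_sq G₀ (card_le_univ (nonisolated G₀))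
  have hqs : √q ^ 2 = q := Real.sq_sqrt hq.le
  have hΨs : √Ψ ^ 2 = Ψ := Real.sq_sqrt hψ.le
  have hq0 : 0 < √q := Real.sqrt_pos.2 hq
  have hΨ0 : 0 < √Ψ := Real.sqrt_pos.2 hψ
  rw [Real.sqrt_mul hq.le] at hθ
  have hθ0 : 0 < θ := by rw [hθ]; positivity
  -- The scale `s₀` of the standard deviation, for which `s₀ * θ = M / (a * Ψ)`.
  set s₀ : ℝ := M * √q / (a * √Ψ) with hs₀
  have hs₀pos : 0 < s₀ := by positivity
  have hsθ : s₀ * θ = M / (a * Ψ) := by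
    rw [hs₀, hθ]
    field_simp
    exact hΨs.symm
  have hsθ' : s₀ / θ = q * (M / a) := by
    rw [hs₀, hθ]
    field_simp
    exact hqs
  have hsσ : 3 / 4 * s₀ ≤ sigma G₀ n p := by
    refine (abs_le_of_sq_le_sq' (le_trans (le_of_eq ?_) hvar) (Real.sqrt_nonneg _)).2
    rw [mul_pow, hs₀, div_pow (M * √q), mul_pow M, mul_pow a, hqs, hΨs]
    ring
  have hσ : 0 < sigma G₀ n p := by linarith
  have hmean : ev (p : ℝ) (total (copyEdges G₀ n)) = Fintype.card (copies G₀ n) * (p : ℝ) ^ e :=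
    ev_total card_copyEdges
  have hP : q * (Fintype.card (copies G₀ n) * (p : ℝ) ^ e) ≤ s₀ / θ := by
    rw [hsθ', hM]
    refine mul_le_mul_of_nonneg_left ?_ hq.le
    rw [le_div_iff₀ ha]
    have : a * Fintype.card (copies G₀ n) ≤ (n : ℝ) ^ Fintype.card V := by
      rw [hcop]
      exact_mod_cast Nat.descFactorial_le_pow n _
    nlinarith [pow_pos hp0 e]
  -- A union of `j` copies is covered by `j * w` vertices.
  have hB : ∀ (j : ℕ) (S : Finset (Fin n)) (U : Finset (Pair n)), Covers S U → #S ≤ j * w →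
      attach (copyEdges G₀ n) (p : ℝ) U ≤ (1 + j * w : ℝ) ^ w * (s₀ * θ) := by
    intro j S U hS hj
    rw [hsθ]
    refine (hatt hS).trans ?_
    have : (#S : ℝ) ≤ j * w := by exact_mod_cast hj
    gcongr
  choose S hScard hScov using fun Γ ↦ exists_covers (G₀ := G₀) (n := n) Γ
  have key := abs_tail_div_sub_one_le_of_attach (A := copyEdges G₀ n) (p := (p : ℝ)) (e := e)
    (σ := sigma G₀ n p) hp0.le hp1.le card_copyEdges (by omega) hσ
    (by rw [← hmean]; exact sigma_sq_eq p) (fun Γ ↦ (card_meets_copyEdges Γ).le) ht hs₀pos hθ0 hc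
    (B₁ := (1 + w : ℝ) ^ w) (B₂ := (1 + 2 * w : ℝ) ^ w) (B₃ := (1 + 3 * w : ℝ) ^ w)
    (B₄ := (1 + 4 * w : ℝ) ^ w) (by positivity) (by positivity) (by positivity) (by positivity)
    hP hsσ hct (attach_product_two_le hw2 hwe hc.le hcsq) (attach_product_three_le hw2 hwe hcsq)
    (attach_product_four_le hw2 hwe hc.le hcsq)
    (fun i ↦ by
      simpa using hB 1 (S i) _ (hScov i) (by rw [hScard, one_mul]))
    (fun i j ↦ by
      have hcard : #(S i ∪ S j) ≤ 2 * w :=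
        (card_union_le _ _).trans (by rw [hScard, hScard]; omega)
      exact_mod_cast hB 2 _ _ ((hScov i).union (hScov j)) hcard)
    (fun i j k ↦ by
      have hcard : #(S i ∪ S j ∪ S k) ≤ 3 * w := by
        have h1 := card_union_le (S i ∪ S j) (S k)
        have h2 := card_union_le (S i) (S j)
        simp only [hScard] at h1 h2
        omega
      exact_mod_cast hB 3 _ _ (((hScov i).union (hScov j)).union (hScov k)) hcard)
    (fun i j k l ↦ by
      have hcard : #(S i ∪ S j ∪ S k ∪ S l) ≤ 4 * w := by
        have h1 := card_union_le (S i ∪ S j ∪ S k) (S l)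
        have h2 := card_union_le (S i ∪ S j) (S k)
        have h3 := card_union_le (S i) (S j)
        simp only [hScard] at h1 h2 h3
        omega
      exact_mod_cast
        hB 4 _ _ ((((hScov i).union (hScov j)).union (hScov k)).union (hScov l)) hcard)
  rw [real_binomialRandom]
  simp_rw [W_graphEquiv, hmean]
  exact key

end SubgraphCount

/-- The crude bound by the reciprocal of the Gaussian tail. -/
theorem NormalApprox.abs_div_one_sub_cdf_sub_one_le {x t : ℝ} (hx : 0 ≤ x) (hx1 : x ≤ 1)
    (ht : 0 ≤ t) :
    |x / (1 - cdf (gaussianReal 0 1) t) - 1| ≤ 50 * Real.exp (t ^ 2) * (1 + t ^ 2) := by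
  have hk := one_sub_cdf_pos ht
  have hk1 : 1 - cdf (gaussianReal 0 1) t ≤ 1 := by linarith [cdf_nonneg (gaussianReal 0 1) t]
  set k := 1 - cdf (gaussianReal 0 1) t with hkk
  have h1 : 1 / k ≤ 50 * Real.exp (t ^ 2) * (1 + t ^ 2) := by
    rw [div_le_iff₀ hk]
    calc (1 : ℝ) = Real.exp (t ^ 2 / 2) * Real.exp (-(t ^ 2 / 2)) := by
          rw [← Real.exp_add]; simp
      _ ≤ Real.exp (t ^ 2) * (2 * 2.51 * (3 / 2 * (1 + t ^ 2)) * k) := by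
          refine mul_le_mul (Real.exp_le_exp.2 (by nlinarith)) ?_ (Real.exp_pos _).le
            (Real.exp_pos _).le
          refine (exp_le_mul_one_sub_cdf ht).trans ?_
          have h2 : 1 + t ≤ 3 / 2 * (1 + t ^ 2) := by nlinarith [sq_nonneg (t - 1 / 3)]
          have h3 := sqrt_two_pi_le
          gcongr
      _ ≤ 50 * Real.exp (t ^ 2) * (1 + t ^ 2) * k := by
          have : 0 < Real.exp (t ^ 2) * (1 + t ^ 2) * k := by positivity
          nlinarith
  have h2 : x / k ≤ 1 / k := by gcongr
  have h3 : 1 ≤ 1 / k := (one_le_div hk).2 hk1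
  have h4 : 0 ≤ x / k := by positivity
  rw [abs_le]
  constructor <;> linarith

theorem theorem1p2 {V : Type*} [Finite V] (G₀ : SimpleGraph V) (hG₀ : G₀.edgeSet.Nonempty)
    (n : ℕ) (hn : 4 * Nat.card V ^ 2 ≤ n) (p : unitInterval) (hp₀ : 0 < p) (hp₁ : p < 1)
    (t : ℝ) (ht : 0 ≤ t) :
    |(SimpleGraph.binomialRandom (Fin n) p).real {G | t < SubgraphCount.W G₀ n p G} /
        (1 - cdf (gaussianReal 0 1) t) - 1| ≤
      50 * SubgraphCount.c G₀ *
        Real.exp (SubgraphCount.c G₀ * t ^ 2 * SubgraphCount.s G₀ n p t) *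
        (1 + t ^ 2) * SubgraphCount.s G₀ n p t := by
  cases nonempty_fintype V
  rw [Nat.card_eq_fintype_card] at hn
  have hV : 0 < Fintype.card V := by
    obtain ⟨y, hy⟩ := hG₀
    induction y using Sym2.ind with
    | _ u v => exact Fintype.card_pos_iff.2 ⟨u⟩
  have hn0 : 0 < n := by nlinarith
  have hc := SubgraphCount.c_pos hG₀
  have hψ := SubgraphCount.psiMin_pos hG₀ hn0 hp₀
  have hp1 : (p : ℝ) < 1 := hp₁
  have hq : 0 < 1 - (p : ℝ) := by linarith
  set θ : ℝ := 1 / √((1 - (p : ℝ)) * SubgraphCount.psiMin G₀ n p) with hθ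
  have hθ0 : 0 < θ := by positivity
  set E : ℝ := Real.exp (5 * (SubgraphCount.D G₀ n : ℝ) * t / SubgraphCount.sigma G₀ n p) with hE
  have hE1 : 1 ≤ E := Real.one_le_exp
    (div_nonneg (mul_nonneg (by positivity) ht) (Real.sqrt_nonneg _))
  have hmin : t ≤ t / min (√(SubgraphCount.psiMin G₀ n p)) 1 :=
    le_div_self ht (lt_min (Real.sqrt_pos.2 hψ) one_pos) (min_le_right _ _)
  have hs : (1 + t) * θ * E ≤ SubgraphCount.s G₀ n p t := by
    rw [SubgraphCount.s]
    gcongr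
  have hs0 : 0 < (1 + t) * θ * E := by positivity
  set r := SubgraphCount.s G₀ n p t with hr
  set b := SubgraphCount.c G₀ with hb
  have hcs : b * ((1 + t) * θ * E) ≤ b * r := mul_le_mul_of_nonneg_left hs hc.le
  have hrhs : 50 * b * Real.exp (b * t ^ 2 * r) * (1 + t ^ 2) * r =
      50 * (b * r) * Real.exp (b * r * t ^ 2) * (1 + t ^ 2) := by
    rw [mul_right_comm b]
    ring
  rw [hrhs]
  obtain h | h := le_or_gt 1 (b * r)
  · -- The error term is too large for the claim to say more than a crude bound does.
    refine (NormalApprox.abs_div_one_sub_cdf_sub_one_le measureReal_nonneg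
      measureReal_le_one ht).trans ?_
    have h1 : Real.exp (t ^ 2) ≤ Real.exp (b * r * t ^ 2) :=
      Real.exp_le_exp.2 (le_mul_of_one_le_left (sq_nonneg t) h)
    have h2 : 50 ≤ 50 * (b * r) := by linarith
    gcongr
  · have hct : b * (1 + t) * θ ≤ 1 := by
      have : b * (1 + t) * θ ≤ b * (1 + t) * θ * E := le_mul_of_one_le_right (by positivity) hE1
      linarith
    refine (SubgraphCount.abs_tail_div_sub_one_le_of_small hG₀ hn hn0 hp₀ hp₁ ht hθ hct).trans ?_
    rw [← hE, ← hb]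
    have hbr : 0 ≤ b * r := le_trans (by positivity) hcs
    gcongr
    norm_num
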